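/- Let $k$ be a perfect field of odd characteristic $p$, let $W_2(k)$ be its ring of Witt vectors of length $2$, and let $\langle Z,J\rangle$ be a small category with a Grothendieck topology. Let $A$ be an associative unital algebra in the category of sheaves of $k$-vector spaces on $\langle Z,J\rangle$, and let $A^{(1)}={\sf Fr}^*A$ be its Frobenius twist, ${\sf Fr}:k\to k$, $\lambda\mapsto\lambda^p$. Let $A^\dagger$ be the DG $k$-algebra in sheaves on $\langle Z,J\rangle$ given by the complex $$ (A^{\otimes p})_{\mathbb{Z}/p\mathbb{Z}} \xrightarrow{\ T\ } (A^{\otimes p})^{\mathbb{Z}/p\mathbb{Z}}, \qquad T[x]=\sum_{j=0}^{p-1}\sigma^j x, $$ with the coinvariants in homological degree $1$ and the invariants in degree $0$, where the generator $\sigma$ of $\mathbb{Z}/p\mathbb{Z}$ acts on $A^{\otimes p}$ by cyclic permutation of the factors and the products are induced by the product of $A^{\otimes p}$ (so $r\cdot[x]=[rx]$ and $[x]\cdot r=[xr]$ for $r$ invariant, and the product of two elements of degree $1$ is $0$). Assume that there exists an associative unital $W_2(k)$-algebra $\widetilde{A}$ in sheaves on $\langle Z,J\rangle$ that is flat over $W_2(k)$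 and such that $\widetilde{A}/p\cong A^{(1)}$ as algebras over $W_2(k)/p=k$. Then the DG $k$-algebra $A^\dagger$ is formal: it is connected by a finite zigzag of quasi-isomorphisms of DG $k$-algebras in sheaves on $\langle Z,J\rangle$ to its homology algebra (with zero differential). Moreover, it is connected by such a zigzag to the trivial square-zero extension of $A^{(1)}$ by $A^{(1)}[1]$ with zero differential. -/

import Mathlib

open CategoryTheory Limits MonoidalCategory TensorProduct

universe w v u

noncomputable section

namespace NCHodge

/-! ### Differential graded algebras in a monoidal category -/

/-- A unital associative DG algebra in a preadditive monoidal category `C`, with homological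
grading by `ℤ`: the differential lowers the degree by one. -/
structure DGAlg (C : Type u) [Category.{v} C] [Preadditive C] [MonoidalCategory C] where
  /-- the underlying complex -/
  K : ChainComplex C ℤ
  /-- the unit -/
  one : 𝟙_ C ⟶ K.X 0
  /-- the graded components of the multiplication -/
  mul (i j n : ℤ) (h : i + j = n) : K.X i ⊗ K.X j ⟶ K.X n
  one_mul (i : ℤ) : (one ▷ K.X i) ≫ mul 0 i i (zero_add i) = (λ_ (K.X i)).hom
  mul_one (i : ℤ) : (K.X i ◁ one) ≫ mul i 0 i (add_zero i) = (ρ_ (K.X i)).hom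
  mul_assoc (i j l a b n : ℤ) (ha : i + j = a) (hb : j + l = b) (hn : a + l = n) :
    (mul i j a ha ▷ K.X l) ≫ mul a l n hn =
      (α_ (K.X i) (K.X j) (K.X l)).hom ≫ (K.X i ◁ mul j l b hb) ≫ mul i b n (by lia)
  one_d : one ≫ K.d 0 (-1) = 0
  leibniz (i j n : ℤ) (h : i + j = n) :
    mul i j n h ≫ K.d n (n - 1) =
      (K.d i (i - 1) ▷ K.X j) ≫ mul (i - 1) j (n - 1) (by lia) +
        i.negOnePow • ((K.X i ◁ K.d j (j - 1)) ≫ mul i (j - 1) (n - 1) (by lia))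

namespace DGAlg

section Basic

variable {C : Type u} [Category.{v} C] [Preadditive C] [MonoidalCategory C]

/-- A morphism of DG algebras: a map of complexes compatible with units and products. -/
@[ext]
structure Hom (X Y : DGAlg C) where
  /-- the underlying map of complexes -/
  f : X.K ⟶ Y.K
  one_f : X.one ≫ f.f 0 = Y.one
  mul_f (i j n : ℤ) (h : i + j = n) :
    X.mul i j n h ≫ f.f n = (f.f i ⊗ₘ f.f j) ≫ Y.mul i j n h

instance : Category (DGAlg C) where
  Hom := Hom
  id X := { f := 𝟙 _, one_f := by simp, mul_f := by simp }
  comp φ ψ :=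
    { f := φ.f ≫ ψ.f
      one_f := by rw [HomologicalComplex.comp_f, ← Category.assoc, φ.one_f, ψ.one_f]
      mul_f := fun i j n h => by
        rw [HomologicalComplex.comp_f, ← Category.assoc, φ.mul_f, Category.assoc, ψ.mul_f,
          ← Category.assoc, tensorHom_comp_tensorHom]
        simp }
  id_comp φ := Hom.ext (Category.id_comp _)
  comp_id φ := Hom.ext (Category.comp_id _)
  assoc φ ψ χ := Hom.ext (Category.assoc _ _ _)

@[simp] lemma id_f (X : DGAlg C) : Hom.f (𝟙 X) = 𝟙 X.K := rfl

@[simp] lemma comp_f {X Y W : DGAlg C} (φ : X ⟶ Y) (ψ : Y ⟶ W) :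
    Hom.f (φ ≫ ψ) = φ.f ≫ ψ.f := rfl

/-- Two DG algebras are quasi-isomorphic if they are connected by a finite zigzag of morphisms of
DG algebras that are quasi-isomorphisms of complexes. -/
def QuasiIsomorphic [CategoryWithHomology C] (X Y : DGAlg C) : Prop :=
  Relation.EqvGen (fun X Y : DGAlg C => ∃ φ : X ⟶ Y, QuasiIso φ.f) X Y

/-- `H` is the homology algebra of `X`: it has zero differential, its components are the homology
objects of `X`, its unit is the class of the unit of `X`, and the product of two classes is the
class of the product of representing cycles. -/
def IsHomologyOf [CategoryWithHomology C] (H X : DGAlg C) : Prop :=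
  (∀ i j : ℤ, H.K.d i j = 0) ∧
  ∃ e : ∀ n : ℤ, H.K.X n ≅ X.K.homology n,
    (∃ c : 𝟙_ C ⟶ X.K.cycles 0,
      c ≫ X.K.iCycles 0 = X.one ∧ c ≫ X.K.homologyπ 0 = H.one ≫ (e 0).hom) ∧
    ∀ (i j n : ℤ) (h : i + j = n),
      ∃ m : X.K.cycles i ⊗ X.K.cycles j ⟶ X.K.cycles n,
        m ≫ X.K.iCycles n = (X.K.iCycles i ⊗ₘ X.K.iCycles j) ≫ X.mul i j n h ∧
        m ≫ X.K.homologyπ n =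
          ((X.K.homologyπ i ≫ (e i).inv) ⊗ₘ (X.K.homologyπ j ≫ (e j).inv)) ≫
            H.mul i j n h ≫ (e n).hom

/-- A DG algebra is formal if it is quasi-isomorphic to its homology algebra. -/
def IsFormal [CategoryWithHomology C] (X : DGAlg C) : Prop :=
  ∃ H : DGAlg C, H.IsHomologyOf X ∧ X.QuasiIsomorphic H

end Basic

section Map

variable {C : Type u} [Category.{v} C] [Preadditive C] [MonoidalCategory C]
  {D : Type w} [Category.{v} D] [Preadditive D] [MonoidalCategory D]

open Functor.LaxMonoidal

/-- The image of a DG algebra under an additive lax monoidal functor. -/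
def map (F : C ⥤ D) [F.Additive] [F.LaxMonoidal] (X : DGAlg C) : DGAlg D where
  K :=
    { X := fun n => F.obj (X.K.X n)
      d := fun i j => F.map (X.K.d i j)
      shape := fun i j hij => by rw [X.K.shape i j hij, F.map_zero]
      d_comp_d' := fun i j l _ _ => by rw [← F.map_comp, X.K.d_comp_d, F.map_zero] }
  one := ε F ≫ F.map X.one
  mul i j n h := μ F (X.K.X i) (X.K.X j) ≫ F.map (X.mul i j n h)
  one_mul i := by
    rw [comp_whiskerRight, Category.assoc, μ_natural_left_assoc, ← F.map_comp, X.one_mul,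
      ← left_unitality]
  mul_one i := by
    rw [whiskerLeft_comp, Category.assoc, μ_natural_right_assoc, ← F.map_comp, X.mul_one,
      ← right_unitality]
  mul_assoc i j l a b n ha hb hn := by
    rw [comp_whiskerRight, Category.assoc, μ_natural_left_assoc, ← F.map_comp,
      X.mul_assoc i j l a b n ha hb hn, F.map_comp, associativity_assoc, whiskerLeft_comp,
      Category.assoc, μ_natural_right_assoc, F.map_comp]
  one_d := by
    rw [Category.assoc, ← F.map_comp, X.one_d, F.map_zero, comp_zero]
  leibniz i j n h := by
    have aux : ∀ (e : ℤˣ) {P Q : C} (S : D) (s : S ⟶ F.obj P) (f : P ⟶ Q) (g : P ⟶ Q),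
        s ≫ F.map (g + e • f) = s ≫ F.map g + e • (s ≫ F.map f) := by
      intro e P Q S s f g
      rw [F.map_add, Preadditive.comp_add]
      rcases Int.units_eq_one_or e with rfl | rfl
      · rw [one_smul, one_smul]
      · rw [Units.neg_smul, Units.neg_smul, one_smul, one_smul, F.map_neg, Preadditive.comp_neg]
    rw [Category.assoc, ← F.map_comp, X.leibniz, aux, F.map_comp, F.map_comp,
      μ_natural_left_assoc, μ_natural_right_assoc]

end Map

section Presheaf

variable {C : Type u} [Category.{v} C] [Preadditive C] [MonoidalCategory C]
  {I : Type w} [Category.{v} I]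

/-- The presheaf formed by the degree `n` components of a presheaf of DG algebras. -/
@[simps]
def ofFunctorX (P : I ⥤ DGAlg C) (n : ℤ) : I ⥤ C where
  obj U := (P.obj U).K.X n
  map g := (P.map g).f.f n
  map_id U := by simp
  map_comp g g' := by simp

/-- The complex of presheaves underlying a presheaf of DG algebras. -/
@[simps]
def ofFunctorK (P : I ⥤ DGAlg C) : ChainComplex (I ⥤ C) ℤ where
  X n := ofFunctorX P n
  d i j :=
    { app := fun U => (P.obj U).K.d i j
      naturality := fun U V g => (P.map g).f.comm i j }
  shape i j hij := by
    ext U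
    exact (P.obj U).K.shape i j hij
  d_comp_d' i j l _ _ := by
    ext U
    exact (P.obj U).K.d_comp_d i j l

/-- A presheaf (functor) of DG algebras, seen as a DG algebra in presheaves for the pointwise
tensor product. -/
def ofFunctor (P : I ⥤ DGAlg C) : DGAlg (I ⥤ C) where
  K := ofFunctorK P
  one :=
    { app := fun U => (P.obj U).one
      naturality := fun U V g => (Category.id_comp _).trans ((P.map g).one_f).symm }
  mul i j n h :=
    { app := fun U => (P.obj U).mul i j n h
      naturality := fun U V g => ((P.map g).mul_f i j n h).symm }
  one_mul i := NatTrans.ext (funext fun U => (P.obj U).one_mul i)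
  mul_one i := NatTrans.ext (funext fun U => (P.obj U).mul_one i)
  mul_assoc i j l a b n ha hb hn :=
    NatTrans.ext (funext fun U => (P.obj U).mul_assoc i j l a b n ha hb hn)
  one_d := NatTrans.ext (funext fun U => (P.obj U).one_d)
  leibniz i j n h := by
    refine NatTrans.ext (funext fun U => ?_)
    rw [NatTrans.app_add, NatTrans.app_units_zsmul]
    exact (P.obj U).leibniz i j n h

end Presheaf

end DGAlg

/-! ### DG algebras concentrated in degrees 0 and 1 -/

/-- The data of a DG algebra over `k` concentrated in homological degrees `0` and `1`:
a `k`-algebra `R` (degree `0`), an `R`-bimodule `M` (degree `1`), and a bimodule map `d : M → R`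
with `d m · m' = m · d m'` (the Leibniz rule for two elements of degree `1`, whose product is `0`
for degree reasons). -/
structure TwoTerm (k : Type u) [CommRing k] where
  /-- the component of degree `0` -/
  R : Type u
  /-- the component of degree `1` -/
  M : Type u
  [ringR : Ring R]
  [algR : Algebra k R]
  [grpM : AddCommGroup M]
  [modM : Module k M]
  /-- the left action of `R` on `M` -/
  lact : R →ₗ[k] M →ₗ[k] M
  /-- the right action of `R` on `M` -/
  ract : M →ₗ[k] R →ₗ[k] M
  /-- the differential -/
  d : M →ₗ[k] R
  one_lact (m : M) : lact 1 m = m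
  ract_one (m : M) : ract m 1 = m
  mul_lact (r s : R) (m : M) : lact (r * s) m = lact r (lact s m)
  ract_mul (m : M) (r s : R) : ract m (r * s) = ract (ract m r) s
  lact_ract (r : R) (m : M) (s : R) : ract (lact r m) s = lact r (ract m s)
  d_lact (r : R) (m : M) : d (lact r m) = r * d m
  d_ract (m : M) (r : R) : d (ract m r) = d m * r
  peiffer (m m' : M) : lact (d m) m' = ract m (d m')

attribute [instance] TwoTerm.ringR TwoTerm.algR TwoTerm.grpM TwoTerm.modM

namespace TwoTerm

variable {k : Type u} [CommRing k]

/-- Morphisms of two-term DG algebras. -/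
@[ext]
structure Hom (E F : TwoTerm k) where
  /-- the component of degree `0` -/
  f : E.R →ₐ[k] F.R
  /-- the component of degree `1` -/
  g : E.M →ₗ[k] F.M
  g_lact (r : E.R) (m : E.M) : g (E.lact r m) = F.lact (f r) (g m)
  g_ract (m : E.M) (r : E.R) : g (E.ract m r) = F.ract (g m) (f r)
  f_d (m : E.M) : f (E.d m) = F.d (g m)

instance : Category (TwoTerm k) where
  Hom := Hom
  id E :=
    { f := AlgHom.id k _
      g := LinearMap.id
      g_lact := fun _ _ => rfl
      g_ract := fun _ _ => rfl
      f_d := fun _ => rfl }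
  comp φ ψ :=
    { f := ψ.f.comp φ.f
      g := ψ.g.comp φ.g
      g_lact := fun r m => by simp [φ.g_lact, ψ.g_lact]
      g_ract := fun r m => by simp [φ.g_ract, ψ.g_ract]
      f_d := fun m => by simp [φ.f_d, ψ.f_d] }

@[simp] lemma id_f (E : TwoTerm k) : Hom.f (𝟙 E) = AlgHom.id k _ := rfl
@[simp] lemma id_g (E : TwoTerm k) : Hom.g (𝟙 E) = LinearMap.id := rfl
@[simp] lemma comp_f {E F G : TwoTerm k} (φ : E ⟶ F) (ψ : F ⟶ G) :
    Hom.f (φ ≫ ψ) = ψ.f.comp φ.f := rfl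
@[simp] lemma comp_g {E F G : TwoTerm k} (φ : E ⟶ F) (ψ : F ⟶ G) :
    Hom.g (φ ≫ ψ) = ψ.g.comp φ.g := rfl

/-- The graded components. -/
def X (E : TwoTerm k) : ℤ → ModuleCat.{u} k
  | 0 => ModuleCat.of k E.R
  | 1 => ModuleCat.of k E.M
  | _ => ModuleCat.of k PUnit.{u + 1}

/-- The components of the differential. -/
def diff (E : TwoTerm k) : ∀ i j : ℤ, E.X i ⟶ E.X j
  | 1, 0 => ModuleCat.ofHom E.d
  | _, _ => 0

/-- The components of the multiplication. -/
def mulHom (E : TwoTerm k) : ∀ i j n : ℤ, E.X i ⊗ E.X j ⟶ E.X n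
  | 0, 0, 0 => ModuleCat.ofHom (TensorProduct.lift (LinearMap.mul k E.R))
  | 0, 1, 1 => ModuleCat.ofHom (TensorProduct.lift E.lact)
  | 1, 0, 1 => ModuleCat.ofHom (TensorProduct.lift E.ract)
  | _, _, _ => 0

lemma X_cases (E : TwoTerm k) (i : ℤ) : i = 0 ∨ i = 1 ∨ Subsingleton (E.X i) := by
  by_cases h0 : i = 0
  · exact Or.inl h0
  by_cases h1 : i = 1
  · exact Or.inr (Or.inl h1)
  refine Or.inr (Or.inr ?_)
  unfold X
  split
  · exact absurd rfl h0
  · exact absurd rfl h1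
  · exact inferInstanceAs (Subsingleton PUnit)

lemma isZero_X (E : TwoTerm k) {i : ℤ} (h0 : i ≠ 0) (h1 : i ≠ 1) : IsZero (E.X i) := by
  rcases E.X_cases i with h | h | h
  · exact absurd h h0
  · exact absurd h h1
  · exact ModuleCat.isZero_of_subsingleton (E.X i)

lemma diff_eq_zero (E : TwoTerm k) {i j : ℤ} (h : i = 1 → j = 0 → False) : E.diff i j = 0 := by
  rcases E.X_cases i with rfl | rfl | hi
  · rcases E.X_cases j with rfl | rfl | hj
    · rfl
    · rfl
    · exact (ModuleCat.isZero_of_subsingleton (E.X j)).eq_of_tgt _ _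
  · rcases E.X_cases j with rfl | rfl | hj
    · exact (h rfl rfl).elim
    · rfl
    · exact (ModuleCat.isZero_of_subsingleton (E.X j)).eq_of_tgt _ _
  · exact (ModuleCat.isZero_of_subsingleton (E.X i)).eq_of_src _ _

/-- The underlying complex. -/
def complex (E : TwoTerm k) : ChainComplex (ModuleCat.{u} k) ℤ where
  X := E.X
  d := E.diff
  shape i j hij := E.diff_eq_zero fun hi hj => hij (by subst hi hj; simp)
  d_comp_d' i j l _ _ := by
    by_cases hj : j = 0
    · rw [E.diff_eq_zero (i := j) (j := l) (by lia), comp_zero]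
    · rw [E.diff_eq_zero (i := i) (j := j) (by lia), zero_comp]

open ModuleCat.MonoidalCategory in
lemma mulHom_assoc (E : TwoTerm k) (i j l a b n : ℤ) (ha : i + j = a) (hb : j + l = b)
    (hn : a + l = n) :
    (E.mulHom i j a ▷ E.X l) ≫ E.mulHom a l n =
      (α_ (E.X i) (E.X j) (E.X l)).hom ≫ (E.X i ◁ E.mulHom j l b) ≫ E.mulHom i b n := by
  rcases E.X_cases i with rfl | rfl | hi
  · rcases E.X_cases j with rfl | rfl | hj
    · rcases E.X_cases l with rfl | rfl | hl
      · obtain ⟨rfl, rfl, rfl⟩ : a = 0 ∧ b = 0 ∧ n = 0 := by lia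
        exact tensor_ext₃' fun (x y z : E.R) => _root_.mul_assoc x y z
      · obtain ⟨rfl, rfl, rfl⟩ : a = 0 ∧ b = 1 ∧ n = 1 := by lia
        exact tensor_ext₃' fun (x y : E.R) (z : E.M) => E.mul_lact x y z
      · exact tensor_ext₃' fun x y z => by
          rw [Subsingleton.elim z 0, tmul_zero, map_zero, map_zero]
    · rcases E.X_cases l with rfl | rfl | hl
      · obtain ⟨rfl, rfl, rfl⟩ : a = 1 ∧ b = 1 ∧ n = 1 := by lia
        exact tensor_ext₃' fun (x : E.R) (y : E.M) (z : E.R) => E.lact_ract x y z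
      · obtain ⟨rfl, rfl, rfl⟩ : a = 1 ∧ b = 2 ∧ n = 2 := by lia
        exact (E.isZero_X (by lia) (by lia)).eq_of_tgt _ _
      · exact tensor_ext₃' fun x y z => by
          rw [Subsingleton.elim z 0, tmul_zero, map_zero, map_zero]
    · exact tensor_ext₃' fun x y z => by
        rw [Subsingleton.elim y 0, tmul_zero, zero_tmul, map_zero, map_zero]
  · rcases E.X_cases j with rfl | rfl | hj
    · rcases E.X_cases l with rfl | rfl | hl
      · obtain ⟨rfl, rfl, rfl⟩ : a = 1 ∧ b = 0 ∧ n = 1 := by lia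
        exact tensor_ext₃' fun (x : E.M) (y z : E.R) => (E.ract_mul x y z).symm
      · exact (E.isZero_X (by lia) (by lia)).eq_of_tgt _ _
      · exact tensor_ext₃' fun x y z => by
          rw [Subsingleton.elim z 0, tmul_zero, map_zero, map_zero]
    · rcases E.X_cases l with rfl | rfl | hl
      · exact (E.isZero_X (by lia) (by lia)).eq_of_tgt _ _
      · exact (E.isZero_X (by lia) (by lia)).eq_of_tgt _ _
      · exact tensor_ext₃' fun x y z => by
          rw [Subsingleton.elim z 0, tmul_zero, map_zero, map_zero]
    · exact tensor_ext₃' fun x y z => by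
        rw [Subsingleton.elim y 0, tmul_zero, zero_tmul, map_zero, map_zero]
  · exact tensor_ext₃' fun x y z => by
      rw [Subsingleton.elim x 0, zero_tmul, zero_tmul, map_zero, map_zero]

open ModuleCat.MonoidalCategory in
lemma mulHom_leibniz (E : TwoTerm k) (i j n : ℤ) (h : i + j = n) :
    E.mulHom i j n ≫ E.diff n (n - 1) =
      (E.diff i (i - 1) ▷ E.X j) ≫ E.mulHom (i - 1) j (n - 1) +
        i.negOnePow • ((E.X i ◁ E.diff j (j - 1)) ≫ E.mulHom i (j - 1) (n - 1)) := by
  rcases E.X_cases i with rfl | rfl | hi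
  · rcases E.X_cases j with rfl | rfl | hj
    · obtain rfl : n = 0 := by lia
      exact (E.isZero_X (by lia) (by lia)).eq_of_tgt _ _
    · obtain rfl : n = 1 := by lia
      rw [Int.negOnePow_zero, one_smul]
      refine tensor_ext fun (x : E.R) (y : E.M) => ?_
      change E.d (E.lact x y) = 0 + x * E.d y
      rw [E.d_lact, zero_add]
    · exact tensor_ext fun x y => by rw [Subsingleton.elim y 0, tmul_zero, map_zero, map_zero]
  · rcases E.X_cases j with rfl | rfl | hj
    · obtain rfl : n = 1 := by lia
      rw [Int.negOnePow_one, Units.neg_smul, one_smul]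
      refine tensor_ext fun (x : E.M) (y : E.R) => ?_
      change E.d (E.ract x y) = E.d x * y + -0
      rw [E.d_ract, neg_zero, add_zero]
    · obtain rfl : n = 2 := by lia
      rw [Int.negOnePow_one, Units.neg_smul, one_smul]
      refine tensor_ext fun (x y : E.M) => ?_
      change (0 : E.M) = E.lact (E.d x) y + -(E.ract x (E.d y))
      rw [E.peiffer, add_neg_cancel]
    · exact tensor_ext fun x y => by rw [Subsingleton.elim y 0, tmul_zero, map_zero, map_zero]
  · exact tensor_ext fun x y => by rw [Subsingleton.elim x 0, zero_tmul, map_zero, map_zero]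

open ModuleCat.MonoidalCategory in
/-- A two-term DG algebra, as a DG algebra in the category of `k`-modules. -/
def toDG (E : TwoTerm k) : DGAlg (ModuleCat.{u} k) where
  K := E.complex
  one := ModuleCat.ofHom (Algebra.linearMap k E.R)
  mul i j n _ := E.mulHom i j n
  one_mul i := by
    rcases E.X_cases i with rfl | rfl | hi
    · refine tensor_ext fun (r : k) (x : E.R) => ?_
      exact (Algebra.smul_def r x).symm
    · refine tensor_ext fun (r : k) (x : E.M) => ?_
      change E.lact (algebraMap k E.R r) x = r • x
      rw [Algebra.algebraMap_eq_smul_one, map_smul, LinearMap.smul_apply, E.one_lact]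
    · exact (ModuleCat.isZero_of_subsingleton (E.X i)).eq_of_tgt _ _
  mul_one i := by
    rcases E.X_cases i with rfl | rfl | hi
    · refine tensor_ext fun (x : E.R) (r : k) => ?_
      exact ((Algebra.smul_def r x).trans (Algebra.commutes r x)).symm
    · refine tensor_ext fun (x : E.M) (r : k) => ?_
      change E.ract x (algebraMap k E.R r) = r • x
      rw [Algebra.algebraMap_eq_smul_one, map_smul, E.ract_one]
    · exact (ModuleCat.isZero_of_subsingleton (E.X i)).eq_of_tgt _ _
  mul_assoc i j l a b n ha hb hn := E.mulHom_assoc i j l a b n ha hb hn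
  one_d := comp_zero
  leibniz i j n h := E.mulHom_leibniz i j n h

/-- The components of the map of complexes given by a morphism of two-term DG algebras. -/
def mapX {E F : TwoTerm k} (φ : E ⟶ F) : ∀ i : ℤ, E.X i ⟶ F.X i
  | 0 => ModuleCat.ofHom (Hom.f φ).toLinearMap
  | 1 => ModuleCat.ofHom (Hom.g φ)
  | _ => 0

lemma mapX_diff {E F : TwoTerm k} (φ : E ⟶ F) (i j : ℤ) :
    mapX φ i ≫ F.diff i j = E.diff i j ≫ mapX φ j := by
  by_cases h : i = 1 ∧ j = 0
  · obtain ⟨rfl, rfl⟩ := h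
    exact ModuleCat.hom_ext (LinearMap.ext fun m => ((Hom.f_d φ) m).symm)
  · rw [E.diff_eq_zero (by lia), F.diff_eq_zero (by lia), comp_zero, zero_comp]

open ModuleCat.MonoidalCategory in
lemma mapX_mul {E F : TwoTerm k} (φ : E ⟶ F) (i j n : ℤ) (h : i + j = n) :
    E.mulHom i j n ≫ mapX φ n = (mapX φ i ⊗ₘ mapX φ j) ≫ F.mulHom i j n := by
  rcases E.X_cases i with rfl | rfl | hi
  · rcases E.X_cases j with rfl | rfl | hj
    · obtain rfl : n = 0 := by lia
      exact tensor_ext fun (x y : E.R) => map_mul (Hom.f φ) x y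
    · obtain rfl : n = 1 := by lia
      exact tensor_ext fun (x : E.R) (y : E.M) => Hom.g_lact φ x y
    · exact tensor_ext fun x y => by rw [Subsingleton.elim y 0, tmul_zero, map_zero, map_zero]
  · rcases E.X_cases j with rfl | rfl | hj
    · obtain rfl : n = 1 := by lia
      exact tensor_ext fun (x : E.M) (y : E.R) => Hom.g_ract φ x y
    · exact (F.isZero_X (by lia) (by lia)).eq_of_tgt _ _
    · exact tensor_ext fun x y => by rw [Subsingleton.elim y 0, tmul_zero, map_zero, map_zero]
  · exact tensor_ext fun x y => by rw [Subsingleton.elim x 0, zero_tmul, map_zero, map_zero]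

lemma mapX_id (E : TwoTerm k) (i : ℤ) : mapX (𝟙 E) i = 𝟙 (E.X i) := by
  rcases E.X_cases i with rfl | rfl | hi
  · rfl
  · rfl
  · exact (ModuleCat.isZero_of_subsingleton (E.X i)).eq_of_tgt _ _

lemma mapX_comp {E F G : TwoTerm k} (φ : E ⟶ F) (ψ : F ⟶ G) (i : ℤ) :
    mapX (φ ≫ ψ) i = mapX φ i ≫ mapX ψ i := by
  rcases E.X_cases i with rfl | rfl | hi
  · rfl
  · rfl
  · exact (ModuleCat.isZero_of_subsingleton (E.X i)).eq_of_src _ _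

variable (k) in
/-- The functor sending a two-term DG algebra to the corresponding DG algebra. -/
def toDGFunctor : TwoTerm k ⥤ DGAlg (ModuleCat.{u} k) where
  obj E := E.toDG
  map φ :=
    { f := { f := mapX φ, comm' := fun i j _ => mapX_diff φ i j }
      one_f := ModuleCat.hom_ext (LinearMap.ext fun r => (Hom.f φ).commutes r)
      mul_f := fun i j n h => mapX_mul φ i j n h }
  map_id E := DGAlg.Hom.ext (HomologicalComplex.hom_ext _ _ fun i => mapX_id E i)
  map_comp φ ψ := DGAlg.Hom.ext (HomologicalComplex.hom_ext _ _ fun i => mapX_comp φ ψ i)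

/-- The trivial square-zero extension of `B` by `B[1]`: the algebra `B` in degree `0`, the diagonal
bimodule `B` in degree `1`, and zero differential. -/
def squareZero (B : AlgCat.{u} k) : TwoTerm k where
  R := B
  M := B
  lact := LinearMap.mul k B
  ract := LinearMap.mul k B
  d := 0
  one_lact m := one_mul m
  ract_one m := mul_one m
  mul_lact r s m := mul_assoc r s m
  ract_mul m r s := (mul_assoc m r s).symm
  lact_ract r m s := mul_assoc r m s
  d_lact r m := (mul_zero r).symm
  d_ract m r := (zero_mul r).symm
  peiffer m m' := by simp

variable (k) in
/-- Functoriality of the trivial square-zero extension. -/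
def squareZeroFunctor : AlgCat.{u} k ⥤ TwoTerm k where
  obj B := squareZero B
  map φ :=
    { f := φ.hom
      g := φ.hom.toLinearMap
      g_lact := map_mul φ.hom
      g_ract := map_mul φ.hom
      f_d := fun _ => map_zero φ.hom }

/-! ### The Tate complex of an algebra with an action of a cyclic group -/

section Tate

variable {T : Type u} [Ring T] [Algebra k T] (σ : T →ₐ[k] T)

/-- The subalgebra of invariants of `σ`. -/
abbrev Inv : Subalgebra k T := AlgHom.equalizer σ (AlgHom.id k T)

/-- The coinvariants of `σ`: the quotient of `T` by all `σ x - x`. -/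
abbrev Coinv : Type u := T ⧸ LinearMap.range (σ.toLinearMap - LinearMap.id)

lemma mem_inv {x : T} : x ∈ Inv σ ↔ σ x = x := Iff.rfl

lemma coinv_eq (x : T) :
    (Submodule.Quotient.mk (σ x) : Coinv σ) = Submodule.Quotient.mk x :=
  (Submodule.Quotient.eq _).2 ⟨x, rfl⟩

lemma le_comap_mulLeft (r : Inv σ) :
    LinearMap.range (σ.toLinearMap - LinearMap.id) ≤
      (LinearMap.range (σ.toLinearMap - LinearMap.id)).comap (LinearMap.mulLeft k (r : T)) := by
  rintro _ ⟨x, rfl⟩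
  refine ⟨r * x, ?_⟩
  have hr : σ r = r := r.2
  simp [mul_sub, hr]

lemma le_comap_mulRight (r : Inv σ) :
    LinearMap.range (σ.toLinearMap - LinearMap.id) ≤
      (LinearMap.range (σ.toLinearMap - LinearMap.id)).comap (LinearMap.mulRight k (r : T)) := by
  rintro _ ⟨x, rfl⟩
  refine ⟨x * r, ?_⟩
  have hr : σ r = r := r.2
  simp [sub_mul, hr]

/-- Left multiplication of coinvariants by invariants: `r · [x] = [r x]`. -/
def coinvL : Inv σ →ₗ[k] Coinv σ →ₗ[k] Coinv σ where
  toFun r := Submodule.mapQ _ _ (LinearMap.mulLeft k (r : T)) (le_comap_mulLeft σ r)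
  map_add' r s := by ext x; simp [add_mul]
  map_smul' c r := by ext x; simp

/-- Right multiplication of coinvariants by invariants: `[x] · r = [x r]`. -/
def coinvR : Coinv σ →ₗ[k] Inv σ →ₗ[k] Coinv σ :=
  LinearMap.flip
    { toFun := fun r =>
        Submodule.mapQ _ _ (LinearMap.mulRight k (r : T)) (le_comap_mulRight σ r)
      map_add' := fun r s => by ext x; simp [mul_add]
      map_smul' := fun c r => by ext x; simp }

lemma coinvL_mk (r : Inv σ) (x : T) :
    coinvL σ r (Submodule.Quotient.mk x) = Submodule.Quotient.mk ((r : T) * x) := rfl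

lemma coinvR_mk (r : Inv σ) (x : T) :
    coinvR σ (Submodule.Quotient.mk x) r = Submodule.Quotient.mk (x * (r : T)) := rfl

/-- The endomorphism `1 + σ + ⋯ + σ ^ (n - 1)` of `T`. -/
def norm (n : ℕ) : T →ₗ[k] T := ∑ j ∈ Finset.range n, (σ ^ j).toLinearMap

lemma norm_apply (n : ℕ) (x : T) : norm σ n x = ∑ j ∈ Finset.range n, (σ ^ j) x := by
  simp [norm]

lemma pow_inv (r : Inv σ) (j : ℕ) : (σ ^ j) (r : T) = r := by
  have hr : σ r = r := r.2
  induction j with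
  | zero => rfl
  | succ j ih => rw [pow_succ, AlgHom.mul_apply, hr, ih]

lemma coinv_pow (j : ℕ) (x : T) :
    (Submodule.Quotient.mk ((σ ^ j) x) : Coinv σ) = Submodule.Quotient.mk x := by
  induction j with
  | zero => rfl
  | succ j ih => rw [pow_succ', AlgHom.mul_apply, coinv_eq, ih]

variable {σ}

lemma norm_sigma {n : ℕ} (h : σ ^ n = 1) (x : T) : norm σ n (σ x) = norm σ n x := by
  rw [norm_apply, norm_apply]
  have h1 : ∀ j, (σ ^ j) (σ x) = (σ ^ (j + 1)) x := fun j => by rw [pow_succ]; rfl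
  simp only [h1]
  have h2 := Finset.sum_range_succ' (fun j => (σ ^ j) x) n
  rw [Finset.sum_range_succ, h] at h2
  exact (add_right_cancel h2).symm

lemma sigma_norm {n : ℕ} (h : σ ^ n = 1) (x : T) : σ (norm σ n x) = norm σ n x := by
  have h1 : σ (norm σ n x) = norm σ n (σ x) := by
    rw [norm_apply, norm_apply, map_sum]
    refine Finset.sum_congr rfl fun j _ => ?_
    rw [← AlgHom.mul_apply, ← AlgHom.mul_apply, ← pow_succ', ← pow_succ]
  rw [h1, norm_sigma h]

/-- The trace map `T` from coinvariants to invariants, `[x] ↦ x + σ x + ⋯ + σ ^ (n - 1) x`. -/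
def trace {n : ℕ} (h : σ ^ n = 1) : Coinv σ →ₗ[k] Inv σ :=
  Submodule.liftQ _
    ((norm σ n).codRestrict (Subalgebra.toSubmodule (Inv σ)) fun x => sigma_norm h x) (by
      rintro _ ⟨x, rfl⟩
      refine Subtype.ext ?_
      change norm σ n (σ x - x) = 0
      rw [map_sub, norm_sigma h, sub_self])

lemma trace_mk {n : ℕ} (h : σ ^ n = 1) (x : T) :
    (trace h (Submodule.Quotient.mk x) : T) = norm σ n x := rfl

lemma coinv_norm {n : ℕ} (h : σ ^ n = 1) (x y : T) :
    (Submodule.Quotient.mk (norm σ n x * y) : Coinv σ) =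
      Submodule.Quotient.mk (x * norm σ n y) := by
  have key : ∀ j ≤ n, (Submodule.Quotient.mk ((σ ^ j) x * y) : Coinv σ) =
      Submodule.Quotient.mk (x * (σ ^ (n - j)) y) := by
    intro j hj
    rw [← coinv_pow σ (n - j), map_mul, ← AlgHom.mul_apply, ← pow_add, Nat.sub_add_cancel hj, h]
    rfl
  have h1 := Finset.sum_flip (n := n)
    fun j => (Submodule.Quotient.mk (x * (σ ^ j) y) : Coinv σ)
  rw [Finset.sum_range_succ, Finset.sum_range_succ, Nat.sub_self, h, pow_zero] at h1
  have h2 := add_right_cancel h1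
  rw [norm_apply, norm_apply, Finset.sum_mul, Finset.mul_sum]
  simp only [← Submodule.mkQ_apply] at key h2 ⊢
  rw [map_sum, map_sum, ← h2]
  exact Finset.sum_congr rfl fun j hj => key j (Finset.mem_range.1 hj).le

/-- The Tate complex `T_{ℤ/n} → T^{ℤ/n}` of an algebra with an automorphism `σ` such that
`σ ^ n = 1`, as a DG algebra: invariants in degree `0`, coinvariants in degree `1`, the
differential is the trace map, and products are induced by the product of `T`. -/
def tate {n : ℕ} (h : σ ^ n = 1) : TwoTerm k where
  R := Inv σ
  M := Coinv σ
  lact := coinvL σ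
  ract := coinvR σ
  d := trace h
  one_lact m := by
    obtain ⟨x, rfl⟩ := Submodule.Quotient.mk_surjective _ m
    simp [coinvL_mk]
  ract_one m := by
    obtain ⟨x, rfl⟩ := Submodule.Quotient.mk_surjective _ m
    simp [coinvR_mk]
  mul_lact r s m := by
    obtain ⟨x, rfl⟩ := Submodule.Quotient.mk_surjective _ m
    simp [coinvL_mk, mul_assoc]
  ract_mul m r s := by
    obtain ⟨x, rfl⟩ := Submodule.Quotient.mk_surjective _ m
    simp [coinvR_mk, mul_assoc]
  lact_ract r m s := by
    obtain ⟨x, rfl⟩ := Submodule.Quotient.mk_surjective _ m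
    simp [coinvL_mk, coinvR_mk, mul_assoc]
  d_lact r m := by
    obtain ⟨x, rfl⟩ := Submodule.Quotient.mk_surjective _ m
    refine Subtype.ext ?_
    rw [coinvL_mk, trace_mk, Subalgebra.coe_mul, trace_mk, norm_apply, norm_apply, Finset.mul_sum]
    exact Finset.sum_congr rfl fun j _ => by rw [map_mul, pow_inv]
  d_ract m r := by
    obtain ⟨x, rfl⟩ := Submodule.Quotient.mk_surjective _ m
    refine Subtype.ext ?_
    rw [coinvR_mk, trace_mk, Subalgebra.coe_mul, trace_mk, norm_apply, norm_apply, Finset.sum_mul]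
    exact Finset.sum_congr rfl fun j _ => by rw [map_mul, pow_inv]
  peiffer m m' := by
    obtain ⟨x, rfl⟩ := Submodule.Quotient.mk_surjective _ m
    obtain ⟨y, rfl⟩ := Submodule.Quotient.mk_surjective _ m'
    rw [coinvL_mk, coinvR_mk, trace_mk, trace_mk, coinv_norm h]

/-- Functoriality of the Tate complex in equivariant algebra maps. -/
def tateMap {T' : Type u} [Ring T'] [Algebra k T'] {σ' : T' →ₐ[k] T'} {n : ℕ} (h : σ ^ n = 1)
    (h' : σ' ^ n = 1) (φ : T →ₐ[k] T') (hφ : ∀ x, φ (σ x) = σ' (φ x)) : tate h ⟶ tate h' where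
  f := (φ.comp (Inv σ).val).codRestrict (Inv σ') fun x => by
    have hx : σ x = x := x.2
    change σ' (φ x) = φ x
    rw [← hφ, hx]
  g := Submodule.mapQ _ _ φ.toLinearMap (by
    rintro _ ⟨x, rfl⟩
    exact ⟨φ x, by simp [hφ]⟩)
  g_lact r m := by
    obtain ⟨x, rfl⟩ := Submodule.Quotient.mk_surjective _ m
    exact congrArg Submodule.Quotient.mk (map_mul φ r.1 x)
  g_ract m r := by
    obtain ⟨x, rfl⟩ := Submodule.Quotient.mk_surjective _ m
    exact congrArg Submodule.Quotient.mk (map_mul φ x r.1)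
  f_d m := by
    obtain ⟨x, rfl⟩ := Submodule.Quotient.mk_surjective _ m
    refine Subtype.ext ?_
    change φ (norm σ n x) = norm σ' n (φ x)
    rw [norm_apply, norm_apply, map_sum]
    refine Finset.sum_congr rfl fun j hj => ?_
    clear hj
    induction j with
    | zero => rfl
    | succ j ih => rw [pow_succ', pow_succ', AlgHom.mul_apply, AlgHom.mul_apply, hφ, ih]

end Tate

/-! ### Tensor powers and the DG algebra `A†` -/

section TensorPower

variable (k)

/-- The tensor power `B^{⊗ n}` over `k`, with factors indexed by `ℤ/n`. -/
abbrev TPow (n : ℕ) (B : Type u) [Ring B] [Algebra k B] : Type u := ⨂[k] _ : ZMod n, B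

/-- The generator of `ℤ/n` acting on the algebra `B^{⊗ n}` by cyclic permutation of factors. -/
def cyc (n : ℕ) (B : Type u) [Ring B] [Algebra k B] : TPow k n B →ₐ[k] TPow k n B :=
  PiTensorProduct.liftAlgHom
    ((PiTensorProduct.tprod k).domDomCongr (Equiv.addRight (1 : ZMod n)))
    rfl (fun _ _ => (PiTensorProduct.tprod_mul_tprod _ _).symm)

@[simp] lemma cyc_tprod (n : ℕ) (B : Type u) [Ring B] [Algebra k B] (b : ZMod n → B) :
    cyc k n B (PiTensorProduct.tprod k b) = PiTensorProduct.tprod k fun i => b (i + 1) :=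
  PiTensorProduct.lift.tprod _

lemma cyc_pow_tprod (n : ℕ) (B : Type u) [Ring B] [Algebra k B] (j : ℕ) (b : ZMod n → B) :
    (cyc k n B ^ j) (PiTensorProduct.tprod k b) = PiTensorProduct.tprod k fun i => b (i + j) := by
  induction j generalizing b with
  | zero => simp
  | succ j ih =>
    rw [pow_succ, AlgHom.mul_apply, cyc_tprod, ih]
    congr 1
    funext i
    congr 1
    push_cast
    ring

lemma cyc_pow (n : ℕ) (B : Type u) [Ring B] [Algebra k B] : cyc k n B ^ n = 1 := by
  refine AlgHom.toLinearMap_injective (PiTensorProduct.ext (MultilinearMap.ext fun b => ?_))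
  change (cyc k n B ^ n) (PiTensorProduct.tprod k b) = PiTensorProduct.tprod k b
  rw [cyc_pow_tprod]
  simp

/-- Functoriality of tensor powers. -/
def tpowMap (n : ℕ) {B B' : Type u} [Ring B] [Algebra k B] [Ring B'] [Algebra k B']
    (φ : B →ₐ[k] B') : TPow k n B →ₐ[k] TPow k n B' :=
  PiTensorProduct.liftAlgHom
    ((PiTensorProduct.tprod k).compLinearMap fun _ => φ.toLinearMap)
    (congrArg (PiTensorProduct.tprod k) (funext fun _ => map_one φ))
    (fun x y => (congrArg (PiTensorProduct.tprod k) (funext fun i => map_mul φ (x i) (y i))).trans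
      (PiTensorProduct.tprod_mul_tprod _ _).symm)

@[simp] lemma tpowMap_tprod (n : ℕ) {B B' : Type u} [Ring B] [Algebra k B] [Ring B']
    [Algebra k B'] (φ : B →ₐ[k] B') (b : ZMod n → B) :
    tpowMap k n φ (PiTensorProduct.tprod k b) = PiTensorProduct.tprod k fun i => φ (b i) :=
  PiTensorProduct.lift.tprod _

lemma tpowMap_cyc (n : ℕ) {B B' : Type u} [Ring B] [Algebra k B] [Ring B'] [Algebra k B']
    (φ : B →ₐ[k] B') (x : TPow k n B) :
    tpowMap k n φ (cyc k n B x) = cyc k n B' (tpowMap k n φ x) := by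
  suffices H : (tpowMap k n φ).comp (cyc k n B) = (cyc k n B').comp (tpowMap k n φ) from
    DFunLike.congr_fun H x
  refine AlgHom.toLinearMap_injective (PiTensorProduct.ext (MultilinearMap.ext fun b => ?_))
  change tpowMap k n φ (cyc k n B (PiTensorProduct.tprod k b)) =
    cyc k n B' (tpowMap k n φ (PiTensorProduct.tprod k b))
  rw [cyc_tprod, tpowMap_tprod, tpowMap_tprod, cyc_tprod]

lemma tpowMap_id (n : ℕ) (B : Type u) [Ring B] [Algebra k B] (x : TPow k n B) :
    tpowMap k n (AlgHom.id k B) x = x := by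
  suffices H : tpowMap k n (AlgHom.id k B) = AlgHom.id k _ from DFunLike.congr_fun H x
  refine AlgHom.toLinearMap_injective (PiTensorProduct.ext (MultilinearMap.ext fun b => ?_))
  exact tpowMap_tprod k n _ b

lemma tpowMap_comp (n : ℕ) {B B' B'' : Type u} [Ring B] [Algebra k B] [Ring B'] [Algebra k B']
    [Ring B''] [Algebra k B''] (φ : B →ₐ[k] B') (ψ : B' →ₐ[k] B'') (x : TPow k n B) :
    tpowMap k n (ψ.comp φ) x = tpowMap k n ψ (tpowMap k n φ x) := by
  suffices H : tpowMap k n (ψ.comp φ) = (tpowMap k n ψ).comp (tpowMap k n φ) from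
    DFunLike.congr_fun H x
  refine AlgHom.toLinearMap_injective (PiTensorProduct.ext (MultilinearMap.ext fun b => ?_))
  change tpowMap k n (ψ.comp φ) (PiTensorProduct.tprod k b) =
    tpowMap k n ψ (tpowMap k n φ (PiTensorProduct.tprod k b))
  rw [tpowMap_tprod, tpowMap_tprod, tpowMap_tprod]
  rfl

/-- The functor sending a `k`-algebra `B` to the DG algebra `(B^{⊗ n})_{ℤ/n} → (B^{⊗ n})^{ℤ/n}`. -/
def dagFunctor (n : ℕ) : AlgCat.{u} k ⥤ TwoTerm k where
  obj B := tate (cyc_pow k n B)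
  map φ := tateMap (cyc_pow k n _) (cyc_pow k n _) (tpowMap k n φ.hom) (tpowMap_cyc k n φ.hom)
  map_id B := by
    refine Hom.ext (AlgHom.ext fun x => Subtype.ext (tpowMap_id k n B x.1))
      (LinearMap.ext fun m => ?_)
    obtain ⟨x, rfl⟩ := Submodule.Quotient.mk_surjective _ m
    exact congrArg Submodule.Quotient.mk (tpowMap_id k n B x)
  map_comp φ ψ := by
    refine Hom.ext (AlgHom.ext fun x => Subtype.ext (tpowMap_comp k n φ.hom ψ.hom x.1))
      (LinearMap.ext fun m => ?_)
    obtain ⟨x, rfl⟩ := Submodule.Quotient.mk_surjective _ m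
    exact congrArg Submodule.Quotient.mk (tpowMap_comp k n φ.hom ψ.hom x)

end TensorPower

end TwoTerm

/-! ### Restriction of scalars, Frobenius twist and reduction of Witt vectors -/

section Scalars

/-- Restriction of scalars of algebras along a ring homomorphism. -/
def restrictAlg {R S : Type u} [CommRing R] [CommRing S] (f : R →+* S) :
    AlgCat.{u} S ⥤ AlgCat.{u} R where
  obj B :=
    letI := Algebra.compHom B f
    AlgCat.of R B
  map {B B'} φ :=
    letI := Algebra.compHom B f
    letI := Algebra.compHom B' f
    AlgCat.ofHom { φ.hom.toRingHom with commutes' := fun r => φ.hom.commutes (f r) }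

/-- The reduction homomorphism `W₂(k) → k`, taking the `0`-th component of a Witt vector. -/
def wittRed (p : ℕ) [Fact p.Prime] (k : Type u) [CommRing k] :
    TruncatedWittVector p 2 k →+* k where
  toFun x := x.coeff 0
  map_one' := by
    rw [← map_one (WittVector.truncate (p := p) (R := k) 2), WittVector.coeff_truncate]
    exact map_one (WittVector.constantCoeff (p := p) (R := k))
  map_zero' := TruncatedWittVector.coeff_zero p 2 k 0
  map_mul' x y := by
    obtain ⟨x, rfl⟩ := WittVector.truncate_surjective p 2 k x
    obtain ⟨y, rfl⟩ := WittVector.truncate_surjective p 2 k y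
    rw [← map_mul, WittVector.coeff_truncate, WittVector.coeff_truncate, WittVector.coeff_truncate]
    exact map_mul WittVector.constantCoeff x y
  map_add' x y := by
    obtain ⟨x, rfl⟩ := WittVector.truncate_surjective p 2 k x
    obtain ⟨y, rfl⟩ := WittVector.truncate_surjective p 2 k y
    rw [← map_add, WittVector.coeff_truncate, WittVector.coeff_truncate, WittVector.coeff_truncate]
    exact map_add WittVector.constantCoeff x y

/-- The inverse of the Frobenius automorphism of a perfect field of characteristic `p`. -/
def frobInv (p : ℕ) [Fact p.Prime] (k : Type u) [Field k] [CharP k p] [PerfectField k] :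
    k →+* k :=
  ((frobeniusEquiv k p).symm : k →+* k)

end Scalars

/-! ### Sheaves on a site -/

section Sheaves

variable {Z : Type u} [SmallCategory Z] (J : GrothendieckTopology Z)

set_option synthInstance.maxHeartbeats 400000 in
instance isMonoidal_W (k : Type u) [CommRing k] : (J.W (A := ModuleCat.{u} k)).IsMonoidal :=
  GrothendieckTopology.W.monoidal

/-- The tensor product of sheaves of `k`-modules: the sheafified tensor product of presheaves. -/
instance sheafMonoidal (k : Type u) [CommRing k] :
    MonoidalCategory (Sheaf J (ModuleCat.{u} k)) :=
  Sheaf.monoidalCategory J _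

/-- The DG algebra in sheaves of `k`-modules associated to a presheaf of two-term DG algebras,
obtained by applying the associated sheaf functor. -/
def sheafDG {k : Type u} [CommRing k] (P : Zᵒᵖ ⥤ TwoTerm k) : DGAlg (Sheaf J (ModuleCat.{u} k)) :=
  (DGAlg.ofFunctor (P ⋙ TwoTerm.toDGFunctor k)).map (presheafToSheaf J (ModuleCat.{u} k))

variable {J}

/-- The DG algebra `A† = ((A^{⊗ p})_{ℤ/p} → (A^{⊗ p})^{ℤ/p})` of a sheaf of `k`-algebras `A`, with
tensor powers, coinvariants and invariants taken in the category of sheaves. As the associated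
sheaf functor is exact and monoidal, this is the DG algebra associated to the presheaf
`U ↦ A(U)†`. -/
def dagger {k : Type u} [CommRing k] (p : ℕ) (A : Sheaf J (AlgCat.{u} k)) :
    DGAlg (Sheaf J (ModuleCat.{u} k)) :=
  sheafDG J (A.obj ⋙ TwoTerm.dagFunctor k p)

/-- The trivial square-zero extension of a sheaf of algebras `B` by `B[1]`, with zero
differential. -/
def squareZero {k : Type u} [CommRing k] (B : Sheaf J (AlgCat.{u} k)) :
    DGAlg (Sheaf J (ModuleCat.{u} k)) :=
  sheafDG J (B.obj ⋙ TwoTerm.squareZeroFunctor k)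

/-- Restriction of scalars of sheaves of algebras. -/
def restrictSheaf {R S : Type u} [CommRing R] [CommRing S] (f : R →+* S)
    (A : Sheaf J (AlgCat.{u} S)) : Sheaf J (AlgCat.{u} R) where
  obj := A.obj ⋙ restrictAlg f
  property := by
    have h := (Presheaf.isSheaf_iff_isSheaf_forget J A.obj (forget (AlgCat.{u} S))).1 A.property
    exact (Presheaf.isSheaf_iff_isSheaf_forget J _ (forget (AlgCat.{u} R))).2 h

/-- The Frobenius twist `A^{(1)} = Fr^* A`. Since Frobenius is bijective, the base change of `A`
along it is `A` with `c : k` acting through `c ^ (1 / p)`. -/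
def frobTwist {k : Type u} [Field k] (p : ℕ) [Fact p.Prime] [CharP k p] [PerfectField k]
    (A : Sheaf J (AlgCat.{u} k)) : Sheaf J (AlgCat.{u} k) :=
  restrictSheaf (frobInv p k) A

/-- The sheaf of modules underlying a sheaf of algebras. -/
abbrev modSheaf (R : Type u) [CommRing R] :
    Sheaf J (AlgCat.{u} R) ⥤ Sheaf J (ModuleCat.{u} R) :=
  sheafCompose J (forget₂ (AlgCat.{u} R) (ModuleCat.{u} R))

/-- A sheaf of `R`-modules is flat if tensoring with it (in the category of sheaves of
`R`-modules) preserves monomorphisms. -/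
def IsFlat {R : Type u} [CommRing R] (M : Sheaf J (ModuleCat.{u} R)) : Prop :=
  ∀ ⦃X Y : Sheaf J (ModuleCat.{u} R)⦄ (f : X ⟶ Y), Mono f → Mono (M ◁ f)

/-- A morphism of sheaves of `R`-algebras `B → B'` identifies `B'` with the quotient `B / c`: as a
map of sheaves of modules, it is a cokernel of the multiplication by the integer `c` on `B`. -/
def IsQuotientBy {R : Type u} [CommRing R] {B B' : Sheaf J (AlgCat.{u} R)} (π : B ⟶ B')
    (c : ℕ) : Prop :=
  ∃ h : (c • 𝟙 ((modSheaf R).obj B)) ≫ (modSheaf R).map π = 0,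
    Nonempty (IsColimit (CokernelCofork.ofπ _ h))

end Sheaves

end NCHodge

end

/-!
The DG algebra `A†` has homology `A^{(1)}` in degrees `0` and `1`: modulo traces every invariant
tensor is a diagonal tensor `a ⊗ ⋯ ⊗ a`, and every coinvariant class of trace zero is the class of
a diagonal tensor (`CyclicTensor.projRing_eq_zero_iff`, `CyclicTensor.trace_eq_zero_iff`). So the
homology algebra is the square-zero extension of `A^{(1)}`, and it remains to connect the two by
quasi-isomorphisms.

The obstruction is that `a ↦ a ⊗ ⋯ ⊗ a` is multiplicative but not additive. It extends to a ring
homomorphism `ℤ[B] → (A^{⊗ p})^{ℤ/p}` on the monoid ring of the sections `B` of the lift, sending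
`[b]` to the diagonal tensor of its reduction. Let `s` be in the kernel of `ℤ[B] → A`, and let `Δ`
be the homomorphism `[b] ↦ [b] ⊗ ⋯ ⊗ [b]` from `ℤ[B]` to `ℤ[B]^{⊗ p}`. The difference
`Δ s - s ⊗ ⋯ ⊗ s` is the trace of some `z`. As `ℤ[B]` is free over `ℤ`, the class of `z` in the coinvariants is
unique, and its image in `(A^{⊗ p})_{ℤ/p}` lifts the image of `s` along the trace. This would give
a splitting of `A†` over the monoid ring, but not one compatible with the scalars of `k`. The lift
corrects it: the image of `s` in `B` is `p · a` for a unique `a` of `A`, by flatness, and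
`[z] - [a ⊗ ⋯ ⊗ a]` is the value of the splitting (`LiftData.Splits`). With this correction the relation
`[x + y] = [x] + [y]` between Teichmüller elements is killed (`LiftData.splits_teich`), since the
same divided binomial coefficients enter the addition of Witt vectors of length two and the
expansion of `(x + y) ⊗ ⋯ ⊗ (x + y)`. The quotient `S` of `ℤ[B]` by the kernel of the splitting is
therefore a `k`-algebra.

With `I` the kernel of `S → A^{(1)}`, the DG algebra `I ⊕ A^{(1)} → S` (`LiftData.roof`) maps to
the square-zero extension of `A^{(1)}` by the projections, and to `A†` by the diagonal in degree
`0` and by the splitting together with `a ↦ [a ⊗ ⋯ ⊗ a]` in degree `1`. All of this is functorial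
in the lifting data `LiftData`, so it applies to the presheaves of sections; both maps are
quasi-isomorphisms after sheafification because the reduction `B → A` is locally surjective. That
the sections of a flat lift form lifting data is `exists_kernelEmbedding`: flatness makes the
multiplication by `p` induce a monomorphism from the quotient modulo `p` (`exists_embedding`).
-/

noncomputable section

namespace NCHodge

/-! ### Cyclic words of prime length -/

namespace CyclicWord

variable {p : ℕ} {X : Type*}

/-- Rotation by `j` of a word indexed by `ZMod p`. -/
def rot (j : ZMod p) (w : ZMod p → X) : ZMod p → X := fun i => w (i + j)

@[simp] lemma rot_zero (w : ZMod p → X) : rot 0 w = w := funext fun i => by simp [rot]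

lemma rot_rot (j l : ZMod p) (w : ZMod p → X) : rot j (rot l w) = rot (j + l) w :=
  funext fun i => by simp [rot, add_assoc]

/-- A word is constant if all its letters agree. -/
def IsConst (w : ZMod p → X) : Prop := ∀ i, w i = w 0

lemma isConst_iff {w : ZMod p → X} : IsConst w ↔ ∃ x, w = fun _ => x :=
  ⟨fun h => ⟨w 0, funext h⟩, by rintro ⟨x, rfl⟩ i; rfl⟩

lemma isConst_rot {j : ZMod p} {w : ZMod p → X} : IsConst (rot j w) ↔ IsConst w := by
  simp only [isConst_iff]
  refine ⟨fun ⟨x, hx⟩ => ⟨x, ?_⟩, fun ⟨x, hx⟩ => ⟨x, ?_⟩⟩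
  · rw [← rot_zero w, ← neg_add_cancel j, ← rot_rot, hx]; rfl
  · rw [hx]; rfl

/-- The rotations act freely on the non-constant words, since `p` is prime. -/
lemma rot_injective [Fact p.Prime] {w : ZMod p → X} (hw : ¬ IsConst w) {j l : ZMod p}
    (h : rot j w = rot l w) : j = l := by
  by_contra hne
  refine hw fun i => ?_
  have hd : j - l ≠ 0 := sub_ne_zero.2 hne
  have h1 : ∀ i, w (i + (j - l)) = w i := fun i => by
    have := congrFun h (i - l)
    simp only [rot] at this
    rw [sub_add_cancel] at this
    rw [← this]
    congr 1
    ring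
  have h2 : ∀ (n : ℕ) i, w (i + n * (j - l)) = w i := by
    intro n
    induction n with
    | zero => simp
    | succ n ih =>
      intro i
      rw [← ih i, ← h1 (i + n * (j - l))]
      congr 1
      push_cast
      ring
  have h3 := h2 (i / (j - l)).val 0
  rwa [ZMod.natCast_zmod_val, div_mul_cancel₀ _ hd, zero_add] at h3

variable (p X) in
/-- Two words are equivalent if they differ by a rotation. -/
def rotSetoid : Setoid (ZMod p → X) where
  r w w' := ∃ j, rot j w = w'
  iseqv :=
    { refl := fun w => ⟨0, rot_zero w⟩
      symm := by
        rintro w _ ⟨j, rfl⟩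
        exact ⟨-j, by rw [rot_rot, neg_add_cancel, rot_zero]⟩
      trans := by
        rintro w _ _ ⟨j, rfl⟩ ⟨l, rfl⟩
        exact ⟨l + j, by rw [rot_rot]⟩ }

/-- A chosen representative of the rotation class of a word. -/
def rep (w : ZMod p → X) : ZMod p → X := Quotient.out (Quotient.mk (rotSetoid p X) w)

lemma exists_rot_eq_rep (w : ZMod p → X) : ∃ j, rot j w = rep w := by
  obtain ⟨j, hj⟩ := Quotient.mk_out (s := rotSetoid p X) w
  refine ⟨-j, ?_⟩
  conv_lhs => rw [← hj, rot_rot, neg_add_cancel, rot_zero]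
  rfl

lemma rep_rot (j : ZMod p) (w : ZMod p → X) : rep (rot j w) = rep w := by
  unfold rep
  congr 1
  exact Quotient.sound ⟨-j, by rw [rot_rot, neg_add_cancel, rot_zero]⟩

/-- A sum over a rotation-stable finite set of non-constant words, organised by free orbits. -/
lemma sum_eq_sum_rep [Fact p.Prime] [DecidableEq (ZMod p → X)] {M : Type*} [AddCommMonoid M]
    (S : Finset (ZMod p → X))
    (hS : ∀ w ∈ S, ¬ IsConst w) (hrot : ∀ w ∈ S, ∀ j, rot j w ∈ S) (F : (ZMod p → X) → M) :
    ∑ w ∈ S, F w = ∑ w ∈ S with rep w = w, ∑ j : ZMod p, F (rot j w) := by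
  rw [← Finset.sum_product']
  symm
  refine Finset.sum_bij (fun x _ => rot x.2 x.1) ?_ ?_ ?_ ?_
  · rintro ⟨w, j⟩ h
    simp only [Finset.mem_product, Finset.mem_filter] at h
    exact hrot w h.1.1 j
  · rintro ⟨w, j⟩ h ⟨w', j'⟩ h' heq
    simp only [Finset.mem_product, Finset.mem_filter] at h h' heq
    obtain rfl : w = w' := by rw [← h.1.2, ← h'.1.2, ← rep_rot j w, heq, rep_rot]
    rw [rot_injective (hS w h.1.1) heq]
  · intro w hw
    obtain ⟨j, hj⟩ := exists_rot_eq_rep w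
    refine ⟨(rep w, -j), ?_, ?_⟩
    · simp only [Finset.mem_product, Finset.mem_filter, Finset.mem_univ, and_true]
      exact ⟨hj ▸ hrot w hw j, by rw [← hj, rep_rot, hj]⟩
    · simp only [← hj, rot_rot, neg_add_cancel, rot_zero]
  · intros; rfl

open Classical in
variable (p) in
/-- Representatives of the rotation classes of non-constant words in two letters. -/
def binaryReps [NeZero p] : Finset (ZMod p → Bool) := {w | ¬ IsConst w ∧ rep w = w}

lemma not_isConst_of_mem [NeZero p] {w : ZMod p → Bool} (h : w ∈ binaryReps p) : ¬ IsConst w := by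
  classical
  exact (Finset.mem_filter.1 h).2.1

lemma exists_eq_of_mem [NeZero p] {w : ZMod p → Bool} (h : w ∈ binaryReps p) (b : Bool) :
    ∃ i, w i = b := by
  by_contra hne
  push Not at hne
  refine not_isConst_of_mem h fun i => ?_
  rw [Bool.eq_not_of_ne (hne i), Bool.eq_not_of_ne (hne 0)]

/-- The sum over all binary words, as the two constant words plus the free orbits. -/
lemma sum_binary [Fact p.Prime] {M : Type*} [AddCommMonoid M] (F : (ZMod p → Bool) → M) :
    ∑ w, F w = F (fun _ => true) + F (fun _ => false) +
      ∑ w ∈ binaryReps p, ∑ j : ZMod p, F (rot j w) := by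
  classical
  rw [← Finset.sum_filter_not_add_sum_filter Finset.univ IsConst F,
    sum_eq_sum_rep {w | ¬ IsConst w} (by simp) (by simp [isConst_rot]) F, add_comm]
  congr 1
  · have : (Finset.univ.filter (IsConst (p := p) (X := Bool))) =
        {fun _ => true, fun _ => false} := by
      ext w
      simp only [Finset.mem_filter, Finset.mem_univ, true_and, Finset.mem_insert,
        Finset.mem_singleton, isConst_iff, Bool.exists_bool]
      exact or_comm
    rw [this, Finset.sum_pair]
    intro h
    simpa using congrFun h 0
  · refine Finset.sum_congr ?_ fun _ _ => rfl
    ext w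
    simp [binaryReps]

/-- The binomial expansion of a `p`-th power, with the mixed terms divided by `p`: the mixed words
fall into free rotation orbits, and a commutative product is constant on each of them. -/
lemma add_pow_eq [Fact p.Prime] {R : Type*} [CommRing R] (x y : R) :
    (x + y) ^ p = x ^ p + y ^ p + p * ∑ w ∈ binaryReps p, ∏ i, bif w i then x else y := by
  have h1 : (x + y) ^ p = ∏ _i : ZMod p, ∑ b : Bool, bif b then x else y := by
    simp [ZMod.card]
  rw [h1, Fintype.prod_sum, sum_binary]
  congr 1
  · simp [ZMod.card]
  · rw [Finset.mul_sum]
    refine Finset.sum_congr rfl fun w _ => ?_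
    have : ∀ j : ZMod p, (∏ i, bif rot j w i then x else y) = ∏ i, bif w i then x else y :=
      fun j => Fintype.prod_equiv (Equiv.addRight j) _ _ fun i => rfl
    simp [this, ZMod.card]

end CyclicWord

/-! ### Tate cohomology of the cyclic group acting on a tensor power -/

namespace CyclicTensor

open CyclicWord Module

variable (R : Type*) [CommRing R] (p : ℕ) (V : Type*) [AddCommGroup V] [Module R V]

/-- The generator of `ℤ/p` acting on `V^{⊗ p}` by cyclic permutation of the factors. -/
def rotL : (⨂[R] _ : ZMod p, V) →ₗ[R] (⨂[R] _ : ZMod p, V) :=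
  PiTensorProduct.lift ((PiTensorProduct.tprod R).domDomCongr (Equiv.addRight (1 : ZMod p)))

/-- The operator `1 + σ + ⋯ + σ ^ (p - 1)` on `V^{⊗ p}`. -/
def trL : (⨂[R] _ : ZMod p, V) →ₗ[R] (⨂[R] _ : ZMod p, V) :=
  ∑ j ∈ Finset.range p, rotL R p V ^ j

variable {V}

/-- The diagonal tensor `a ⊗ ⋯ ⊗ a`. -/
def diag (a : V) : ⨂[R] _ : ZMod p, V := PiTensorProduct.tprod R fun _ => a

variable {p}

@[simp] lemma rotL_tprod (b : ZMod p → V) :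
    rotL R p V (PiTensorProduct.tprod R b) = PiTensorProduct.tprod R (rot 1 b) :=
  PiTensorProduct.lift.tprod _

lemma rotL_pow_tprod (j : ℕ) (b : ZMod p → V) :
    (rotL R p V ^ j) (PiTensorProduct.tprod R b) =
      PiTensorProduct.tprod R (rot (j : ZMod p) b) := by
  induction j with
  | zero => simp
  | succ j ih =>
    rw [pow_succ', Module.End.mul_apply, ih, rotL_tprod, rot_rot]
    push_cast
    rw [add_comm]

lemma sum_range_zmod [NeZero p] {M : Type*} [AddCommMonoid M] (F : ZMod p → M) :
    ∑ j ∈ Finset.range p, F (j : ZMod p) = ∑ j : ZMod p, F j := by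
  symm
  refine Finset.sum_bij' (fun j _ => j.val) (fun j _ => (j : ZMod p)) ?_ ?_ ?_ ?_ ?_
  · intro j _; exact Finset.mem_range.2 (ZMod.val_lt j)
  · intros; exact Finset.mem_univ _
  · intro j _; simp
  · intro j hj; exact ZMod.val_cast_of_lt (Finset.mem_range.1 hj)
  · intro j _; simp

lemma trL_tprod [NeZero p] (b : ZMod p → V) :
    trL R p V (PiTensorProduct.tprod R b) = ∑ j : ZMod p, PiTensorProduct.tprod R (rot j b) := by
  rw [trL, LinearMap.sum_apply]
  simp only [rotL_pow_tprod]
  exact sum_range_zmod fun j => PiTensorProduct.tprod R (rot j b)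

lemma trL_diag [NeZero p] (a : V) : trL R p V (diag R p a) = (p : R) • diag R p a := by
  rw [diag, trL_tprod]
  have : ∀ j : ZMod p, rot j (fun _ => a) = fun _ => a := fun j => rfl
  simp [this, ZMod.card, Nat.cast_smul_eq_nsmul]

lemma diag_smul [NeZero p] (r : R) (a : V) : diag R p (r • a) = r ^ p • diag R p a := by
  have := (PiTensorProduct.tprod R).map_smul_univ (fun _ : ZMod p => r) (fun _ => a)
  simpa [ZMod.card, diag] using this

lemma diag_zero [NeZero p] : diag R p (0 : V) = 0 :=
  (PiTensorProduct.tprod R).map_coord_zero (0 : ZMod p) rfl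

variable (p) in
/-- The mixed term of the expansion of `(a + b) ⊗ ⋯ ⊗ (a + b)`: one word in `a` and `b` for
every free orbit of the rotations. -/
def mixed [NeZero p] (a b : V) : ⨂[R] _ : ZMod p, V :=
  ∑ w ∈ binaryReps p, PiTensorProduct.tprod R fun i => bif w i then a else b

/-- The diagonal is additive up to a trace. -/
lemma diag_add [Fact p.Prime] (a b : V) :
    diag R p (a + b) = diag R p a + diag R p b + trL R p V (mixed R p a b) := by
  have h1 : (fun _ : ZMod p => a + b) = fun _ => ∑ c : Bool, bif c then a else b := by simp
  rw [diag, h1, (PiTensorProduct.tprod R).map_sum, sum_binary, mixed, map_sum]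
  simp only [trL_tprod]
  rfl

lemma mixed_zero_left [NeZero p] (b : V) : mixed R p 0 b = 0 := by
  refine Finset.sum_eq_zero fun w hw => ?_
  obtain ⟨i, hi⟩ := exists_eq_of_mem hw true
  exact (PiTensorProduct.tprod R).map_coord_zero i (by simp [hi])

lemma rotL_diag (a : V) : rotL R p V (diag R p a) = diag R p a := rotL_tprod R _

lemma rotL_pow_sub_mem_range (j : ℕ) (x : ⨂[R] _ : ZMod p, V) :
    (rotL R p V ^ j) x - x ∈ LinearMap.range (rotL R p V - LinearMap.id) := by
  induction j with
  | zero => simp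
  | succ j ih =>
    rw [pow_succ', Module.End.mul_apply, ← sub_add_sub_cancel _ ((rotL R p V ^ j) x)]
    exact add_mem ⟨(rotL R p V ^ j) x, rfl⟩ ih

section Basis

variable {R} {ι : Type*} (b : Basis ι R V)

variable (p) in
/-- The basis of `V^{⊗ p}` indexed by words in a basis of `V`. -/
abbrev wordBasis [NeZero p] : Basis (ZMod p → ι) R (⨂[R] _ : ZMod p, V) :=
  Basis.piTensorProduct fun _ => b

lemma wordBasis_apply [NeZero p] (w : ZMod p → ι) :
    wordBasis p b w = PiTensorProduct.tprod R fun i => b (w i) :=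
  Basis.piTensorProduct_apply _ _

lemma rotL_pow_wordBasis [NeZero p] (j : ℕ) (w : ZMod p → ι) :
    (rotL R p V ^ j) (wordBasis p b w) = wordBasis p b (rot (j : ZMod p) w) := by
  rw [wordBasis_apply, rotL_pow_tprod, wordBasis_apply]
  rfl

lemma rotL_wordBasis [NeZero p] (w : ZMod p → ι) :
    rotL R p V (wordBasis p b w) = wordBasis p b (rot 1 w) := by
  simpa using rotL_pow_wordBasis b 1 w

lemma trL_wordBasis [NeZero p] (w : ZMod p → ι) :
    trL R p V (wordBasis p b w) = ∑ j : ZMod p, wordBasis p b (rot j w) := by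
  rw [wordBasis_apply, trL_tprod]
  refine Finset.sum_congr rfl fun j _ => ?_
  rw [wordBasis_apply]
  rfl

lemma repr_rotL [NeZero p] (x : ⨂[R] _ : ZMod p, V) (w : ZMod p → ι) :
    (wordBasis p b).repr (rotL R p V x) (rot 1 w) = (wordBasis p b).repr x w := by
  suffices H : (wordBasis p b).coord (rot 1 w) ∘ₗ rotL R p V = (wordBasis p b).coord w from
    LinearMap.congr_fun H x
  classical
  refine (wordBasis p b).ext fun v => ?_
  rw [LinearMap.comp_apply, rotL_wordBasis, Basis.coord_apply, Basis.coord_apply,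
    Basis.repr_self_apply, Basis.repr_self_apply]
  have hinj : rot 1 v = rot 1 w ↔ v = w :=
    ⟨fun h => by simpa [rot_rot] using congrArg (rot (-1)) h, fun h => h ▸ rfl⟩
  simp only [hinj]

lemma repr_trL [NeZero p] (x : ⨂[R] _ : ZMod p, V) (w : ZMod p → ι) :
    (wordBasis p b).repr (trL R p V x) w = ∑ j : ZMod p, (wordBasis p b).repr x (rot j w) := by
  suffices H : (wordBasis p b).coord w ∘ₗ trL R p V =
      ∑ j : ZMod p, (wordBasis p b).coord (rot j w) by
    simpa using LinearMap.congr_fun H x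
  classical
  refine (wordBasis p b).ext fun v => ?_
  rw [LinearMap.comp_apply, trL_wordBasis, map_sum, LinearMap.sum_apply]
  refine Fintype.sum_equiv (Equiv.neg _) _ _ fun j => ?_
  rw [Basis.coord_apply, Basis.coord_apply, Basis.repr_self_apply, Basis.repr_self_apply]
  have hinj : rot j v = w ↔ v = rot (-j) w := by
    constructor
    · rintro rfl; simp [rot_rot]
    · rintro rfl; simp [rot_rot]
  simp only [hinj, Equiv.neg_apply]

lemma repr_diag [NeZero p] (a : V) (c : ι) :
    (wordBasis p b).repr (diag R p a) (fun _ => c) = b.repr a c ^ p := by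
  rw [diag, Basis.piTensorProduct_repr_tprod_apply]
  simp [ZMod.card]

lemma repr_trL_const [NeZero p] (x : ⨂[R] _ : ZMod p, V) (c : ι) :
    (wordBasis p b).repr (trL R p V x) (fun _ => c) =
      p * (wordBasis p b).repr x (fun _ => c) := by
  rw [repr_trL]
  have : ∀ j : ZMod p, rot j (fun _ => c) = fun _ => c := fun j => rfl
  simp [this, ZMod.card]

lemma repr_const_of_mem_range [NeZero p] {x : ⨂[R] _ : ZMod p, V}
    (hx : x ∈ LinearMap.range (rotL R p V - LinearMap.id)) (c : ι) :
    (wordBasis p b).repr x (fun _ => c) = 0 := by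
  obtain ⟨y, rfl⟩ := hx
  have : (wordBasis p b).repr (rotL R p V y) (fun _ => c) =
    (wordBasis p b).repr y (fun _ => c) := repr_rotL b y fun _ => c
  simp [this]

/-- An invariant tensor without constant words is a trace: the non-constant words are permuted
freely. -/
lemma exists_eq_trL [Fact p.Prime] {x : ⨂[R] _ : ZMod p, V} (hx : rotL R p V x = x)
    (hc : ∀ c, (wordBasis p b).repr x (fun _ => c) = 0) : ∃ z, x = trL R p V z := by
  classical
  set r := (wordBasis p b).repr x with hr
  have h1 : ∀ w, r (rot 1 w) = r w := fun w => by rw [hr, ← repr_rotL b x w, hx]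
  have hn : ∀ (n : ℕ) w, r (rot (n : ZMod p) w) = r w := by
    intro n
    induction n with
    | zero => simp
    | succ n ih =>
      intro w
      rw [← ih w, ← h1 (rot (n : ZMod p) w), rot_rot]
      push_cast
      rw [add_comm]
  have hj : ∀ (j : ZMod p) w, r (rot j w) = r w := fun j w => by
    simpa using hn j.val w
  refine ⟨∑ w ∈ r.support with rep w = w, r w • wordBasis p b w, ?_⟩
  rw [map_sum]
  simp only [map_smul, trL_wordBasis, Finset.smul_sum]
  conv_lhs => rw [← (wordBasis p b).linearCombination_repr x, Finsupp.linearCombination_apply,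
    Finsupp.sum]
  rw [← hr, sum_eq_sum_rep r.support ?_ ?_ fun w => r w • wordBasis p b w]
  · simp only [hj]
  · intro w hw hcw
    obtain ⟨c, rfl⟩ := isConst_iff.1 hcw
    exact Finsupp.mem_support_iff.1 hw (hc c)
  · intro w hw j
    rw [Finsupp.mem_support_iff] at hw ⊢
    rwa [hj]

/-- A tensor of trace zero without constant words vanishes in the coinvariants. -/
lemma mem_range_of_trL_eq_zero [Fact p.Prime] {x : ⨂[R] _ : ZMod p, V} (hx : trL R p V x = 0)
    (hc : ∀ c, (wordBasis p b).repr x (fun _ => c) = 0) :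
    x ∈ LinearMap.range (rotL R p V - LinearMap.id) := by
  classical
  set r := (wordBasis p b).repr x with hr
  let S : Finset (ZMod p → ι) :=
    (r.support ×ˢ (Finset.univ : Finset (ZMod p))).image fun y => rot y.2 y.1
  have hS : ∀ w, w ∈ S ↔ ∃ v, r v ≠ 0 ∧ ∃ j, rot j v = w := fun w => by simp [S]
  have hsub : r.support ⊆ S := fun w hw =>
    (hS w).2 ⟨w, Finsupp.mem_support_iff.1 hw, 0, rot_zero w⟩
  have h1 : x = ∑ w ∈ S, r w • wordBasis p b w := by
    conv_lhs => rw [← (wordBasis p b).linearCombination_repr x, Finsupp.linearCombination_apply]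
    exact Finsupp.sum_of_support_subset _ hsub _ fun _ _ => zero_smul _ _
  have h2 : ∀ w, ∑ j : ZMod p, r (rot j w) = 0 := fun w => by
    rw [hr, ← repr_trL, hx]; simp
  have h3 : x = ∑ w ∈ S with rep w = w,
      ∑ j : ZMod p, r (rot j w) • (wordBasis p b (rot j w) - wordBasis p b w) := by
    simp only [smul_sub, Finset.sum_sub_distrib, ← Finset.sum_smul, h2, zero_smul,
      sub_zero]
    conv_lhs => rw [h1]
    refine sum_eq_sum_rep S ?_ ?_ fun w => r w • wordBasis p b w
    · intro w hw hcw
      obtain ⟨v, hv, j, rfl⟩ := (hS w).1 hw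
      obtain ⟨c, rfl⟩ := isConst_iff.1 (isConst_rot.1 hcw)
      exact hv (hc c)
    · intro w hw l
      obtain ⟨v, hv, j, rfl⟩ := (hS w).1 hw
      exact (hS _).2 ⟨v, hv, l + j, by rw [rot_rot]⟩
  rw [h3]
  refine sum_mem fun w _ => sum_mem fun j _ => Submodule.smul_mem _ _ ?_
  have := rotL_pow_sub_mem_range R j.val (wordBasis p b w)
  rwa [rotL_pow_wordBasis, ZMod.natCast_zmod_val] at this

/-- On the tensor power of a free module over a ring in which `p` is not a zero divisor, the trace
is injective on coinvariants. -/
lemma mem_range_of_trL_eq_zero_of_free [Fact p.Prime] [Module.Free R V]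
    (hp : ∀ r : R, (p : R) * r = 0 → r = 0)
    {x : ⨂[R] _ : ZMod p, V} (hx : trL R p V x = 0) :
    x ∈ LinearMap.range (rotL R p V - LinearMap.id) :=
  let b := Module.Free.chooseBasis R V
  mem_range_of_trL_eq_zero b hx fun c => hp _ (by rw [← repr_trL_const b, hx]; simp)

end Basis

section Perfect

variable {k : Type*} [Field k] {V : Type*} [AddCommGroup V] [Module k V]

/-- Every family of constant-word coefficients is that of a diagonal tensor, as `k` is perfect. -/
lemma exists_diag_repr [Fact p.Prime] [CharP k p] [PerfectField k] {ι : Type*}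
    (b : Basis ι k V) (x : ⨂[k] _ : ZMod p, V) :
    ∃ a : V, ∀ c, (wordBasis p b).repr (diag k p a) (fun _ => c) =
      (wordBasis p b).repr x (fun _ => c) := by
  let f : ι →₀ k := ((wordBasis p b).repr x).comapDomain (fun c _ => c)
    (fun c _ c' _ h => congrFun h 0)
  refine ⟨b.repr.symm (f.mapRange (frobeniusEquiv k p).symm (map_zero _)), fun c => ?_⟩
  rw [repr_diag, LinearEquiv.apply_symm_apply, Finsupp.mapRange_apply,
    frobeniusEquiv_symm_pow_p]
  rfl

/-- Every invariant tensor is a diagonal tensor modulo traces. -/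
lemma exists_diag_add_trL [Fact p.Prime] [CharP k p] [PerfectField k]
    {x : ⨂[k] _ : ZMod p, V} (hx : rotL k p V x = x) :
    ∃ a z, x = diag k p a + trL k p V z := by
  let b := Basis.ofVectorSpace k V
  obtain ⟨a, ha⟩ := exists_diag_repr b x
  obtain ⟨z, hz⟩ := exists_eq_trL b (x := x - diag k p a)
    (by rw [map_sub, hx, rotL_diag]) (fun c => by simp [ha])
  exact ⟨a, z, by rw [← hz]; abel⟩

/-- A diagonal tensor that is a trace vanishes: in characteristic `p`, a trace has no constant
words. -/
lemma eq_zero_of_diag_eq_trL [NeZero p] [CharP k p] {a : V} {z : ⨂[k] _ : ZMod p, V}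
    (h : diag k p a = trL k p V z) : a = 0 := by
  let b := Basis.ofVectorSpace k V
  refine b.repr.map_eq_zero_iff.1 (Finsupp.ext fun c => ?_)
  have h1 := repr_diag (p := p) b a c
  rw [h, repr_trL_const, CharP.cast_eq_zero, zero_mul] at h1
  exact eq_zero_of_pow_eq_zero h1.symm

/-- Every coinvariant class of trace zero is the class of a diagonal tensor. -/
lemma exists_diag_of_trL_eq_zero [Fact p.Prime] [CharP k p] [PerfectField k]
    {x : ⨂[k] _ : ZMod p, V} (hx : trL k p V x = 0) :
    ∃ a, x - diag k p a ∈ LinearMap.range (rotL k p V - LinearMap.id) := by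
  let b := Basis.ofVectorSpace k V
  obtain ⟨a, ha⟩ := exists_diag_repr b x
  refine ⟨a, mem_range_of_trL_eq_zero b ?_ fun c => by simp [ha]⟩
  rw [map_sub, hx, trL_diag, CharP.cast_eq_zero, zero_smul, sub_zero]

lemma eq_zero_of_diag_mem_range [NeZero p] {a : V}
    (h : diag k p a ∈ LinearMap.range (rotL k p V - LinearMap.id)) : a = 0 := by
  let b := Basis.ofVectorSpace k V
  refine b.repr.map_eq_zero_iff.1 (Finsupp.ext fun c => ?_)
  have h1 := repr_diag (p := p) b a c
  rw [repr_const_of_mem_range b h] at h1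
  exact eq_zero_of_pow_eq_zero h1.symm

/-- In characteristic `p`, traces vanish in the coinvariants. -/
lemma trL_mem_range [CharP k p] (x : ⨂[k] _ : ZMod p, V) :
    trL k p V x ∈ LinearMap.range (rotL k p V - LinearMap.id) := by
  have h : trL k p V x = ∑ j ∈ Finset.range p, ((rotL k p V ^ j) x - x) := by
    rw [Finset.sum_sub_distrib, Finset.sum_const, Finset.card_range, ← Nat.cast_smul_eq_nsmul k,
      CharP.cast_eq_zero, zero_smul, sub_zero, trL, LinearMap.sum_apply]
  rw [h]
  exact sum_mem fun j _ => rotL_pow_sub_mem_range k j x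

end Perfect

end CyclicTensor

/-! ### The homology of the Tate complex of a tensor power of an algebra -/

namespace CyclicTensor

open CyclicWord

section Algebra

variable (R : Type*) [CommRing R] {p : ℕ} {B : Type*} [Ring B] [Algebra R B]

lemma diag_one : diag R p (1 : B) = 1 := rfl

lemma diag_mul (a b : B) : diag R p (a * b) = diag R p a * diag R p b :=
  (PiTensorProduct.tprod_mul_tprod (R := R) (fun _ : ZMod p => a) fun _ => b).symm

/-- The multiplicative map `a ↦ a ⊗ ⋯ ⊗ a`. -/
def diagHom (p : ℕ) (B : Type*) [Ring B] [Algebra R B] : B →* ⨂[R] _ : ZMod p, B where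
  toFun := diag R p
  map_one' := diag_one R
  map_mul' := diag_mul R

/-- The trace is linear over the diagonal tensors. -/
lemma trL_diag_mul [NeZero p] (a : B) (z : ⨂[R] _ : ZMod p, B) :
    trL R p B (diag R p a * z) = diag R p a * trL R p B z := by
  suffices H : trL R p B ∘ₗ LinearMap.mulLeft R (diag R p a) =
      LinearMap.mulLeft R (diag R p a) ∘ₗ trL R p B from LinearMap.congr_fun H z
  refine PiTensorProduct.ext (MultilinearMap.ext fun b => ?_)
  change trL R p B (diag R p a * PiTensorProduct.tprod R b) =
    diag R p a * trL R p B (PiTensorProduct.tprod R b)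
  rw [diag, PiTensorProduct.tprod_mul_tprod, trL_tprod, trL_tprod, Finset.mul_sum]
  exact Finset.sum_congr rfl fun j _ => (PiTensorProduct.tprod_mul_tprod _ _).symm

lemma trL_mul_diag [NeZero p] (z : ⨂[R] _ : ZMod p, B) (a : B) :
    trL R p B (z * diag R p a) = trL R p B z * diag R p a := by
  suffices H : trL R p B ∘ₗ LinearMap.mulRight R (diag R p a) =
      LinearMap.mulRight R (diag R p a) ∘ₗ trL R p B from LinearMap.congr_fun H z
  refine PiTensorProduct.ext (MultilinearMap.ext fun b => ?_)
  change trL R p B (PiTensorProduct.tprod R b * diag R p a) =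
    trL R p B (PiTensorProduct.tprod R b) * diag R p a
  rw [diag, PiTensorProduct.tprod_mul_tprod, trL_tprod, trL_tprod, Finset.sum_mul]
  exact Finset.sum_congr rfl fun j _ => (PiTensorProduct.tprod_mul_tprod _ _).symm

end Algebra

section Cyc

variable {k : Type u} [CommRing k] {p : ℕ} {B : Type u} [Ring B] [Algebra k B]

lemma cyc_eq (x : TwoTerm.TPow k p B) : TwoTerm.cyc k p B x = rotL k p B x := rfl

lemma norm_cyc (x : TwoTerm.TPow k p B) : TwoTerm.norm (TwoTerm.cyc k p B) p x = trL k p B x := by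
  have h : ∀ j : ℕ, (TwoTerm.cyc k p B ^ j) x = (rotL k p B ^ j) x := by
    intro j
    induction j with
    | zero => rfl
    | succ j ih =>
      rw [pow_succ', pow_succ', AlgHom.mul_apply, Module.End.mul_apply, ih, cyc_eq]
  rw [TwoTerm.norm_apply, trL, LinearMap.sum_apply]
  exact Finset.sum_congr rfl fun j _ => h j

lemma coinv_eq_iff {x y : TwoTerm.TPow k p B} :
    (Submodule.Quotient.mk x : TwoTerm.Coinv (TwoTerm.cyc k p B)) = Submodule.Quotient.mk y ↔
      x - y ∈ LinearMap.range (rotL k p B - LinearMap.id) :=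
  Submodule.Quotient.eq _

lemma coe_trace_mk (x : TwoTerm.TPow k p B) :
    (TwoTerm.trace (TwoTerm.cyc_pow k p B) (Submodule.Quotient.mk x) : TwoTerm.TPow k p B) =
      trL k p B x :=
  norm_cyc x

variable (k p B) in
/-- The multiplicative map `a ↦ a ⊗ ⋯ ⊗ a` into the invariants. -/
def diagInv : B →* TwoTerm.Inv (TwoTerm.cyc k p B) where
  toFun a := ⟨diag k p a, rotL_diag k a⟩
  map_one' := rfl
  map_mul' a b := Subtype.ext (diag_mul k a b)

lemma tpowMap_diag {C : Type u} [Ring C] [Algebra k C] (φ : B →ₐ[k] C) (a : B) :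
    TwoTerm.tpowMap k p φ (diag k p a) = diag k p (φ a) :=
  TwoTerm.tpowMap_tprod k p φ _

end Cyc

section CharP

variable {k : Type u} [Field k] {p : ℕ} [Fact p.Prime] [CharP k p] {B : Type u} [Ring B]
  [Algebra k B]

variable (k p B) in
/-- The map `a ↦ [a ⊗ ⋯ ⊗ a]` into the coinvariants, which is additive in characteristic `p`. -/
def diagCoinv : B →+ TwoTerm.Coinv (TwoTerm.cyc k p B) where
  toFun a := Submodule.Quotient.mk (diag k p a)
  map_zero' := by rw [diag_zero]; rfl
  map_add' a b := by
    rw [← Submodule.Quotient.mk_add, coinv_eq_iff, diag_add, add_sub_cancel_left]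
    exact trL_mem_range _

lemma diagCoinv_apply (a : B) :
    diagCoinv k p B a = Submodule.Quotient.mk (diag k p a) := rfl

lemma trace_diagCoinv (a : B) :
    TwoTerm.trace (TwoTerm.cyc_pow k p B) (diagCoinv k p B a) = 0 := by
  refine Subtype.ext ?_
  rw [diagCoinv_apply, coe_trace_mk, trL_diag, CharP.cast_eq_zero, zero_smul]
  rfl

variable (k p B) in
lemma diagCoinv_injective : Function.Injective (diagCoinv k p B) := by
  rw [injective_iff_map_eq_zero]
  intro a ha
  exact eq_zero_of_diag_mem_range (p := p) ((Submodule.Quotient.mk_eq_zero _).1 ha)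

/-- The diagonal part of an invariant tensor is unique. -/
lemma eq_of_diag_add_trL_eq {a b : B} {y z : TwoTerm.TPow k p B}
    (h : diag k p a + trL k p B y = diag k p b + trL k p B z) : a = b := by
  have h1 := diag_add k (p := p) (a - b) b
  rw [sub_add_cancel] at h1
  rw [← sub_eq_zero]
  refine eq_zero_of_diag_eq_trL (p := p) (z := z - y - mixed k p (a - b) b) ?_
  rw [h1, add_right_comm, add_right_comm _ (diag k p b), add_comm _ (diag k p b),
    add_assoc, add_right_inj] at h
  rw [map_sub, map_sub, ← h]
  abel

end CharP

section Perfect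

variable {k : Type u} [Field k] {p : ℕ} [Fact p.Prime] [CharP k p] [PerfectField k]

variable (p) in
/-- The Frobenius twist of an algebra `B` over a perfect field: the same ring, with `c` acting
through `c ^ (1 / p)`. -/
abbrev twist (B : AlgCat.{u} k) : AlgCat.{u} k := (restrictAlg (frobInv p k)).obj B

lemma frobInv_pow (c : k) : frobInv p k c ^ p = c := frobeniusEquiv_symm_pow_p k p c

lemma frobInv_apply_pow (c : k) : frobInv p k (c ^ p) = c :=
  frobeniusEquiv_symm_apply_frobenius k p c

section Single

variable {B : AlgCat.{u} k}

lemma exists_inv_eq (x : TwoTerm.Inv (TwoTerm.cyc k p B)) :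
    ∃ a, ∃ z, (x : TwoTerm.TPow k p B) = diag k p a + trL k p B z :=
  exists_diag_add_trL x.2

variable (p B) in
/-- The projection of the invariants of `B^{⊗ p}` onto `B`, with `a ⊗ ⋯ ⊗ a ↦ a` and with the image
of the trace map as its kernel, as a ring homomorphism. -/
def projRing : TwoTerm.Inv (TwoTerm.cyc k p B) →+* B := by
  have key : ∀ {x : TwoTerm.Inv (TwoTerm.cyc k p B)} {a : B} {z},
      (x : TwoTerm.TPow k p B) = diag k p a + trL k p B z → (exists_inv_eq x).choose = a :=
    fun {x a z} h => eq_of_diag_add_trL_eq ((exists_inv_eq x).choose_spec.choose_spec.symm.trans h)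
  have add : ∀ x y : TwoTerm.Inv (TwoTerm.cyc k p B), (exists_inv_eq (x + y)).choose =
      (exists_inv_eq x).choose + (exists_inv_eq y).choose := fun x y => by
    obtain ⟨z, hz⟩ := (exists_inv_eq x).choose_spec
    obtain ⟨w, hw⟩ := (exists_inv_eq y).choose_spec
    refine key (z := z + w - mixed k p (exists_inv_eq x).choose (exists_inv_eq y).choose) ?_
    rw [map_sub, map_add, diag_add, Subalgebra.coe_add]
    nth_rw 1 [hz, hw]
    abel
  have mul : ∀ x y : TwoTerm.Inv (TwoTerm.cyc k p B), (exists_inv_eq (x * y)).choose =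
      (exists_inv_eq x).choose * (exists_inv_eq y).choose := fun x y => by
    obtain ⟨z, hz⟩ := (exists_inv_eq x).choose_spec
    obtain ⟨w, hw⟩ := (exists_inv_eq y).choose_spec
    refine key (z := z * y + diag k p (exists_inv_eq x).choose * w) ?_
    have h : trL k p B (z * y) = trL k p B z * y := by
      have := congrArg Subtype.val
        (TwoTerm.tate (TwoTerm.cyc_pow k p B) |>.d_ract (Submodule.Quotient.mk z) y)
      exact (norm_cyc _).symm.trans (this.trans (congrArg (· * (y : TwoTerm.TPow k p B))
        (norm_cyc z)))
    rw [map_add, h, trL_diag_mul, diag_mul, Subalgebra.coe_mul]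
    nth_rw 1 [hz]
    rw [add_mul]
    nth_rw 1 [hw]
    rw [mul_add]
    abel
  exact
    { toFun := fun x => (exists_inv_eq x).choose
      map_one' := key (z := 0) (by rw [map_zero, add_zero, diag_one]; rfl)
      map_mul' := mul
      map_zero' := key (z := 0) (by rw [map_zero, add_zero, diag_zero]; rfl)
      map_add' := add }

lemma exists_eq_diag_projRing (x : TwoTerm.Inv (TwoTerm.cyc k p B)) :
    ∃ z, (x : TwoTerm.TPow k p B) = diag k p (projRing p B x) + trL k p B z :=
  (exists_inv_eq x).choose_spec

lemma projRing_eq {x : TwoTerm.Inv (TwoTerm.cyc k p B)} {a : B} {z : TwoTerm.TPow k p B}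
    (h : (x : TwoTerm.TPow k p B) = diag k p a + trL k p B z) : projRing p B x = a :=
  eq_of_diag_add_trL_eq ((exists_eq_diag_projRing x).choose_spec.symm.trans h)

variable (p B) in
lemma projRing_diagInv (a : B) : projRing p B (diagInv k p B a) = a :=
  projRing_eq (z := 0) (by rw [map_zero, add_zero]; rfl)

/-- In degree `0`, the homology of the Tate complex is the Frobenius twist of `B`. -/
lemma projRing_eq_zero_iff {x : TwoTerm.Inv (TwoTerm.cyc k p B)} :
    projRing p B x = 0 ↔ ∃ m, TwoTerm.trace (TwoTerm.cyc_pow k p B) m = x := by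
  constructor
  · intro h
    obtain ⟨z, hz⟩ := exists_eq_diag_projRing x
    refine ⟨Submodule.Quotient.mk z, Subtype.ext ?_⟩
    rw [hz, coe_trace_mk, h, diag_zero, zero_add]
  · rintro ⟨m, rfl⟩
    obtain ⟨z, rfl⟩ := Submodule.Quotient.mk_surjective _ m
    exact projRing_eq (z := z) (by rw [coe_trace_mk, diag_zero, zero_add])

variable (p B) in
/-- The projection of the invariants of `B^{⊗ p}` onto the Frobenius twist of `B`. -/
def proj : TwoTerm.Inv (TwoTerm.cyc k p B) →ₐ[k] twist p B where
  __ : TwoTerm.Inv (TwoTerm.cyc k p B) →+* B := projRing p B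
  commutes' c := by
    refine projRing_eq (a := algebraMap k B (frobInv p k c)) (z := 0) ?_
    rw [map_zero, add_zero, Algebra.algebraMap_eq_smul_one (frobInv p k c), diag_smul, frobInv_pow,
      diag_one, Algebra.algebraMap_eq_smul_one]
    rfl

variable (p B) in
/-- The map `a ↦ [a ⊗ ⋯ ⊗ a]` is linear on the Frobenius twist. -/
def diagTw : twist p B →ₗ[k] TwoTerm.Coinv (TwoTerm.cyc k p B) where
  toFun a := diagCoinv k p B a
  map_add' := map_add (diagCoinv k p B)
  map_smul' c a := by
    change B at a
    change diagCoinv k p B (frobInv p k c • a) = c • diagCoinv k p B a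
    rw [diagCoinv_apply, diag_smul, frobInv_pow]
    rfl

/-- In degree `1`, the homology of the Tate complex is the Frobenius twist of `B`. -/
lemma trace_eq_zero_iff {m : TwoTerm.Coinv (TwoTerm.cyc k p B)} :
    TwoTerm.trace (TwoTerm.cyc_pow k p B) m = 0 ↔ ∃ a, diagCoinv k p B a = m := by
  constructor
  · intro h
    obtain ⟨x, rfl⟩ := Submodule.Quotient.mk_surjective _ m
    obtain ⟨a, ha⟩ := exists_diag_of_trL_eq_zero (p := p)
      ((coe_trace_mk x).symm.trans (congrArg Subtype.val h))
    exact ⟨a, (coinv_eq_iff.2 ha).symm⟩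
  · rintro ⟨a, rfl⟩
    exact trace_diagCoinv (B := B) a

/-- The invariants act on the homology in degree `1` through their projection to `B`, since the
product of a trace and a diagonal tensor is a trace, whose class is zero. -/
lemma diagCoinv_mul (x : TwoTerm.Inv (TwoTerm.cyc k p B)) (a : B) :
    diagCoinv k p B (projRing p B x * a) = TwoTerm.coinvL _ x (diagCoinv k p B a) := by
  obtain ⟨z, hz⟩ := exists_eq_diag_projRing x
  rw [diagCoinv_apply, diagCoinv_apply, TwoTerm.coinvL_mk, coinv_eq_iff, hz, diag_mul, add_mul,
    sub_add_cancel_left, ← trL_mul_diag]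
  exact neg_mem (trL_mem_range _)

lemma diagCoinv_mul' (a : B) (x : TwoTerm.Inv (TwoTerm.cyc k p B)) :
    diagCoinv k p B (a * projRing p B x) = TwoTerm.coinvR _ (diagCoinv k p B a) x := by
  obtain ⟨z, hz⟩ := exists_eq_diag_projRing x
  rw [diagCoinv_apply, diagCoinv_apply, TwoTerm.coinvR_mk, coinv_eq_iff, hz, diag_mul, mul_add,
    sub_add_cancel_left, ← trL_diag_mul]
  exact neg_mem (trL_mem_range _)

variable (p B) in
/-- The cycles of the Tate complex of `B^{⊗ p}`, as a two-term DG algebra with zero differential: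
the invariants in degree `0` and the Frobenius twist of `B` in degree `1`. -/
def cycles : TwoTerm k where
  R := TwoTerm.Inv (TwoTerm.cyc k p B)
  M := twist p B
  lact := (LinearMap.mul k (twist p B)).comp (proj p B).toLinearMap
  ract := (LinearMap.mul k (twist p B)).compl₂ (proj p B).toLinearMap
  d := 0
  one_lact m := (congrArg (· * m) (map_one (proj p B))).trans (one_mul m)
  ract_one m := (congrArg (m * ·) (map_one (proj p B))).trans (mul_one m)
  mul_lact r s m := (congrArg (· * m) (map_mul (proj p B) r s)).trans (mul_assoc _ _ m)
  ract_mul m r s := (congrArg (m * ·) (map_mul (proj p B) r s)).trans (mul_assoc m _ _).symm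
  lact_ract r m s := mul_assoc _ m _
  d_lact r m := (mul_zero r).symm
  d_ract m r := (zero_mul r).symm
  peiffer m m' := by simp

variable (p B) in
/-- The inclusion of the cycles. -/
def cyclesToDag : cycles p B ⟶ TwoTerm.tate (TwoTerm.cyc_pow k p B) where
  f := AlgHom.id k _
  g := diagTw p B
  g_lact r m := diagCoinv_mul (B := B) r m
  g_ract m r := diagCoinv_mul' (B := B) m r
  f_d m := (trace_diagCoinv (B := B) m).symm

variable (p B) in
/-- The projection of the cycles to homology. -/
def cyclesToSquareZero : cycles p B ⟶ TwoTerm.squareZero (twist p B) where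
  f := proj p B
  g := LinearMap.id
  g_lact _ _ := rfl
  g_ract _ _ := rfl
  f_d _ := map_zero (proj p B)

end Single

variable {B C : AlgCat.{u} k} (φ : B ⟶ C)

variable (p) in
/-- Functoriality of the invariants. -/
def mapInv : TwoTerm.Inv (TwoTerm.cyc k p B) →ₐ[k] TwoTerm.Inv (TwoTerm.cyc k p C) :=
  TwoTerm.Hom.f ((TwoTerm.dagFunctor k p).map φ)

lemma projRing_naturality (x : TwoTerm.Inv (TwoTerm.cyc k p B)) :
    projRing p C (mapInv p φ x) = φ.hom (projRing p B x) := by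
  obtain ⟨z, hz⟩ := exists_eq_diag_projRing x
  have h := TwoTerm.Hom.f_d ((TwoTerm.dagFunctor k p).map φ) (Submodule.Quotient.mk z)
  have h1 : TwoTerm.tpowMap k p φ.hom (trL k p B z) = trL k p C (TwoTerm.tpowMap k p φ.hom z) :=
    (congrArg _ (norm_cyc z).symm).trans ((congrArg Subtype.val h).trans (norm_cyc _))
  refine projRing_eq (z := TwoTerm.tpowMap k p φ.hom z) ?_
  refine (congrArg (TwoTerm.tpowMap k p φ.hom) hz).trans ?_
  rw [map_add, h1, tpowMap_diag]

/-- Functoriality of the cycles. -/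
def cyclesMap : cycles p B ⟶ cycles p C where
  f := mapInv p φ
  g := ((restrictAlg (frobInv p k)).map φ).hom.toLinearMap
  g_lact r m := by
    change B at m
    exact (map_mul φ.hom (projRing p B r) m).trans
      (congrArg (· * φ.hom m) (projRing_naturality φ r).symm)
  g_ract m r := by
    change B at m
    exact (map_mul φ.hom m (projRing p B r)).trans
      (congrArg (φ.hom m * ·) (projRing_naturality φ r).symm)
  f_d _ := map_zero _

variable (k p) in
/-- The cycles, as a functor. -/
def cyclesFunctor : AlgCat.{u} k ⥤ TwoTerm k where
  obj B := cycles p B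
  map φ := cyclesMap φ
  map_id B :=
    have h : mapInv p (𝟙 B) = AlgHom.id k _ :=
      congrArg TwoTerm.Hom.f ((TwoTerm.dagFunctor k p).map_id B)
    TwoTerm.Hom.ext h rfl
  map_comp φ ψ :=
    have h : mapInv p (φ ≫ ψ) = (mapInv p ψ).comp (mapInv p φ) :=
      congrArg TwoTerm.Hom.f ((TwoTerm.dagFunctor k p).map_comp φ ψ)
    TwoTerm.Hom.ext h rfl

variable (k p) in
/-- The inclusion of the cycles is natural. -/
def cyclesToDagNat : cyclesFunctor k p ⟶ TwoTerm.dagFunctor k p where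
  app B := cyclesToDag p B
  naturality B C φ :=
    have h : ∀ a : B, diagCoinv k p C (φ.hom a) =
        TwoTerm.Hom.g ((TwoTerm.dagFunctor k p).map φ) (diagCoinv k p B a) :=
      fun a => congrArg Submodule.Quotient.mk (tpowMap_diag φ.hom a).symm
    TwoTerm.Hom.ext (AlgHom.ext fun _ => rfl) (LinearMap.ext h)

variable (k p) in
/-- The projection of the cycles to homology is natural. -/
def cyclesToSquareZeroNat :
    cyclesFunctor k p ⟶ restrictAlg (frobInv p k) ⋙ TwoTerm.squareZeroFunctor k where
  app B := cyclesToSquareZero p B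
  naturality _ _ φ := TwoTerm.Hom.ext (AlgHom.ext fun x => projRing_naturality φ x) rfl

end Perfect

end CyclicTensor

/-! ### Lifts modulo `p²` and the splitting they induce -/

/-- What the sections over an object of the site retain of a flat `W₂(k)`-lift `B` of the
Frobenius twist of a `k`-algebra `A`: the reduction `B → A`, the inclusion `A → B` of the kernel
of the reduction induced by the multiplication by `p`, and the Teichmüller elements in the centre
of `B`. The reduction need not be surjective. -/
structure LiftData (p : ℕ) [Fact p.Prime] (k : Type u) [Field k] [CharP k p] [PerfectField k] where
  /-- the algebra in characteristic `p` -/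
  A : AlgCat.{u} k
  /-- the ring lifting it -/
  B : RingCat.{u}
  /-- the reduction -/
  red : B →+* A
  /-- the inclusion of the kernel of the reduction -/
  inc : A →+ B
  inc_injective : Function.Injective inc
  inc_red (b : B) : inc (red b) = p • b
  red_inc (a : A) : red (inc a) = 0
  exists_inc (b : B) (hb : red b = 0) : ∃ a, inc a = b
  mul_inc (b : B) (a : A) : b * inc a = inc (red b * a)
  inc_mul (a : A) (b : B) : inc a * b = inc (a * red b)
  /-- the Teichmüller elements -/
  teich : k →* B
  teich_comm (c : k) (b : B) : teich c * b = b * teich c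
  red_teich (c : k) : red (teich c) = algebraMap k A (frobInv p k c)
  teich_add (c d : k) : teich (c ^ p + d ^ p) = teich (c ^ p) + teich (d ^ p) +
    p • ∑ w ∈ CyclicWord.binaryReps p, teich (∏ i, bif w i then c else d)

namespace LiftData

open CyclicTensor CyclicWord

variable {p : ℕ} [Fact p.Prime] {k : Type u} [Field k] [CharP k p] [PerfectField k]
  (D : LiftData p k)

/-- The monoid ring of the multiplicative monoid of `B`. -/
abbrev L : Type u := MonoidAlgebra ℤ D.B

/-- The class `[b]` in the monoid ring. -/
abbrev cls : D.B →* D.L := MonoidAlgebra.of ℤ D.B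

/-- The tautological ring homomorphism `ℤ[B] → B`. -/
def toB : D.L →ₐ[ℤ] D.B := MonoidAlgebra.lift ℤ D.B D.B (MonoidHom.id D.B)

@[simp] lemma toB_cls (b : D.B) : D.toB (D.cls b) = b := MonoidAlgebra.lift_of _ _

/-- The composite `ℤ[B] → B → A`. -/
def toA : D.L →+* D.A := D.red.comp D.toB.toRingHom

lemma toA_apply (s : D.L) : D.toA s = D.red (D.toB s) := rfl

@[simp] lemma toA_cls (b : D.B) : D.toA (D.cls b) = D.red b := by rw [toA_apply, toB_cls]

/-- The coinvariants of `A^{⊗ p}`. -/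
abbrev C : Type u := TwoTerm.Coinv (TwoTerm.cyc k p D.A)

/-- The ring homomorphism from `ℤ[B]` to the invariants of `A^{⊗ p}` sending `[b]` to
`a ⊗ ⋯ ⊗ a`, where `a` is the reduction of `b`. -/
def toInv : D.L →ₐ[ℤ] TwoTerm.Inv (TwoTerm.cyc k p D.A) :=
  MonoidAlgebra.lift ℤ _ D.B ((diagInv k p D.A).comp D.red.toMonoidHom)

lemma coe_toInv_cls (b : D.B) :
    (D.toInv (D.cls b) : TwoTerm.TPow k p D.A) = diag k p (D.red b) :=
  congrArg Subtype.val (MonoidAlgebra.lift_of ((diagInv k p D.A).comp D.red.toMonoidHom) b)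

/-- The ring homomorphism `ℤ[B] → ℤ[B]^{⊗ p}` sending `[b]` to `[b] ⊗ ⋯ ⊗ [b]`. -/
def comul : D.L →ₐ[ℤ] ⨂[ℤ] _ : ZMod p, D.L :=
  MonoidAlgebra.lift ℤ _ D.B ((diagHom ℤ p D.L).comp D.cls)

@[simp] lemma comul_cls (b : D.B) : D.comul (D.cls b) = diag ℤ p (D.cls b) :=
  MonoidAlgebra.lift_of _ _

/-- The multilinear map underlying `ℤ[B]^{⊗ p} → A^{⊗ p}`. -/
def evMultilinear : MultilinearMap ℤ (fun _ : ZMod p => D.L) (TwoTerm.TPow k p D.A) where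
  toFun s := PiTensorProduct.tprod k fun i => D.toA (s i)
  map_update_add' m i x y := by
    have h : ∀ x, (fun j => D.toA (Function.update m i x j)) =
        Function.update (fun j => D.toA (m j)) i (D.toA x) := fun x =>
      funext fun j => Function.apply_update (fun _ => D.toA) m i x j
    rw [h, h, h, map_add, MultilinearMap.map_update_add]
  map_update_smul' m i n x := by
    have h : ∀ x, (fun j => D.toA (Function.update m i x j)) =
        Function.update (fun j => D.toA (m j)) i (D.toA x) := fun x =>
      funext fun j => Function.apply_update (fun _ => D.toA) m i x j
    rw [h, h, map_zsmul, ← Int.cast_smul_eq_zsmul k, MultilinearMap.map_update_smul,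
      Int.cast_smul_eq_zsmul]

/-- The ring homomorphism `ℤ[B]^{⊗ p} → A^{⊗ p}`. -/
def ev : (⨂[ℤ] _ : ZMod p, D.L) →+* TwoTerm.TPow k p D.A :=
  -- instance search would find the `ℤ`-algebra structure of a tensor product, whose scalar action
  -- is not definitionally that of the additive group
  letI : Algebra ℤ (TwoTerm.TPow k p D.A) := Ring.toIntAlgebra _
  (PiTensorProduct.liftAlgHom D.evMultilinear
    (congrArg (PiTensorProduct.tprod k) (funext fun _ => map_one D.toA))
    (fun x y => (congrArg (PiTensorProduct.tprod k)
      (funext fun i => map_mul D.toA (x i) (y i))).trans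
      (PiTensorProduct.tprod_mul_tprod _ _).symm)).toRingHom

lemma ev_tprod (s : ZMod p → D.L) :
    D.ev (PiTensorProduct.tprod ℤ s) = PiTensorProduct.tprod k fun i => D.toA (s i) :=
  PiTensorProduct.lift.tprod (φ := D.evMultilinear) _

lemma ev_diag (s : D.L) : D.ev (diag ℤ p s) = diag k p (D.toA s) := D.ev_tprod _

lemma ev_rotL (z : ⨂[ℤ] _ : ZMod p, D.L) : D.ev (rotL ℤ p D.L z) = rotL k p D.A (D.ev z) := by
  induction z using PiTensorProduct.induction_on with
  | smul_tprod r f =>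
    rw [map_zsmul, map_zsmul, map_zsmul, map_zsmul, rotL_tprod, ev_tprod, ev_tprod, rotL_tprod]
    rfl
  | add x y hx hy => simp [hx, hy]

lemma ev_trL (z : ⨂[ℤ] _ : ZMod p, D.L) : D.ev (trL ℤ p D.L z) = trL k p D.A (D.ev z) := by
  have h : ∀ j : ℕ, D.ev ((rotL ℤ p D.L ^ j) z) = (rotL k p D.A ^ j) (D.ev z) := by
    intro j
    induction j with
    | zero => rfl
    | succ j ih =>
      rw [pow_succ', pow_succ', Module.End.mul_apply, Module.End.mul_apply, ev_rotL, ih]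
  rw [trL, trL, LinearMap.sum_apply, LinearMap.sum_apply, map_sum]
  exact Finset.sum_congr rfl fun j _ => h j

lemma ev_mixed (s t : D.L) : D.ev (mixed ℤ p s t) = mixed k p (D.toA s) (D.toA t) := by
  rw [mixed, mixed, map_sum]
  refine Finset.sum_congr rfl fun w _ => ?_
  rw [ev_tprod]
  congr 1
  funext i
  cases w i <;> rfl

lemma ev_comul (s : D.L) : D.ev (D.comul s) = D.toInv s := by
  induction s using MonoidAlgebra.induction_on with
  | of b => rw [← cls, comul_cls, ev_diag, coe_toInv_cls, toA_cls]
  | add s t hs ht => rw [map_add, map_add, map_add, hs, ht]; rfl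
  | smul n s hs => rw [map_zsmul, map_zsmul, map_zsmul, hs]; rfl

/-- Elements of `ℤ[B]^{⊗ p}` with the same trace have the same image in the coinvariants of
`A^{⊗ p}`, because `ℤ[B]` is free over `ℤ`. -/
lemma mk_ev_eq_of_trL_eq {z z' : ⨂[ℤ] _ : ZMod p, D.L}
    (h : trL ℤ p D.L z = trL ℤ p D.L z') :
    (Submodule.Quotient.mk (D.ev z) : D.C) = Submodule.Quotient.mk (D.ev z') := by
  have hz : trL ℤ p D.L (z - z') = 0 := by rw [map_sub, h, sub_self]
  obtain ⟨y, hy⟩ := mem_range_of_trL_eq_zero_of_free (R := ℤ) (p := p)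
    (fun r hr => (mul_eq_zero.1 hr).resolve_left
      (Nat.cast_ne_zero.2 (Fact.out : p.Prime).ne_zero)) hz
  rw [coinv_eq_iff, ← map_sub, ← hy]
  exact ⟨D.ev y, by simp [ev_rotL]⟩

/-- In `ℤ[B]^{⊗ p}`, the difference between the linear and the multiplicative extension of
`[b] ↦ [b] ⊗ ⋯ ⊗ [b]` is a trace. -/
lemma exists_trL_eq (s : D.L) : ∃ z, trL ℤ p D.L z = D.comul s - diag ℤ p s := by
  induction s using MonoidAlgebra.induction_on with
  | of b => exact ⟨0, by rw [← cls, comul_cls, sub_self, map_zero]⟩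
  | add s t hs ht =>
    obtain ⟨y, hy⟩ := hs
    obtain ⟨z, hz⟩ := ht
    refine ⟨y + z - mixed ℤ p s t, ?_⟩
    rw [map_sub, map_add, hy, hz, map_add, diag_add]
    abel
  | smul n s hs =>
    obtain ⟨y, hy⟩ := hs
    obtain ⟨m, hm⟩ : (p : ℤ) ∣ n ^ p - n := by
      rw [← ZMod.intCast_zmod_eq_zero_iff_dvd]
      push_cast
      rw [ZMod.pow_card, sub_self]
    refine ⟨n • y - m • diag ℤ p s, ?_⟩
    rw [map_sub, map_smul, map_smul, hy, trL_diag, map_smul, diag_smul, smul_smul, mul_comm m,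
      ← hm]
    module

/-- The relation defining the splitting: `x` is the class of `T⁻¹` of the difference between the
linear and the multiplicative extension of the diagonal to `s`, corrected by the element of `A`
that measures `s` in `B`. -/
def Splits (s : D.L) (x : D.C) : Prop :=
  ∃ z a, trL ℤ p D.L z = D.comul s - diag ℤ p s ∧ D.inc a = D.toB s ∧
    x = Submodule.Quotient.mk (D.ev z) - diagCoinv k p D.A a

variable {D}

/-- The element `z` is determined up to the kernel of the map to the coinvariants, and `a` by the
injectivity of `inc`. -/
lemma Splits.unique {s : D.L} {x y : D.C} (hx : D.Splits s x) (hy : D.Splits s y) : x = y := by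
  obtain ⟨z, a, hz, ha, rfl⟩ := hx
  obtain ⟨z', a', hz', ha', rfl⟩ := hy
  rw [D.mk_ev_eq_of_trL_eq (hz.trans hz'.symm), D.inc_injective (ha.trans ha'.symm)]

lemma exists_splits {s : D.L} (hs : D.toA s = 0) : ∃ x, D.Splits s x := by
  obtain ⟨z, hz⟩ := D.exists_trL_eq s
  obtain ⟨a, ha⟩ := D.exists_inc _ hs
  exact ⟨_, z, a, hz, ha, rfl⟩

lemma Splits.add {s t : D.L} {x y : D.C} (hs : D.toA s = 0) (hx : D.Splits s x)
    (hy : D.Splits t y) : D.Splits (s + t) (x + y) := by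
  obtain ⟨z, a, hz, ha, rfl⟩ := hx
  obtain ⟨z', a', hz', ha', rfl⟩ := hy
  refine ⟨z + z' - mixed ℤ p s t, a + a', ?_, by rw [map_add, map_add, ha, ha'], ?_⟩
  · rw [map_sub, map_add, hz, hz', map_add, diag_add]
    abel
  · rw [map_sub, map_add, ev_mixed, hs, mixed_zero_left, sub_zero, map_add,
      Submodule.Quotient.mk_add]
    abel

lemma Splits.cls_mul (b : D.B) {s : D.L} {x : D.C} (hx : D.Splits s x) :
    D.Splits (D.cls b * s)
      (TwoTerm.coinvL (TwoTerm.cyc k p D.A) (D.toInv (D.cls b)) x) := by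
  obtain ⟨z, a, hz, ha, rfl⟩ := hx
  refine ⟨diag ℤ p (D.cls b) * z, D.red b * a, ?_, ?_, ?_⟩
  · rw [trL_diag_mul, hz, map_mul, diag_mul, mul_sub, comul_cls]
  · rw [← D.mul_inc, ha, map_mul, toB_cls]
  · rw [map_sub, TwoTerm.coinvL_mk, diagCoinv_apply, TwoTerm.coinvL_mk, coe_toInv_cls, map_mul,
      ev_diag, diagCoinv_apply, diag_mul, toA_cls]

lemma Splits.mul_cls (b : D.B) {s : D.L} {x : D.C} (hx : D.Splits s x) :
    D.Splits (s * D.cls b)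
      (TwoTerm.coinvR (TwoTerm.cyc k p D.A) x (D.toInv (D.cls b))) := by
  obtain ⟨z, a, hz, ha, rfl⟩ := hx
  refine ⟨z * diag ℤ p (D.cls b), a * D.red b, ?_, ?_, ?_⟩
  · rw [trL_mul_diag, hz, map_mul, diag_mul, sub_mul, comul_cls]
  · rw [← D.inc_mul, ha, map_mul, toB_cls]
  · rw [map_sub, LinearMap.sub_apply, TwoTerm.coinvR_mk, diagCoinv_apply, TwoTerm.coinvR_mk,
      coe_toInv_cls, map_mul, ev_diag, diagCoinv_apply, diag_mul, toA_cls]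

/-- The splitting is a section of the trace map. -/
lemma Splits.trace_eq {s : D.L} (hs : D.toA s = 0) {x : D.C} (hx : D.Splits s x) :
    TwoTerm.trace (TwoTerm.cyc_pow k p D.A) x = D.toInv s := by
  obtain ⟨z, a, hz, ha, rfl⟩ := hx
  refine Subtype.ext ?_
  rw [map_sub, trace_diagCoinv, sub_zero, coe_trace_mk, ← ev_trL, hz, map_sub, ev_comul, ev_diag,
    hs, diag_zero, sub_zero]

/-- The failure of additivity of the Teichmüller elements is killed by the splitting: the mixed
words in the Teichmüller elements contribute the same element, once through the tensor power and
once through the lift `B`, and the two contributions cancel. -/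
lemma splits_teich (c d : k) : D.Splits
    (D.cls (D.teich (c ^ p + d ^ p)) - D.cls (D.teich (c ^ p)) - D.cls (D.teich (d ^ p))) 0 := by
  set X := D.cls (D.teich (c ^ p + d ^ p)) with hX
  set Y := D.cls (D.teich (c ^ p)) with hY
  set Z := D.cls (D.teich (d ^ p)) with hZ
  -- by `teich_add`, the element of `A` that measures `X - Y - Z` in the lift
  let e : k := ∑ w ∈ binaryReps p, frobInv p k (∏ i, bif w i then c else d)
  have he : e ^ p = ∑ w ∈ binaryReps p, ∏ i, bif w i then c else d := by
    rw [sum_pow_char]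
    exact Finset.sum_congr rfl fun w _ => frobInv_pow _
  have hB : D.inc (algebraMap k D.A e) = D.toB (X - Y - Z) := by
    rw [map_sub, map_sub, hX, hY, hZ, toB_cls, toB_cls, toB_cls, D.teich_add, map_sum, map_sum,
      Finset.smul_sum]
    simp only [← D.red_teich, D.inc_red]
    abel
  have hA : D.toA (X - Y - Z) = 0 := by rw [toA_apply, ← hB, D.red_inc]
  refine ⟨mixed ℤ p (X - Y - Z) (Y + Z) + mixed ℤ p Y Z, algebraMap k D.A e, ?_, hB, ?_⟩
  · have h1 := diag_add ℤ (p := p) (X - Y - Z) (Y + Z)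
    rw [show X - Y - Z + (Y + Z) = X by abel, diag_add ℤ Y Z] at h1
    rw [map_sub, map_sub, hX, hY, hZ, comul_cls, comul_cls, comul_cls, ← hX, ← hY, ← hZ, h1,
      map_add]
    abel
  · have h1 : diag k p (algebraMap k D.A e) = e ^ p • diag k p (1 : D.A) := by
      rw [Algebra.algebraMap_eq_smul_one, diag_smul]
    have h2 : D.ev (mixed ℤ p Y Z) = e ^ p • diag k p (1 : D.A) := by
      rw [ev_mixed, hY, hZ, toA_cls, toA_cls, D.red_teich, D.red_teich, frobInv_apply_pow,
        frobInv_apply_pow, he, Finset.sum_smul, mixed]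
      refine Finset.sum_congr rfl fun w _ => ?_
      rw [CyclicTensor.diag, ← MultilinearMap.map_smul_univ]
      congr 1
      funext i
      rw [← Algebra.algebraMap_eq_smul_one]
      cases w i <;> rfl
    rw [map_add, ev_mixed, hA, mixed_zero_left, zero_add, h2, diagCoinv_apply, h1, sub_self]

end LiftData

/-! ### The roof of the zigzag -/

namespace LiftData

open CyclicTensor CyclicWord

variable {p : ℕ} [Fact p.Prime] {k : Type u} [Field k] [CharP k p] [PerfectField k]
  (D : LiftData p k)

/-- The splitting `ker (ℤ[B] → A) → (A^{⊗ p})_{ℤ/p}` of the trace map over the lift. -/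
def split : RingHom.ker D.toA →+ D.C :=
  AddMonoidHom.mk' (fun s => (exists_splits s.2).choose) fun s t =>
    (exists_splits (s + t).2).choose_spec.unique
      ((exists_splits s.2).choose_spec.add s.2 (exists_splits t.2).choose_spec)

lemma splits_split (s : RingHom.ker D.toA) : D.Splits s (D.split s) :=
  (exists_splits s.2).choose_spec

variable {D} in
lemma Splits.split_eq {s : RingHom.ker D.toA} {x : D.C} (h : D.Splits s x) : D.split s = x :=
  (D.splits_split s).unique h

variable {D} in
/-- Additive maps out of `ℤ[B]` are determined by their values on the classes `[b]`. -/
lemma addHom_ext {M : Type*} [AddCommGroup M] {F G : D.L →+ M}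
    (h : ∀ b, F (D.cls b) = G (D.cls b)) : F = G := by
  refine DFunLike.ext _ _ fun r => ?_
  induction r using MonoidAlgebra.induction_on with
  | of b => exact h b
  | add x y hx hy => rw [map_add, map_add, hx, hy]
  | smul n x hx => rw [map_zsmul, map_zsmul, hx]

lemma split_mul (r : D.L) (s : RingHom.ker D.toA) (h : r * s ∈ RingHom.ker D.toA) :
    D.split ⟨r * s, h⟩ = TwoTerm.coinvL _ (D.toInv r) (D.split s) := by
  let g : D.L →+ RingHom.ker D.toA := AddMonoidHom.mk'
    (fun r => ⟨r * s, Ideal.mul_mem_left _ r s.2⟩) fun x y => Subtype.ext (add_mul x y s.1)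
  let e : TwoTerm.Inv (TwoTerm.cyc k p D.A) →+ D.C := AddMonoidHom.mk'
    (fun r => TwoTerm.coinvL _ r (D.split s))
    fun x y => by rw [map_add, LinearMap.add_apply]
  suffices H : D.split.comp g = e.comp (D.toInv : D.L →+ _) from DFunLike.congr_fun H r
  exact addHom_ext fun b => Splits.split_eq (s := g (D.cls b)) ((D.splits_split s).cls_mul b)

lemma split_mul' (s : RingHom.ker D.toA) (r : D.L) (h : s * r ∈ RingHom.ker D.toA) :
    D.split ⟨s * r, h⟩ = TwoTerm.coinvR _ (D.split s) (D.toInv r) := by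
  let g : D.L →+ RingHom.ker D.toA := AddMonoidHom.mk'
    (fun r => ⟨s * r, Ideal.mul_mem_right r _ s.2⟩) fun x y => Subtype.ext (mul_add s.1 x y)
  let e : TwoTerm.Inv (TwoTerm.cyc k p D.A) →+ D.C := AddMonoidHom.mk'
    (fun r => TwoTerm.coinvR _ (D.split s) r) fun x y => by rw [map_add]
  suffices H : D.split.comp g = e.comp (D.toInv : D.L →+ _) from DFunLike.congr_fun H r
  exact addHom_ext fun b => Splits.split_eq (s := g (D.cls b)) ((D.splits_split s).mul_cls b)

lemma trace_split (s : RingHom.ker D.toA) :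
    TwoTerm.trace (TwoTerm.cyc_pow k p D.A) (D.split s) = D.toInv s :=
  (D.splits_split s).trace_eq s.2

/-- The kernel of the splitting, as an ideal of `ℤ[B]`. -/
def splitKer : Ideal D.L where
  carrier := {s | D.toA s = 0 ∧ D.Splits s 0}
  zero_mem' := by
    have h := D.splits_split 0
    rw [map_zero] at h
    exact ⟨map_zero _, h⟩
  add_mem' := by
    rintro s t ⟨hs, hs'⟩ ⟨ht, ht'⟩
    refine ⟨by rw [map_add, hs, ht, add_zero], ?_⟩
    rw [← add_zero (0 : D.C)]
    exact hs'.add hs ht'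
  smul_mem' := by
    rintro r s ⟨hs, hs'⟩
    have h : D.toA (r * s) = 0 := by rw [map_mul, hs, mul_zero]
    have h' := D.splits_split ⟨r * s, h⟩
    rw [D.split_mul r ⟨s, hs⟩ h, Splits.split_eq (s := ⟨s, hs⟩) hs', map_zero] at h'
    exact ⟨h, h'⟩

instance : D.splitKer.IsTwoSided where
  mul_mem_of_left := by
    rintro s r ⟨hs, hs'⟩
    have h : D.toA (s * r) = 0 := by rw [map_mul, hs, zero_mul]
    have h' := D.splits_split ⟨s * r, h⟩
    rw [D.split_mul' ⟨s, hs⟩ r h, Splits.split_eq (s := ⟨s, hs⟩) hs', map_zero,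
      LinearMap.zero_apply] at h'
    exact ⟨h, h'⟩

/-- The quotient of `ℤ[B]` by the kernel of the splitting. In contrast to `ℤ[B]`, it is a
`k`-algebra. -/
def S : Type u := D.L ⧸ D.splitKer

instance : Ring D.S := inferInstanceAs (Ring (D.L ⧸ D.splitKer))

/-- The quotient map `ℤ[B] → S`. -/
def toS : D.L →+* D.S := Ideal.Quotient.mk D.splitKer

lemma toS_surjective : Function.Surjective D.toS := Ideal.Quotient.mk_surjective

variable {D} in
lemma toS_eq_zero_iff {s : D.L} :
    D.toS s = 0 ↔ D.toA s = 0 ∧ D.Splits s 0 := Ideal.Quotient.eq_zero_iff_mem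

/-- The scalars of `S` are the classes of the Teichmüller elements. -/
def teichS : k →+* D.S :=
  let f : k →* D.S := (D.toS : D.L →* D.S).comp (D.cls.comp D.teich)
  have hadd : ∀ c d, f (c + d) = f c + f d := fun c d => by
    have h := D.splits_teich (frobInv p k c) (frobInv p k d)
    have hpow : ∀ c, frobInv p k c ^ p = c := frobeniusEquiv_symm_pow_p k p
    rw [hpow, hpow] at h
    obtain ⟨z, a, -, ha, -⟩ := id h
    have hA : D.toA (D.cls (D.teich (c + d)) - D.cls (D.teich c) - D.cls (D.teich d)) = 0 := by
      rw [toA_apply, ← ha, D.red_inc]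
    have h0 := toS_eq_zero_iff.2 ⟨hA, h⟩
    rw [map_sub, map_sub, sub_sub, sub_eq_zero] at h0
    exact h0
  { f with
    map_zero' := by
      have := hadd 0 0
      rw [add_zero] at this
      exact left_eq_add.1 this
    map_add' := hadd }

lemma teichS_apply (c : k) : D.teichS c = D.toS (D.cls (D.teich c)) := rfl

lemma cls_teich_comm (c : k) (s : D.L) :
    D.cls (D.teich c) * s = s * D.cls (D.teich c) := by
  induction s using MonoidAlgebra.induction_on with
  | of b => rw [← map_mul, ← map_mul, D.teich_comm]
  | add x y hx hy => rw [mul_add, add_mul, hx, hy]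
  | smul n x hx => rw [mul_smul_comm, smul_mul_assoc, hx]

instance : Algebra k D.S :=
  RingHom.toAlgebra' D.teichS fun c x => by
    obtain ⟨s, rfl⟩ := D.toS_surjective x
    rw [teichS_apply, ← map_mul, cls_teich_comm, map_mul]

lemma smul_toS (c : k) (s : D.L) : c • D.toS s = D.toS (D.cls (D.teich c) * s) := by
  rw [Algebra.smul_def, map_mul]
  rfl

/-- The Frobenius twist of `A`. -/
abbrev Tw : AlgCat.{u} k := twist p D.A

/-- The algebra homomorphism from `S` to the Frobenius twist of `A`. -/
def quo : D.S →ₐ[k] D.Tw where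
  __ : D.S →+* D.A := Ideal.Quotient.lift D.splitKer D.toA fun _ h => h.1
  commutes' c := by
    change D.toA (D.cls (D.teich c)) = algebraMap k D.A (frobInv p k c)
    rw [toA_cls, D.red_teich]

@[simp] lemma quo_toS (s : D.L) : D.quo (D.toS s) = D.toA s := rfl

lemma toInv_teich (c : k) :
    D.toInv (D.cls (D.teich c)) = algebraMap k (TwoTerm.Inv (TwoTerm.cyc k p D.A)) c := by
  refine Subtype.ext ?_
  rw [coe_toInv_cls, D.red_teich, Algebra.algebraMap_eq_smul_one, diag_smul]
  rw [frobInv_pow,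
    Algebra.algebraMap_eq_smul_one]
  rfl

/-- The algebra homomorphism from `S` to the invariants of `A^{⊗ p}`. -/
def inv : D.S →ₐ[k] TwoTerm.Inv (TwoTerm.cyc k p D.A) where
  __ : D.S →+* TwoTerm.Inv (TwoTerm.cyc k p D.A) :=
    Ideal.Quotient.lift D.splitKer D.toInv.toRingHom fun s ⟨hs, hs'⟩ => by
      change D.toInv s = 0
      rw [← hs'.trace_eq hs, map_zero]
  commutes' := D.toInv_teich

@[simp] lemma inv_toS (s : D.L) : D.inv (D.toS s) = D.toInv s := rfl

/-- The kernel of the homomorphism from `S` to the Frobenius twist of `A`. -/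
abbrev I : Ideal D.S := RingHom.ker D.quo

lemma exists_toS_eq (i : D.I) : ∃ s : RingHom.ker D.toA, D.toS s = i := by
  obtain ⟨s, hs⟩ := D.toS_surjective i
  have hi : D.quo i = 0 := i.2
  rw [← hs, quo_toS] at hi
  exact ⟨⟨s, hi⟩, hs⟩

variable {D} in
lemma split_eq_of_toS_eq {s t : RingHom.ker D.toA} (h : D.toS s = D.toS t) :
    D.split s = D.split t := by
  rw [← sub_eq_zero, ← map_sub] at h
  rw [← sub_eq_zero, ← map_sub]
  exact Splits.split_eq (s := s - t) (toS_eq_zero_iff.1 h).2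

/-- The splitting, on the quotient `I` of `ker (ℤ[B] → A)`. -/
def splitI : D.I →ₗ[k] D.C where
  toFun i := D.split (D.exists_toS_eq i).choose
  map_add' i j := by
    rw [← map_add]
    refine split_eq_of_toS_eq ?_
    rw [(D.exists_toS_eq (i + j)).choose_spec, Submodule.coe_add, Submodule.coe_add, map_add,
      (D.exists_toS_eq i).choose_spec, (D.exists_toS_eq j).choose_spec]
  map_smul' c i := by
    have h := Ideal.mul_mem_left _ (D.cls (D.teich c)) (D.exists_toS_eq i).choose.2
    refine (split_eq_of_toS_eq (t := ⟨_, h⟩) ?_).trans ?_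
    · rw [(D.exists_toS_eq (c • i)).choose_spec, ← smul_toS, (D.exists_toS_eq i).choose_spec]
      rfl
    · obtain ⟨x, hx⟩ := Submodule.Quotient.mk_surjective _ (D.split (D.exists_toS_eq i).choose)
      rw [split_mul, toInv_teich, ← hx, TwoTerm.coinvL_mk, Algebra.algebraMap_eq_smul_one]
      exact congrArg Submodule.Quotient.mk (by simp)

lemma splitI_eq {i : D.I} (s : RingHom.ker D.toA) (h : D.toS s = i) : D.splitI i = D.split s :=
  split_eq_of_toS_eq ((D.exists_toS_eq i).choose_spec.trans h.symm)

/-- The two-term DG algebra `I ⊕ A^{(1)} → S` with differential given by the inclusion of `I` and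
by zero on the Frobenius twist `A^{(1)}` of `A`. -/
def roof : TwoTerm k where
  R := D.S
  M := D.I × D.Tw
  lact := LinearMap.mk₂ k (fun s m => (s • m.1, D.quo s * m.2))
    (fun s t m => by simp [add_smul, add_mul]) (fun c s m => by simp)
    (fun s m n => by simp [mul_add]) (fun c s m => by simp [smul_comm s c])
  ract := LinearMap.mk₂ k
    (fun m s => (⟨m.1 * s, Ideal.mul_mem_right s _ m.1.2⟩, m.2 * D.quo s))
    (fun m n s => Prod.ext (Subtype.ext (add_mul _ _ _)) (add_mul _ _ _))
    (fun c m s => Prod.ext (Subtype.ext (smul_mul_assoc _ _ _)) (smul_mul_assoc _ _ _))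
    (fun m s t => Prod.ext (Subtype.ext (mul_add _ _ _))
      ((congrArg (m.2 * ·) (map_add D.quo s t)).trans (mul_add _ _ _)))
    (fun c m s => Prod.ext (Subtype.ext (mul_smul_comm _ _ _))
      ((congrArg (m.2 * ·) (map_smul D.quo c s)).trans (mul_smul_comm _ _ _)))
  d := ((D.I.restrictScalars k).subtype).comp (LinearMap.fst k D.I D.Tw)
  one_lact m := by simp
  ract_one m := Prod.ext (Subtype.ext (mul_one _))
    ((congrArg (m.2 * ·) (map_one D.quo)).trans (mul_one _))
  mul_lact r s m := by simp [mul_smul, mul_assoc]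
  ract_mul m r s := Prod.ext (Subtype.ext (mul_assoc _ _ _).symm)
    ((congrArg (m.2 * ·) (map_mul D.quo r s)).trans (mul_assoc _ _ _).symm)
  lact_ract r m s := Prod.ext (Subtype.ext (mul_assoc _ _ _)) (mul_assoc _ _ _)
  d_lact r m := rfl
  d_ract m r := rfl
  peiffer m m' := by
    have h : D.quo m.1 = 0 := m.1.2
    have h' : D.quo m'.1 = 0 := m'.1.2
    refine Prod.ext (Subtype.ext rfl) ?_
    change D.quo m.1 * m'.2 = m.2 * D.quo m'.1
    rw [h, h', zero_mul, mul_zero]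

/-- The projection of the roof to the square-zero extension of the Frobenius twist. -/
def roofToSquareZero : D.roof ⟶ TwoTerm.squareZero D.Tw where
  f := D.quo
  g := LinearMap.snd k D.I D.Tw
  g_lact _ _ := rfl
  g_ract _ _ := rfl
  f_d m := m.1.2

lemma projRing_toInv (s : D.L) : projRing p D.A (D.toInv s) = D.toA s := by
  obtain ⟨z, hz⟩ := D.exists_trL_eq s
  refine projRing_eq (z := D.ev z) ?_
  rw [← ev_trL, hz, map_sub, ev_comul, ev_diag, add_sub_cancel]

lemma projRing_inv (x : D.S) : projRing p D.A (D.inv x) = D.quo x := by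
  obtain ⟨s, rfl⟩ := D.toS_surjective x
  exact D.projRing_toInv s

/-- The map from the roof to the DG algebra `A†`, given by the splitting on `I`. -/
def roofToDag : D.roof ⟶ TwoTerm.tate (TwoTerm.cyc_pow k p D.A) where
  f := D.inv
  g := D.splitI.coprod (diagTw p D.A)
  g_lact r m := by
    obtain ⟨r, rfl⟩ := D.toS_surjective r
    obtain ⟨i, a⟩ := m
    change D.A at a
    obtain ⟨s, hs⟩ := D.exists_toS_eq i
    have h : D.toA (r * s) = 0 := by rw [map_mul, show D.toA s = 0 from s.2, mul_zero]
    change D.splitI (D.toS r • i) + diagCoinv k p D.A (D.toA r * a) =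
      TwoTerm.coinvL _ (D.toInv r) (D.splitI i + diagCoinv k p D.A a)
    rw [map_add, ← projRing_toInv, diagCoinv_mul, D.splitI_eq s hs, ← D.split_mul r s h,
      D.splitI_eq ⟨r * s, h⟩ (by rw [map_mul, hs]; rfl)]
  g_ract m r := by
    obtain ⟨r, rfl⟩ := D.toS_surjective r
    obtain ⟨i, a⟩ := m
    change D.A at a
    obtain ⟨s, hs⟩ := D.exists_toS_eq i
    have h : D.toA (s * r) = 0 := by rw [map_mul, show D.toA s = 0 from s.2, zero_mul]
    change D.splitI ⟨i * D.toS r, _⟩ + diagCoinv k p D.A (a * D.toA r : D.A) =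
      TwoTerm.coinvR _ (D.splitI i + diagCoinv k p D.A a) (D.toInv r)
    rw [map_add, LinearMap.add_apply, ← projRing_toInv, diagCoinv_mul', D.splitI_eq s hs,
      ← D.split_mul' s r h,
      D.splitI_eq ⟨s * r, h⟩ (by rw [map_mul, hs])]
  f_d m := by
    obtain ⟨i, a⟩ := m
    change D.A at a
    obtain ⟨s, hs⟩ := D.exists_toS_eq i
    change D.inv i = TwoTerm.trace (TwoTerm.cyc_pow k p D.A) (D.splitI i + diagCoinv k p D.A a)
    rw [map_add, trace_diagCoinv, add_zero, D.splitI_eq s hs, trace_split, ← hs, inv_toS]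

end LiftData

/-! ### Functoriality of the roof -/

namespace CyclicTensor

open CyclicWord

lemma trL_map {R : Type*} [CommRing R] {p : ℕ} [NeZero p] {V W : Type*} [AddCommGroup V]
    [Module R V] [AddCommGroup W] [Module R W] (f : V →ₗ[R] W) (z : ⨂[R] _ : ZMod p, V) :
    trL R p W (PiTensorProduct.map (fun _ => f) z) =
      PiTensorProduct.map (fun _ => f) (trL R p V z) := by
  suffices H : trL R p W ∘ₗ PiTensorProduct.map (fun _ => f) =
      PiTensorProduct.map (fun _ => f) ∘ₗ trL R p V from LinearMap.congr_fun H z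
  refine PiTensorProduct.ext (MultilinearMap.ext fun b => ?_)
  change trL R p W (PiTensorProduct.map (fun _ => f) (PiTensorProduct.tprod R b)) =
    PiTensorProduct.map (fun _ => f) (trL R p V (PiTensorProduct.tprod R b))
  rw [PiTensorProduct.map_tprod, trL_tprod, trL_tprod, map_sum]
  exact Finset.sum_congr rfl fun j _ => (PiTensorProduct.map_tprod _ _).symm

end CyclicTensor

namespace LiftData

open CyclicTensor CyclicWord

variable {p : ℕ} [Fact p.Prime] {k : Type u} [Field k] [CharP k p] [PerfectField k]

/-- Morphisms of lifting data. -/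
@[ext]
structure Hom (D E : LiftData p k) where
  /-- the map in characteristic `p` -/
  fA : D.A ⟶ E.A
  /-- the map of lifts -/
  fB : D.B →+* E.B
  red_fB (b : D.B) : E.red (fB b) = fA.hom (D.red b)
  inc_fA (a : D.A) : E.inc (fA.hom a) = fB (D.inc a)
  fB_teich (c : k) : fB (D.teich c) = E.teich c

instance : Category (LiftData p k) where
  Hom := Hom
  id D :=
    { fA := 𝟙 _
      fB := RingHom.id _
      red_fB := fun _ => rfl
      inc_fA := fun _ => rfl
      fB_teich := fun _ => rfl }
  comp φ ψ :=
    { fA := φ.fA ≫ ψ.fA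
      fB := ψ.fB.comp φ.fB
      red_fB := fun b => by simp [ψ.red_fB, φ.red_fB]
      inc_fA := fun a => by simp [ψ.inc_fA, φ.inc_fA]
      fB_teich := fun c => by simp [ψ.fB_teich, φ.fB_teich] }

variable (p k) in
/-- The functor remembering the algebra in characteristic `p`. -/
def algFunctor : LiftData p k ⥤ AlgCat.{u} k where
  obj D := D.A
  map φ := Hom.fA φ

variable {D E F : LiftData p k} (φ : D ⟶ E) (ψ : E ⟶ F)

/-- Functoriality of the monoid ring. -/
def mapL : D.L →ₐ[ℤ] E.L := MonoidAlgebra.lift ℤ _ D.B (E.cls.comp (Hom.fB φ).toMonoidHom)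

@[simp] lemma mapL_cls (b : D.B) : mapL φ (D.cls b) = E.cls (Hom.fB φ b) :=
  MonoidAlgebra.lift_of _ _

lemma toB_mapL (s : D.L) : E.toB (mapL φ s) = Hom.fB φ (D.toB s) := by
  suffices H : (E.toB : E.L →+ E.B).comp (mapL φ : D.L →+ E.L) =
      (Hom.fB φ : D.B →+ E.B).comp (D.toB : D.L →+ D.B) from DFunLike.congr_fun H s
  refine addHom_ext fun b => ?_
  change E.toB (mapL φ (D.cls b)) = Hom.fB φ (D.toB (D.cls b))
  rw [mapL_cls, toB_cls, toB_cls]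

lemma toA_mapL (s : D.L) : E.toA (mapL φ s) = (Hom.fA φ).hom (D.toA s) := by
  rw [toA_apply, toB_mapL, Hom.red_fB φ, toA_apply]

lemma toInv_mapL (s : D.L) :
    (E.toInv (mapL φ s) : TwoTerm.TPow k p E.A) =
      TwoTerm.tpowMap k p (Hom.fA φ).hom (D.toInv s : TwoTerm.TPow k p D.A) := by
  let e : ∀ E : LiftData p k, TwoTerm.Inv (TwoTerm.cyc k p E.A) →+ TwoTerm.TPow k p E.A :=
    fun E => (TwoTerm.Inv (TwoTerm.cyc k p E.A)).val
  suffices H : ((e E).comp (E.toInv : E.L →+ _)).comp (mapL φ : D.L →+ E.L) =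
      ((TwoTerm.tpowMap k p (Hom.fA φ).hom : _ →+ _).comp (e D)).comp (D.toInv : D.L →+ _) from
    DFunLike.congr_fun H s
  refine addHom_ext fun b => ?_
  change (E.toInv (mapL φ (D.cls b)) : TwoTerm.TPow k p E.A) =
      TwoTerm.tpowMap k p (Hom.fA φ).hom (D.toInv (D.cls b) : TwoTerm.TPow k p D.A)
  rw [mapL_cls, coe_toInv_cls, coe_toInv_cls, Hom.red_fB φ]
  exact (TwoTerm.tpowMap_tprod k p (Hom.fA φ).hom _).symm

lemma map_mapL_diag (s : D.L) :
    PiTensorProduct.map (fun _ => (mapL φ).toLinearMap) (diag ℤ p s) = diag ℤ p (mapL φ s) :=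
  PiTensorProduct.map_tprod _ _

lemma comul_mapL (s : D.L) : E.comul (mapL φ s) =
    PiTensorProduct.map (fun _ => (mapL φ).toLinearMap) (D.comul s) := by
  suffices H : (E.comul : E.L →+ ⨂[ℤ] _ : ZMod p, E.L).comp (mapL φ : D.L →+ E.L) =
      (PiTensorProduct.map (fun _ => (mapL φ).toLinearMap)).toAddMonoidHom.comp
        (D.comul : D.L →+ ⨂[ℤ] _ : ZMod p, D.L) from DFunLike.congr_fun H s
  refine addHom_ext fun b => ?_
  change E.comul (mapL φ (D.cls b)) =
    PiTensorProduct.map (fun _ => (mapL φ).toLinearMap) (D.comul (D.cls b))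
  rw [mapL_cls, comul_cls, comul_cls, map_mapL_diag, mapL_cls]

lemma ev_map (z : ⨂[ℤ] _ : ZMod p, D.L) :
    E.ev (PiTensorProduct.map (fun _ => (mapL φ).toLinearMap) z) =
      TwoTerm.tpowMap k p (Hom.fA φ).hom (D.ev z) := by
  induction z using PiTensorProduct.induction_on with
  | smul_tprod r f =>
    rw [map_zsmul, map_zsmul, map_zsmul, map_zsmul, PiTensorProduct.map_tprod, ev_tprod, ev_tprod,
      TwoTerm.tpowMap_tprod]
    congr 2
    exact funext fun i => toA_mapL φ (f i)
  | add x y hx hy => simp only [map_add, hx, hy]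

/-- Functoriality of the coinvariants. -/
def mapC : D.C →ₗ[k] E.C := TwoTerm.Hom.g ((TwoTerm.dagFunctor k p).map (Hom.fA φ))

lemma mapC_mk (x : TwoTerm.TPow k p D.A) : mapC φ (Submodule.Quotient.mk x) =
    Submodule.Quotient.mk (TwoTerm.tpowMap k p (Hom.fA φ).hom x) := rfl

lemma mapC_diagCoinv (a : D.A) :
    mapC φ (diagCoinv k p D.A a) = diagCoinv k p E.A ((Hom.fA φ).hom a) := by
  rw [diagCoinv_apply, mapC_mk, diagCoinv_apply]
  exact congrArg _ (TwoTerm.tpowMap_tprod k p (Hom.fA φ).hom _)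

lemma Splits.map {s : D.L} {x : D.C} (h : D.Splits s x) : E.Splits (mapL φ s) (mapC φ x) := by
  obtain ⟨z, a, hz, ha, rfl⟩ := h
  refine ⟨PiTensorProduct.map (fun _ => (mapL φ).toLinearMap) z, (Hom.fA φ).hom a, ?_, ?_, ?_⟩
  · rw [trL_map, hz, map_sub, comul_mapL, map_mapL_diag]
  · rw [Hom.inc_fA φ, ha, toB_mapL]
  · rw [map_sub, mapC_mk, ev_map, mapC_diagCoinv]

/-- Functoriality of the quotient `S` of the monoid ring. -/
def mapS : D.S →ₐ[k] E.S where
  __ : D.S →+* E.S := Ideal.Quotient.lift D.splitKer (E.toS.comp (mapL φ).toRingHom)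
    fun s ⟨hs, hs'⟩ => by
      refine toS_eq_zero_iff.2 ⟨?_, ?_⟩
      · exact (toA_mapL φ s).trans (by rw [hs, map_zero])
      · rw [← map_zero (mapC φ)]
        exact hs'.map φ
  commutes' c := by
    change E.toS (mapL φ (D.cls (D.teich c))) = E.toS (E.cls (E.teich c))
    rw [mapL_cls, Hom.fB_teich φ]

@[simp] lemma mapS_toS (s : D.L) : mapS φ (D.toS s) = E.toS (mapL φ s) := rfl

/-- Functoriality of the Frobenius twist. -/
def mapTw : D.Tw →ₐ[k] E.Tw := ((restrictAlg (frobInv p k)).map (Hom.fA φ)).hom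

lemma quo_mapS (x : D.S) : E.quo (mapS φ x) = mapTw φ (D.quo x) := by
  obtain ⟨s, rfl⟩ := D.toS_surjective x
  exact toA_mapL φ s

/-- Functoriality of the kernel `I`. -/
def mapI : D.I →ₗ[k] E.I where
  toFun i := ⟨mapS φ i, by
    have hi : D.quo i = 0 := i.2
    exact (quo_mapS φ i).trans (by rw [hi, map_zero])⟩
  map_add' i j := Subtype.ext (map_add (mapS φ) i.1 j.1)
  map_smul' c i := Subtype.ext (map_smul (mapS φ) c i.1)

lemma coe_mapI (i : D.I) : (mapI φ i : E.S) = mapS φ i := rfl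

lemma splitI_mapI (i : D.I) : E.splitI (mapI φ i) = mapC φ (D.splitI i) := by
  obtain ⟨s, hs⟩ := D.exists_toS_eq i
  have h : E.toA (mapL φ s) = 0 := by
    rw [toA_mapL, show D.toA s = 0 from s.2, map_zero]
  rw [D.splitI_eq s hs, E.splitI_eq ⟨mapL φ s, h⟩ (by rw [coe_mapI, ← hs, mapS_toS])]
  exact Splits.split_eq (s := ⟨mapL φ s, h⟩) ((D.splits_split s).map φ)

/-- Functoriality of the roof. -/
def roofMap : D.roof ⟶ E.roof where
  f := mapS φ
  g := (mapI φ).prodMap (mapTw φ).toLinearMap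
  g_lact r m := Prod.ext (Subtype.ext (map_mul (mapS φ) _ _))
    ((map_mul (mapTw φ) (D.quo r) m.2).trans (congrArg (· * mapTw φ m.2) (quo_mapS φ r).symm))
  g_ract m r := Prod.ext (Subtype.ext (map_mul (mapS φ) _ _))
    ((map_mul (mapTw φ) m.2 (D.quo r)).trans (congrArg (mapTw φ m.2 * ·) (quo_mapS φ r).symm))
  f_d _ := rfl

lemma mapL_id (s : D.L) : mapL (𝟙 D) s = s := by
  suffices H : (mapL (𝟙 D) : D.L →+ D.L) = AddMonoidHom.id _ from DFunLike.congr_fun H s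
  exact addHom_ext fun b => mapL_cls _ b

lemma mapL_comp (s : D.L) : mapL (φ ≫ ψ) s = mapL ψ (mapL φ s) := by
  suffices H : (mapL (φ ≫ ψ) : D.L →+ F.L) = (mapL ψ : E.L →+ F.L).comp (mapL φ : D.L →+ E.L)
    from DFunLike.congr_fun H s
  refine addHom_ext fun b => ?_
  change mapL (φ ≫ ψ) (D.cls b) = mapL ψ (mapL φ (D.cls b))
  rw [mapL_cls, mapL_cls, mapL_cls]
  rfl

lemma mapS_id (x : D.S) : mapS (𝟙 D) x = x := by
  obtain ⟨s, rfl⟩ := D.toS_surjective x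
  exact congrArg D.toS (mapL_id s)

lemma mapS_comp (x : D.S) : mapS (φ ≫ ψ) x = mapS ψ (mapS φ x) := by
  obtain ⟨s, rfl⟩ := D.toS_surjective x
  exact congrArg F.toS (mapL_comp φ ψ s)

variable (p k) in
/-- The roof, as a functor of the lifting data. -/
def roofFunctor : LiftData p k ⥤ TwoTerm k where
  obj D := D.roof
  map φ := roofMap φ
  map_id _ := TwoTerm.Hom.ext (AlgHom.ext fun x => mapS_id x)
    (LinearMap.ext fun m => Prod.ext (Subtype.ext (mapS_id m.1.1)) rfl)
  map_comp φ ψ := TwoTerm.Hom.ext (AlgHom.ext fun x => mapS_comp φ ψ x)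
    (LinearMap.ext fun m => Prod.ext (Subtype.ext (mapS_comp φ ψ m.1.1)) rfl)

variable (p k) in
/-- The projection to the square-zero extension is natural. -/
def roofToSquareZeroNat : roofFunctor p k ⟶
    algFunctor p k ⋙ restrictAlg (frobInv p k) ⋙ TwoTerm.squareZeroFunctor k where
  app D := D.roofToSquareZero
  naturality _ _ φ := TwoTerm.Hom.ext (AlgHom.ext fun x => quo_mapS φ x) rfl

lemma coe_inv_mapS (x : D.S) : (E.inv (mapS φ x) : TwoTerm.TPow k p E.A) =
    TwoTerm.tpowMap k p (Hom.fA φ).hom (D.inv x : TwoTerm.TPow k p D.A) := by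
  obtain ⟨s, rfl⟩ := D.toS_surjective x
  exact toInv_mapL φ s

variable (p k) in
/-- The map to `A†` is natural. -/
def roofToDagNat : roofFunctor p k ⟶ algFunctor p k ⋙ TwoTerm.dagFunctor k p where
  app D := D.roofToDag
  naturality _ _ φ := TwoTerm.Hom.ext (AlgHom.ext fun x => Subtype.ext (coe_inv_mapS φ x))
    (LinearMap.ext fun m => (congrArg₂ (· + ·) (splitI_mapI φ m.1)
      (mapC_diagCoinv φ m.2).symm).trans (map_add (mapC φ) _ _).symm)

end LiftData

/-! ### Homology of complexes of presheaves and sheafification -/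

namespace PresheafComplex

variable {Z : Type u} [SmallCategory Z] {k : Type u} [CommRing k]

lemma exists_of_exact {S : ShortComplex (Zᵒᵖ ⥤ ModuleCat.{u} k)} (hS : S.Exact) (U : Zᵒᵖ)
    (x : S.X₂.obj U) (hx : S.g.app U x = 0) : ∃ y, S.f.app U y = x :=
  (ShortComplex.moduleCat_exact_iff _).1 (hS.map ((evaluation _ _).obj U)) x hx

variable {ι : Type*} {c : ComplexShape ι} {K L : HomologicalComplex (Zᵒᵖ ⥤ ModuleCat.{u} k) c}

lemma exists_cycle (n j : ι) (hj : c.next n = j) (U : Zᵒᵖ) (x : (K.X n).obj U)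
    (hx : (K.d n j).app U x = 0) : ∃ y : (K.cycles n).obj U, (K.iCycles n).app U y = x :=
  exists_of_exact (S := ShortComplex.mk _ _ (K.iCycles_d n j))
    (ShortComplex.exact_of_f_is_kernel _ (K.cyclesIsKernel n j hj)) U x hx

lemma exists_boundary (i n : ι) (hi : c.prev n = i) (U : Zᵒᵖ) (x : (K.cycles n).obj U)
    (hx : (K.homologyπ n).app U x = 0) : ∃ y, (K.toCycles i n).app U y = x :=
  exists_of_exact (S := ShortComplex.mk _ _ (K.toCycles_comp_homologyπ i n))
    (ShortComplex.exact_of_g_is_cokernel _ (K.homologyIsCokernel i n hi)) U x hx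

lemma homologyπ_surjective (n : ι) (U : Zᵒᵖ) :
    Function.Surjective ((K.homologyπ n).app U) :=
  (ModuleCat.epi_iff_surjective _).1 inferInstance

lemma iCycles_injective (n : ι) (U : Zᵒᵖ) : Function.Injective ((K.iCycles n).app U) :=
  (ModuleCat.mono_iff_injective _).1 inferInstance

lemma comp_apply' {F G H : Zᵒᵖ ⥤ ModuleCat.{u} k} (f : F ⟶ G) (g : G ⟶ H) {h : F ⟶ H}
    (w : f ≫ g = h) (U : Zᵒᵖ) (x : F.obj U) : g.app U (f.app U x) = h.app U x := by
  rw [← w]; rfl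

variable (φ : K ⟶ L)

/-- Injectivity on homology is tested on sections: a cycle of `K` whose image is a boundary is a
boundary. -/
lemma homologyMap_injective (i n j : ι) (hi : c.prev n = i) (U : Zᵒᵖ)
    (h : ∀ x : (K.X n).obj U, (K.d n j).app U x = 0 →
      ∀ y : (L.X i).obj U, (φ.f n).app U x = (L.d i n).app U y →
        ∃ y' : (K.X i).obj U, x = (K.d i n).app U y') :
    Function.Injective ((HomologicalComplex.homologyMap φ n).app U) := by
  rw [injective_iff_map_eq_zero]
  intro x hx
  obtain ⟨z, rfl⟩ := homologyπ_surjective n U x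
  rw [comp_apply' _ _ (HomologicalComplex.homologyπ_naturality φ n) U z] at hx
  obtain ⟨y, hy⟩ := exists_boundary i n hi U ((HomologicalComplex.cyclesMap φ n).app U z)
    (by rw [comp_apply' _ _ rfl, hx])
  have h1 := congrArg ((L.iCycles n).app U) hy
  rw [comp_apply' _ _ (L.toCycles_i i n), comp_apply' _ _ (HomologicalComplex.cyclesMap_i φ n),
    ← comp_apply' (K.iCycles n) (φ.f n) rfl] at h1
  obtain ⟨y', hy'⟩ := h ((K.iCycles n).app U z)
    (by rw [comp_apply' _ _ (K.iCycles_d n j)]; rfl) y h1.symm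
  have h2 : z = (K.toCycles i n).app U y' := iCycles_injective n U (by
    rw [hy', comp_apply' _ _ (K.toCycles_i i n)])
  rw [h2, comp_apply' _ _ (K.toCycles_comp_homologyπ i n)]
  rfl

variable (J : GrothendieckTopology Z)

/-- Local surjectivity on homology is tested on sections: a cycle of `L` is locally the image of a
cycle of `K` up to a boundary. -/
lemma homologyMap_isLocallySurjective (i n j : ι) (hj : c.next n = j)
    (h : ∀ (U : Z) (x : (L.X n).obj (.op U)), (L.d n j).app _ x = 0 →
      ∃ S ∈ J U, ∀ ⦃V : Z⦄ (g : V ⟶ U), S g → ∃ x' : (K.X n).obj (.op V),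
        (K.d n j).app _ x' = 0 ∧ ∃ y : (L.X i).obj (.op V),
          (L.X n).map g.op x = (φ.f n).app _ x' + (L.d i n).app _ y) :
    Presheaf.IsLocallySurjective J (HomologicalComplex.homologyMap φ n) where
  imageSieve_mem {U} s := by
    obtain ⟨z, rfl⟩ := homologyπ_surjective n (.op U) s
    obtain ⟨S, hS, hS'⟩ := h U ((L.iCycles n).app _ z)
      (by rw [comp_apply' _ _ (L.iCycles_d n j)]; rfl)
    refine J.superset_covering (fun V g hg => ?_) hS
    obtain ⟨x', hx', y, hy⟩ := hS' g hg
    obtain ⟨z', rfl⟩ := exists_cycle n j hj _ x' hx'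
    refine ⟨(K.homologyπ n).app _ z', ?_⟩
    rw [comp_apply' _ _ (HomologicalComplex.homologyπ_naturality φ n),
      ← comp_apply' (HomologicalComplex.cyclesMap φ n) _ rfl]
    have h1 : (L.cycles n).map g.op z = (HomologicalComplex.cyclesMap φ n).app _ z' +
        (L.toCycles i n).app _ y := iCycles_injective n _ (by
      rw [map_add, comp_apply' _ _ (L.toCycles_i i n),
        comp_apply' _ _ (HomologicalComplex.cyclesMap_i φ n), ← comp_apply' _ _ rfl, ← hy]
      exact congrArg (fun f => f z) (congrArg ModuleCat.Hom.hom ((L.iCycles n).naturality g.op)))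
    have h2 : (L.homology n).map g.op ((L.homologyπ n).app _ z) =
        (L.homologyπ n).app _ ((L.cycles n).map g.op z) :=
      (congrArg (fun f => f z) (congrArg ModuleCat.Hom.hom ((L.homologyπ n).naturality g.op))).symm
    rw [h2, h1, map_add, comp_apply' (L.toCycles i n) _ (L.toCycles_comp_homologyπ i n)]
    exact (add_zero _).symm

/-- A map of complexes of presheaves that becomes an isomorphism on sheafified homology becomes a
quasi-isomorphism, as sheafification is exact. -/
lemma quasiIso_sheafify
    (h : ∀ n, J.W (HomologicalComplex.homologyMap φ n)) :
    QuasiIso (((presheafToSheaf J (ModuleCat.{u} k)).mapHomologicalComplex c).map φ) where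
  quasiIsoAt n := by
    rw [quasiIsoAt_iff, ShortComplex.quasiIso_iff]
    have h1 := ShortComplex.mapHomologyIso_hom_naturality
      ((HomologicalComplex.shortComplexFunctor _ c n).map φ) (presheafToSheaf J (ModuleCat.{u} k))
    have h2 : IsIso ((presheafToSheaf J (ModuleCat.{u} k)).map
        (HomologicalComplex.homologyMap φ n)) := (J.W_iff _).1 (h n)
    have h3 := IsIso.comp_isIso' (Iso.isIso_hom ((K.sc n).mapHomologyIso
      (presheafToSheaf J (ModuleCat.{u} k)))) h2
    have h4 := Iso.isIso_hom ((L.sc n).mapHomologyIso (presheafToSheaf J (ModuleCat.{u} k)))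
    exact @IsIso.of_isIso_comp_right _ _ _ _ _ _ _ h4 (h1 ▸ h3)

end PresheafComplex

/-! ### Functoriality and homology algebras of DG algebras -/

namespace DGAlg

section MapHom

variable {C : Type u} [Category.{v} C] [Preadditive C] [MonoidalCategory C]
  {D : Type w} [Category.{v} D] [Preadditive D] [MonoidalCategory D]

open Functor.LaxMonoidal

/-- Functoriality of the image of a DG algebra under an additive lax monoidal functor. -/
def mapHom (F : C ⥤ D) [F.Additive] [F.LaxMonoidal] {X Y : DGAlg C} (φ : X ⟶ Y) :
    X.map F ⟶ Y.map F where
  f := (F.mapHomologicalComplex _).map (Hom.f φ)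
  one_f := by
    change (ε F ≫ F.map X.one) ≫ F.map ((Hom.f φ).f 0) = ε F ≫ F.map Y.one
    rw [Category.assoc, ← F.map_comp, Hom.one_f φ]
  mul_f i j n h := by
    change (μ F _ _ ≫ F.map (X.mul i j n h)) ≫ F.map ((Hom.f φ).f n) =
      (F.map ((Hom.f φ).f i) ⊗ₘ F.map ((Hom.f φ).f j)) ≫ μ F _ _ ≫ F.map (Y.mul i j n h)
    rw [Category.assoc, ← F.map_comp, Hom.mul_f φ, F.map_comp, μ_natural_assoc]

end MapHom

section Presheaf

variable {C : Type u} [Category.{v} C] [Preadditive C] [MonoidalCategory C]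
  {I : Type w} [Category.{v} I]

/-- A natural transformation between presheaves of DG algebras, as a morphism of DG algebras in
presheaves. -/
def ofFunctorHom {P Q : I ⥤ DGAlg C} (τ : P ⟶ Q) : ofFunctor P ⟶ ofFunctor Q where
  f :=
    { f := fun n =>
        { app := fun U => (Hom.f (τ.app U)).f n
          naturality := fun _ _ g =>
            congrArg (fun φ => HomologicalComplex.Hom.f (Hom.f φ) n) (τ.naturality g) }
      comm' := fun i j _ => NatTrans.ext (funext fun U => (Hom.f (τ.app U)).comm i j) }
  one_f := NatTrans.ext (funext fun U => Hom.one_f (τ.app U))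
  mul_f i j n h := NatTrans.ext (funext fun U => Hom.mul_f (τ.app U) i j n h)

end Presheaf

section Homology

variable {C : Type u} [Category.{v} C] [Preadditive C] [MonoidalCategory C]
  [CategoryWithHomology C]

/-- If the cycles of `X` form a DG algebra `Y` with a morphism to a DG algebra `H` with zero
differential that is the projection to the homology objects, then `H` is the homology algebra
of `X`. -/
lemma isHomologyOf_of_cycles {X Y H : DGAlg C} (hH : ∀ i j, H.K.d i j = 0) (i : Y ⟶ X) (π : Y ⟶ H)
    (y : ∀ n, Y.K.X n ≅ X.K.cycles n) (e : ∀ n, H.K.X n ≅ X.K.homology n)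
    (hy : ∀ n, (y n).hom ≫ X.K.iCycles n = (Hom.f i).f n)
    (he : ∀ n, (Hom.f π).f n ≫ (e n).hom = (y n).hom ≫ X.K.homologyπ n) : H.IsHomologyOf X := by
  have hy' : ∀ n, (y n).inv ≫ (Hom.f i).f n = X.K.iCycles n := fun n => by
    rw [← hy, Iso.inv_hom_id_assoc]
  have he' : ∀ n, X.K.homologyπ n ≫ (e n).inv = (y n).inv ≫ (Hom.f π).f n := fun n => by
    rw [Iso.comp_inv_eq, Category.assoc, he, Iso.inv_hom_id_assoc]
  refine ⟨hH, e, ⟨Y.one ≫ (y 0).hom, ?_, ?_⟩, fun a b n h =>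
    ⟨((y a).inv ⊗ₘ (y b).inv) ≫ Y.mul a b n h ≫ (y n).hom, ?_, ?_⟩⟩
  · rw [Category.assoc, hy, Hom.one_f i]
  · rw [Category.assoc, ← he, ← Category.assoc, Hom.one_f π]
  · rw [Category.assoc, Category.assoc, hy, Hom.mul_f i, tensorHom_comp_tensorHom_assoc, hy', hy']
  · rw [Category.assoc, Category.assoc, ← he, ← Category.assoc (Y.mul a b n h), Hom.mul_f π, he',
      he', Category.assoc, tensorHom_comp_tensorHom_assoc]

end Homology

end DGAlg

namespace PresheafComplex

variable {Z : Type u} [SmallCategory Z] {k : Type u} [CommRing k]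

lemma exact_of_forall (S : ShortComplex (Zᵒᵖ ⥤ ModuleCat.{u} k))
    (h : ∀ U (x : S.X₂.obj U), S.g.app U x = 0 → ∃ y, S.f.app U y = x) : S.Exact := by
  rw [ShortComplex.exact_iff_isZero_homology]
  refine Functor.isZero _ fun U => ?_
  refine IsZero.of_iso ?_ (S.mapHomologyIso ((evaluation _ _).obj U)).symm
  rw [← ShortComplex.exact_iff_isZero_homology]
  exact (ShortComplex.moduleCat_exact_iff _).2 fun x hx => h U x hx

/-- Left homology data of a short complex of presheaves, from conditions on sections. -/
def leftHomologyData (S : ShortComplex (Zᵒᵖ ⥤ ModuleCat.{u} k)) {K H : Zᵒᵖ ⥤ ModuleCat.{u} k}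
    (i : K ⟶ S.X₂) (π : K ⟶ H) (wi : i ≫ S.g = 0)
    (hi : ∀ U, Function.Injective (i.app U))
    (hiS : ∀ U (x : S.X₂.obj U), S.g.app U x = 0 → ∃ y, i.app U y = x)
    (hπ : ∀ U, Function.Surjective (π.app U))
    (hπS : ∀ U (y : K.obj U), π.app U y = 0 ↔ ∃ x, S.f.app U x = i.app U y) :
    S.LeftHomologyData :=
  have : Mono i := (NatTrans.mono_iff_mono_app i).2 fun U =>
    (ModuleCat.mono_iff_injective _).2 (hi U)
  have : Epi π := (NatTrans.epi_iff_epi_app π).2 fun U =>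
    (ModuleCat.epi_iff_surjective _).2 (hπ U)
  have : Mono (ShortComplex.mk i S.g wi).f := ‹Mono i›
  let hK := (exact_of_forall (ShortComplex.mk i S.g wi) hiS).fIsKernel
  let f' : S.X₁ ⟶ K := hK.lift (KernelFork.ofι _ S.zero)
  have hf' : f' ≫ i = S.f := Fork.IsLimit.lift_ι hK
  have wπ : f' ≫ π = 0 := by
    ext U x
    exact (hπS U (f'.app U x)).2 ⟨x, (comp_apply' f' i hf' U x).symm⟩
  have : Epi (ShortComplex.mk f' π wπ).g := ‹Epi π›
  { K, H, i, π, wi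
    hi := hK
    wπ := wπ
    hπ := (exact_of_forall (ShortComplex.mk f' π wπ) fun U y hy => by
      obtain ⟨x, hx⟩ := (hπS U y).1 hy
      exact ⟨x, hi U (by rw [comp_apply' f' i hf', hx])⟩).gIsCokernel }

end PresheafComplex

/-! ### Sheaves of two-term DG algebras -/

namespace TwoTerm

variable {Z : Type u} [SmallCategory Z] {k : Type u} [CommRing k] (J : GrothendieckTopology Z)

/-- The morphism of sheaves of DG algebras associated to a morphism of presheaves of two-term DG
algebras. -/
def sheafDGHom {P Q : Zᵒᵖ ⥤ TwoTerm k} (τ : P ⟶ Q) : sheafDG J P ⟶ sheafDG J Q :=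
  DGAlg.mapHom _ (DGAlg.ofFunctorHom (Functor.whiskerRight τ (toDGFunctor k)))

/-- A morphism of presheaves of two-term DG algebras that is locally bijective on homology induces
a quasi-isomorphism of the associated sheaves of DG algebras. -/
lemma quasiIso_sheafDGHom {P Q : Zᵒᵖ ⥤ TwoTerm k} (τ : P ⟶ Q)
    (h₁ : ∀ U (m : (P.obj U).M), (P.obj U).d m = 0 → (Hom.g (τ.app U)) m = 0 → m = 0)
    (h₂ : ∀ U (m : (Q.obj U).M), (Q.obj U).d m = 0 →
      ∃ m', (P.obj U).d m' = 0 ∧ m = Hom.g (τ.app U) m')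
    (h₃ : ∀ U (r : (P.obj U).R) (m : (Q.obj U).M), Hom.f (τ.app U) r = (Q.obj U).d m →
      ∃ m', r = (P.obj U).d m')
    (h₄ : ∀ (U : Z) (r : (Q.obj (.op U)).R), ∃ S ∈ J U, ∀ ⦃V : Z⦄ (g : V ⟶ U), S g →
      ∃ (r' : (P.obj (.op V)).R) (m : (Q.obj (.op V)).M),
        Hom.f (Q.map g.op) r = Hom.f (τ.app (.op V)) r' + (Q.obj (.op V)).d m) :
    QuasiIso (DGAlg.Hom.f (sheafDGHom J τ)) := by
  refine PresheafComplex.quasiIso_sheafify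
    (DGAlg.Hom.f (DGAlg.ofFunctorHom (Functor.whiskerRight τ (toDGFunctor k)))) J fun n => ?_
  have inj : ∀ U, Function.Injective ((HomologicalComplex.homologyMap (DGAlg.Hom.f
      (DGAlg.ofFunctorHom (Functor.whiskerRight τ (toDGFunctor k)))) n).app U) := by
    intro U
    rcases (P.obj U).X_cases n with rfl | rfl | hn
    · refine PresheafComplex.homologyMap_injective _ 1 0 (-1) (ChainComplex.prev ℤ 0) U ?_
      intro x _ y hy
      exact h₃ U x y hy
    · refine PresheafComplex.homologyMap_injective _ 2 1 0 (ChainComplex.prev ℤ 1) U ?_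
      intro x hx y hy
      exact ⟨0, (h₁ U x hx (hy.trans (map_zero _))).trans (map_zero _).symm⟩
    · refine PresheafComplex.homologyMap_injective _ (n + 1) n (n - 1) (ChainComplex.prev ℤ n) U ?_
      intro x hx y hy
      exact ⟨0, (Subsingleton.elim (h := hn) _ _)⟩
  have := Presheaf.isLocallyInjective_of_injective J _ inj
  have : Presheaf.IsLocallySurjective J (HomologicalComplex.homologyMap (DGAlg.Hom.f
      (DGAlg.ofFunctorHom (Functor.whiskerRight τ (toDGFunctor k)))) n) := by
    by_cases h0 : n = 0
    · subst h0
      refine PresheafComplex.homologyMap_isLocallySurjective _ J 1 0 (0 - 1)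
        (ChainComplex.next ℤ 0) fun U x _ => ?_
      obtain ⟨S, hS, hS'⟩ := h₄ U x
      refine ⟨S, hS, fun V g hg => ?_⟩
      obtain ⟨r, m, hrm⟩ := hS' g hg
      exact ⟨r, rfl, m, hrm⟩
    by_cases h1 : n = 1
    · subst h1
      refine PresheafComplex.homologyMap_isLocallySurjective _ J 2 1 0
        (ChainComplex.next ℤ 1) fun U x hx => ?_
      obtain ⟨m, hm, rfl⟩ := h₂ (.op U) x hx
      refine ⟨⊤, J.top_mem U, fun V g _ => ⟨Hom.g (P.map g.op) m, ?_, 0, ?_⟩⟩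
      · refine ((Hom.f_d (P.map g.op) m).symm.trans ?_)
        rw [hm, map_zero]
        rfl
      · refine Eq.trans ?_ (add_zero _).symm
        exact (congrArg (fun φ => Hom.g φ m) (τ.naturality g.op)).symm
    · refine PresheafComplex.homologyMap_isLocallySurjective _ J (n + 1) n (n - 1)
        (ChainComplex.next ℤ n) fun U x _ => ⟨⊤, J.top_mem U, fun V g _ => ⟨0, map_zero _, 0, ?_⟩⟩
      have : Subsingleton ((Q.obj (.op V)).X n) := by
        have := (Q.obj (.op V)).X_cases n
        tauto
      exact Subsingleton.elim (h := this) _ _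
  exact J.W_of_isLocallyBijective _

end TwoTerm

namespace PresheafComplex

variable {Z : Type u} [SmallCategory Z] {k : Type u} [CommRing k] {ι : Type*} {c : ComplexShape ι}
  (K : HomologicalComplex (Zᵒᵖ ⥤ ModuleCat.{u} k) c)

/-- Left homology data of a complex of presheaves in a given degree, from conditions on
sections. -/
def leftHomologyDataSc (l n j : ι) (hl : c.prev n = l) (hj : c.next n = j)
    {Y H : Zᵒᵖ ⥤ ModuleCat.{u} k} (i : Y ⟶ K.X n) (π : Y ⟶ H)
    (wi : ∀ U (y : Y.obj U), (K.d n j).app U (i.app U y) = 0)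
    (hi : ∀ U, Function.Injective (i.app U))
    (hiS : ∀ U (x : (K.X n).obj U), (K.d n j).app U x = 0 → ∃ y, i.app U y = x)
    (hπ : ∀ U, Function.Surjective (π.app U))
    (hπS : ∀ U (y : Y.obj U), π.app U y = 0 ↔ ∃ x, (K.d l n).app U x = i.app U y) :
    (K.sc n).LeftHomologyData :=
  leftHomologyData (K.sc n) i π
    (by subst hj; exact NatTrans.ext (funext fun U => ModuleCat.hom_ext (LinearMap.ext (wi U))))
    hi (by subst hj; exact hiS) hπ (by subst hl; exact hπS)

end PresheafComplex

namespace TwoTerm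

variable {Z : Type u} [SmallCategory Z] {k : Type u} [CommRing k] (J : GrothendieckTopology Z)

/-- `i : Y ⟶ P` is sectionwise the inclusion of the algebra of cycles of `P`, and `π : Y ⟶ H` is
sectionwise the projection of the cycles to the homology. -/
structure IsHomologyPair {P Y H : Zᵒᵖ ⥤ TwoTerm k} (i : Y ⟶ P) (π : Y ⟶ H) : Prop where
  bijective_f (U) : Function.Bijective (Hom.f (i.app U))
  injective_g (U) : Function.Injective (Hom.g (i.app U))
  d_eq_zero_iff (U) (m : (P.obj U).M) : (P.obj U).d m = 0 ↔ ∃ m', Hom.g (i.app U) m' = m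
  surjective_f (U) : Function.Surjective (Hom.f (π.app U))
  f_eq_zero_iff (U) (r : (Y.obj U).R) : Hom.f (π.app U) r = 0 ↔
    ∃ m, (P.obj U).d m = Hom.f (i.app U) r
  bijective_g (U) : Function.Bijective (Hom.g (π.app U))

variable {P Y H : Zᵒᵖ ⥤ TwoTerm k} {i : Y ⟶ P} {π : Y ⟶ H}

/-- Left homology data of the complex of a presheaf of two-term DG algebras. -/
def leftHomologyData (h : IsHomologyPair i π) (n : ℤ) :
    ((DGAlg.ofFunctor (P ⋙ toDGFunctor k)).K.sc n).LeftHomologyData :=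
  PresheafComplex.leftHomologyDataSc _ (n + 1) n (n - 1) (ChainComplex.prev ℤ n)
    (ChainComplex.next ℤ n)
    ((DGAlg.Hom.f (DGAlg.ofFunctorHom (Functor.whiskerRight i (toDGFunctor k)))).f n)
    ((DGAlg.Hom.f (DGAlg.ofFunctorHom (Functor.whiskerRight π (toDGFunctor k)))).f n)
    (fun U y => by
      rcases (P.obj U).X_cases n with rfl | rfl | hn
      · rfl
      · exact (h.d_eq_zero_iff U _).2 ⟨y, rfl⟩
      · exact (congrArg _ (Subsingleton.elim (h := hn) _ 0)).trans (map_zero _))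
    (fun U => by
      rcases (Y.obj U).X_cases n with rfl | rfl | hn
      · exact (h.bijective_f U).1
      · exact h.injective_g U
      · exact fun x y _ => Subsingleton.elim (h := hn) _ _)
    (fun U x hx => by
      rcases (P.obj U).X_cases n with rfl | rfl | hn
      · exact (h.bijective_f U).2 x
      · exact (h.d_eq_zero_iff U x).1 hx
      · exact ⟨0, Subsingleton.elim (h := hn) _ _⟩)
    (fun U => by
      rcases (H.obj U).X_cases n with rfl | rfl | hn
      · exact h.surjective_f U
      · exact (h.bijective_g U).2
      · exact fun x => ⟨0, Subsingleton.elim (h := hn) _ _⟩)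
    (fun U y => by
      rcases (Y.obj U).X_cases n with rfl | rfl | hn
      · exact h.f_eq_zero_iff U y
      · refine ⟨fun hy => ⟨0, ?_⟩, fun ⟨_, hy⟩ => ?_⟩
        · rw [show y = 0 from (h.bijective_g U).1 (Eq.trans hy (map_zero (Hom.g (π.app U))).symm)]
          exact (map_zero (Hom.g (i.app U))).symm
        · rw [show y = 0 from h.injective_g U (Eq.trans hy.symm (map_zero (Hom.g (i.app U))).symm)]
          exact map_zero (Hom.g (π.app U))
      · rw [show y = 0 from Subsingleton.elim (h := hn) _ _]
        exact ⟨fun _ => ⟨0, (map_zero _).trans (map_zero _).symm⟩, fun _ => map_zero _⟩)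

/-- If `Y` is sectionwise the algebra of cycles of `P` and `H` is sectionwise its homology algebra,
then the DG algebra in sheaves associated to `H` is the homology algebra of the one associated
to `P`. -/
lemma isHomologyOf_sheafDG (h : IsHomologyPair i π)
    (hH : ∀ U (m : (H.obj U).M), (H.obj U).d m = 0) :
    (sheafDG J H).IsHomologyOf (sheafDG J P) := by
  let F := presheafToSheaf J (ModuleCat.{u} k)
  let e : ∀ n, ((sheafDG J P).K.sc n).LeftHomologyData := fun n => (leftHomologyData h n).map F
  refine DGAlg.isHomologyOf_of_cycles (fun a b => ?_) (sheafDGHom J i) (sheafDGHom J π)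
    (fun n => (e n).cyclesIso.symm) (fun n => (e n).homologyIso.symm)
    (fun n => (e n).cyclesIso_inv_comp_iCycles) (fun n => (e n).π_comp_homologyIso_inv)
  refine Eq.trans (congrArg (fun φ => F.map φ) (NatTrans.ext (funext fun U => ?_)))
    (F.map_zero _ _)
  by_cases hab : a = 1 ∧ b = 0
  · obtain ⟨rfl, rfl⟩ := hab
    exact ModuleCat.hom_ext (LinearMap.ext (hH U))
  · exact (H.obj U).diff_eq_zero (by lia)

end TwoTerm

section Dagger

variable {Z : Type u} [SmallCategory Z] {J : GrothendieckTopology Z} {k : Type u} [Field k] {p : ℕ}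
  [Fact p.Prime] [CharP k p] [PerfectField k]

open CyclicTensor

/-- The homology algebra of `A†` is the square-zero extension of the Frobenius twist of `A`. -/
lemma isHomologyOf_dagger (A : Sheaf J (AlgCat.{u} k)) :
    (squareZero (frobTwist p A)).IsHomologyOf (dagger p A) := by
  refine TwoTerm.isHomologyOf_sheafDG (Y := A.obj ⋙ cyclesFunctor k p) J
    (i := Functor.whiskerLeft A.obj (cyclesToDagNat k p))
    (π := Functor.whiskerLeft A.obj (cyclesToSquareZeroNat k p)) ?_ fun _ _ => rfl
  exact
    { bijective_f := fun U => Function.bijective_id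
      injective_g := fun U => diagCoinv_injective k p (A.obj.obj U)
      d_eq_zero_iff := fun U m => trace_eq_zero_iff
      surjective_f := fun U a => ⟨_, projRing_diagInv p (A.obj.obj U) a⟩
      f_eq_zero_iff := fun U r => projRing_eq_zero_iff
      bijective_g := fun U => Function.bijective_id }

end Dagger

/-! ### The zigzag for a presheaf of lifting data -/

namespace LiftData

open CyclicTensor

variable {p : ℕ} [Fact p.Prime] {k : Type u} [Field k] [CharP k p] [PerfectField k]

section

variable (D : LiftData p k)

lemma eq_zero_of_roofToDag_eq_zero {m : D.roof.M} (hd : D.roof.d m = 0)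
    (hm : TwoTerm.Hom.g D.roofToDag m = 0) : m = 0 := by
  obtain ⟨i, a⟩ := m
  change D.A at a
  obtain rfl : i = 0 := Subtype.ext hd
  have h : D.splitI 0 + diagCoinv k p D.A a = 0 := hm
  rw [map_zero, zero_add] at h
  rw [diagCoinv_injective k p D.A (h.trans (map_zero _).symm)]
  rfl

end

variable {Z : Type u} [SmallCategory Z] (J : GrothendieckTopology Z) (Φ : Zᵒᵖ ⥤ LiftData p k)

/-- The reduction maps are locally surjective. -/
def IsLocallySurjective : Prop :=
  ∀ (U : Z) (a : (Φ.obj (.op U)).A), ∃ S ∈ J U, ∀ ⦃V : Z⦄ (g : V ⟶ U), S g →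
    ∃ b, (Φ.obj (.op V)).red b = (Hom.fA (Φ.map g.op)).hom a

variable {J Φ}

/-- On sections, the projection is bijective on homology in degree `1` and injective in degree `0`;
in degree `0` it is locally surjective with the reduction. -/
lemma quasiIso_roofToSquareZero (h : IsLocallySurjective J Φ) :
    QuasiIso (DGAlg.Hom.f
      (TwoTerm.sheafDGHom J (Functor.whiskerLeft Φ (roofToSquareZeroNat p k)))) := by
  refine TwoTerm.quasiIso_sheafDGHom J _ (fun U m hd hm => Prod.ext (Subtype.ext hd) hm)
    (fun U a _ => ⟨((0, a) : (Φ.obj U).I × (Φ.obj U).Tw), rfl, rfl⟩)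
    (fun U s m hs => ⟨((⟨s, hs⟩, 0) : (Φ.obj U).I × (Φ.obj U).Tw), rfl⟩)
    (fun U a => ?_)
  obtain ⟨S, hS, hS'⟩ := h U a
  refine ⟨S, hS, fun V g hg => ?_⟩
  obtain ⟨b, hb⟩ := hS' g hg
  refine ⟨(Φ.obj (.op V)).toS ((Φ.obj (.op V)).cls b), 0, ?_⟩
  refine hb.symm.trans (((Φ.obj (.op V)).toA_cls b).symm.trans ?_)
  exact ((congrArg _ (map_zero _)).trans (add_zero _)).symm

/-- The homology of `A†` is the Frobenius twist of `A` in both degrees, and on the roof the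
identification is the one given by the projection to the square-zero extension. -/
lemma quasiIso_roofToDag (h : IsLocallySurjective J Φ) :
    QuasiIso (DGAlg.Hom.f
      (TwoTerm.sheafDGHom J (Functor.whiskerLeft Φ (roofToDagNat p k)))) := by
  refine TwoTerm.quasiIso_sheafDGHom J _
    (fun U m hd hm => (Φ.obj U).eq_zero_of_roofToDag_eq_zero hd hm) (fun U m hm => ?_)
    (fun U s m hs => ?_) (fun U x => ?_)
  · obtain ⟨a, rfl⟩ := trace_eq_zero_iff.1 hm
    refine ⟨((0, a) : (Φ.obj U).I × (Φ.obj U).Tw), rfl, ?_⟩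
    exact (zero_add _).symm.trans
      (congrArg (· + diagCoinv k p (Φ.obj U).A a) (map_zero (Φ.obj U).splitI).symm)
  · have hs' : (Φ.obj U).quo s = 0 :=
      ((Φ.obj U).projRing_inv s).symm.trans (projRing_eq_zero_iff.2 ⟨m, hs.symm⟩)
    exact ⟨((⟨s, hs'⟩, 0) : (Φ.obj U).I × (Φ.obj U).Tw), rfl⟩
  · change TwoTerm.Inv (TwoTerm.cyc k p (Φ.obj (.op U)).A) at x
    obtain ⟨S, hS, hS'⟩ := h U (projRing p (Φ.obj (.op U)).A x)
    refine ⟨S, hS, fun V g hg => ?_⟩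
    obtain ⟨b, hb⟩ := hS' g hg
    have h1 : projRing p (Φ.obj (.op V)).A (mapInv p (Hom.fA (Φ.map g.op)) x -
        (Φ.obj (.op V)).toInv ((Φ.obj (.op V)).cls b)) = 0 := by
      rw [map_sub, projRing_naturality, projRing_toInv, toA_cls, hb, sub_self]
    obtain ⟨m, hm⟩ := projRing_eq_zero_iff.1 h1
    exact ⟨(Φ.obj (.op V)).toS ((Φ.obj (.op V)).cls b), m, sub_eq_iff_eq_add'.1 hm.symm⟩

end LiftData

section

open LiftData CyclicTensor

variable {Z : Type u} [SmallCategory Z] {J : GrothendieckTopology Z} {k : Type u} [Field k] {p : ℕ}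
  [Fact p.Prime] [CharP k p] [PerfectField k]

/-- If `A` is locally the reduction of lifting data, then `A†` is quasi-isomorphic to the
square-zero extension of the Frobenius twist of `A`. -/
lemma quasiIsomorphic_dagger_squareZero {A : Sheaf J (AlgCat.{u} k)} (Φ : Zᵒᵖ ⥤ LiftData p k)
    (h : IsLocallySurjective J Φ) (hA : Φ ⋙ algFunctor p k = A.obj) :
    (dagger p A).QuasiIsomorphic (squareZero (frobTwist p A)) := by
  obtain ⟨A, hA'⟩ := A
  obtain rfl := hA
  exact .trans _ _ _ (.symm _ _ (.rel _ _ ⟨_, quasiIso_roofToDag h⟩))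
    (.rel _ _ ⟨_, quasiIso_roofToSquareZero h⟩)

end

/-! ### Witt vectors of length two -/

namespace WittTwo

variable {p : ℕ} [Fact p.Prime] {k : Type u} [CommRing k]

lemma wittRed_truncate (x : WittVector p k) :
    wittRed p k (WittVector.truncate 2 x) = x.coeff 0 := WittVector.coeff_truncate x 0

variable (p k) in
/-- The Teichmüller map `k → W₂(k)`. -/
def teich : k →* TruncatedWittVector p 2 k :=
  (WittVector.truncate (p := p) (R := k) 2).toMonoidHom.comp (WittVector.teichmuller p)

lemma wittRed_teich (c : k) : wittRed p k (teich p k c) = c :=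
  (wittRed_truncate _).trans (WittVector.teichmuller_coeff_zero p c)

section CharP

variable [CharP k p]

lemma p_mul_p : (p : TruncatedWittVector p 2 k) * (p : TruncatedWittVector p 2 k) = 0 := by
  have h : WittVector.truncate 2 ((p : WittVector p k) * (p : WittVector p k)) =
      (p : TruncatedWittVector p 2 k) * (p : TruncatedWittVector p 2 k) := by simp
  rw [← h]
  refine TruncatedWittVector.ext fun i => ?_
  rw [WittVector.coeff_truncate, TruncatedWittVector.coeff_zero]
  fin_cases i
  · exact WittVector.mul_charP_coeff_zero _
  · exact (WittVector.mul_charP_coeff_succ _ 0).trans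
      (by rw [WittVector.coeff_p_zero, zero_pow (Fact.out : p.Prime).ne_zero])

lemma wittRed_eq_zero_of_p_mul [IsReduced k] {x : TruncatedWittVector p 2 k} (h : p * x = 0) :
    wittRed p k x = 0 := by
  obtain ⟨x, rfl⟩ := WittVector.truncate_surjective p 2 k x
  rw [wittRed_truncate]
  rw [mul_comm, ← map_natCast (WittVector.truncate (p := p) (R := k) 2), ← map_mul] at h
  have h1 := congrArg (TruncatedWittVector.coeff 1) h
  rw [WittVector.coeff_truncate, TruncatedWittVector.coeff_zero] at h1
  exact eq_zero_of_pow_eq_zero ((WittVector.mul_charP_coeff_succ x 0).symm.trans h1)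

lemma dvd_of_wittRed_eq_zero [PerfectRing k p] {x : TruncatedWittVector p 2 k}
    (h : wittRed p k x = 0) : (p : TruncatedWittVector p 2 k) ∣ x := by
  obtain ⟨x, rfl⟩ := WittVector.truncate_surjective p 2 k x
  rw [wittRed_truncate] at h
  refine ⟨teich p k ((frobeniusEquiv k p).symm (x.coeff 1)), ?_⟩
  rw [mul_comm, ← map_natCast (WittVector.truncate (p := p) (R := k) 2), teich,
    MonoidHom.comp_apply]
  refine Eq.trans ?_ (map_mul (WittVector.truncate (p := p) (R := k) 2) _ _)
  refine TruncatedWittVector.ext fun i => ?_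
  rw [WittVector.coeff_truncate, WittVector.coeff_truncate]
  fin_cases i
  · exact h.trans (WittVector.mul_charP_coeff_zero _).symm
  · refine Eq.trans ?_ (WittVector.mul_charP_coeff_succ _ 0).symm
    rw [WittVector.teichmuller_coeff_zero]
    exact (frobeniusEquiv_symm_pow_p k p _).symm

/-- The failure of additivity of the Teichmüller map on `p`-th powers. -/
lemma teich_add [PerfectRing k p] (c d : k) :
    teich p k (c ^ p + d ^ p) = teich p k (c ^ p) + teich p k (d ^ p) +
      p • ∑ w ∈ CyclicWord.binaryReps p, teich p k (∏ i, bif w i then c else d) := by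
  have h : (p : TruncatedWittVector p 2 k) ∣ teich p k (c + d) - (teich p k c + teich p k d) :=
    dvd_of_wittRed_eq_zero (by simp [wittRed_teich])
  have h1 := dvd_sub_pow_of_dvd_sub h 1
  rw [pow_one, one_add_one_eq_two, pow_two, p_mul_p, zero_dvd_iff, sub_eq_zero,
    CyclicWord.add_pow_eq] at h1
  rw [← add_pow_char, map_pow, h1, map_pow, map_pow, nsmul_eq_mul]
  congr 3
  funext w
  rw [map_prod]
  refine Finset.prod_congr rfl fun i _ => ?_
  cases w i <;> rfl

end CharP

end WittTwo

/-! ### Flat sheaves of modules and their quotients -/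

section Flat

variable {Z : Type u} [SmallCategory Z] {J : GrothendieckTopology Z} {R : Type u} [CommRing R]
  {M : Sheaf J (ModuleCat.{u} R)}

open Functor.LaxMonoidal Functor.Monoidal

/-- Tensoring sections of a flat sheaf with an injective map gives a locally injective map. -/
lemma IsFlat.isLocallyInjective_whiskerLeft (hM : IsFlat M) {C D : Zᵒᵖ ⥤ ModuleCat.{u} R}
    (f : C ⟶ D) (hf : ∀ U, Function.Injective (f.app U)) :
    Presheaf.IsLocallyInjective J (M.obj ◁ f) := by
  let F := presheafToSheaf J (ModuleCat.{u} R)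
  rw [← Presheaf.isLocallyInjective_presheafToSheaf_map_iff, Sheaf.isLocallyInjective_iff_injective]
  have : Mono f := (NatTrans.mono_iff_mono_app f).2 fun U =>
    (ModuleCat.mono_iff_injective _).2 (hf U)
  have h1 : Mono (M ◁ F.map f) := hM (F.map f) inferInstance
  let e : F.obj M.obj ≅ M :=
    asIso ((sheafificationAdjunction J (ModuleCat.{u} R)).counit.app M)
  have h2 : F.obj M.obj ◁ F.map f = (e.hom ▷ F.obj C) ≫ (M ◁ F.map f) ≫ (e.inv ▷ F.obj D) := by
    rw [← whisker_exchange_assoc, ← comp_whiskerRight, e.hom_inv_id, id_whiskerRight,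
      Category.comp_id]
  have h3 : Mono (F.obj M.obj ◁ F.map f) := by
    rw [h2]
    infer_instance
  have h4 : F.map (M.obj ◁ f) =
      (μIso F M.obj C).inv ≫ (F.obj M.obj ◁ F.map f) ≫ (μIso F M.obj D).hom := by
    rw [Iso.eq_inv_comp]
    exact (μ_natural_right F M.obj f).symm
  have h5 : Mono (F.map (M.obj ◁ f)) := by
    rw [h4]
    infer_instance
  have h6 : Mono (F.map (M.obj ◁ f)).hom := inferInstance
  exact fun U => (ModuleCat.mono_iff_injective _).1 ((NatTrans.mono_iff_mono_app _).1 h6 U)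

/-- A section of a flat sheaf of modules annihilated by a scalar `c` lies locally in the submodule
generated by the annihilator of `c`. -/
lemma IsFlat.exists_mem_smul_top (hM : IsFlat M) (c : R) (U : Z) (x : M.obj.obj (.op U))
    (hx : c • x = 0) : ∃ S ∈ J U, ∀ ⦃V : Z⦄ (g : V ⟶ U), S g →
      M.obj.map g.op x ∈
        (LinearMap.ker (LinearMap.mulLeft R c) • ⊤ : Submodule R (M.obj.obj (.op V))) := by
  let I : Ideal R := LinearMap.ker (LinearMap.mulLeft R c)
  let φ : (R ⧸ I) →ₗ[R] R := Submodule.liftQ I (LinearMap.mulLeft R c) le_rfl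
  have hφ : Function.Injective φ :=
    LinearMap.ker_eq_bot.1 (Submodule.ker_liftQ_eq_bot _ _ le_rfl le_rfl)
  let f : (Functor.const Zᵒᵖ).obj (ModuleCat.of R (R ⧸ I)) ⟶
      (Functor.const Zᵒᵖ).obj (ModuleCat.of R R) := (Functor.const Zᵒᵖ).map (ModuleCat.ofHom φ)
  have := hM.isLocallyInjective_whiskerLeft f fun U => hφ
  let y : (M.obj ⊗ (Functor.const Zᵒᵖ).obj (ModuleCat.of R (R ⧸ I))).obj (.op U) :=
    (x ⊗ₜ[R] (1 : R ⧸ I) : M.obj.obj (.op U) ⊗[R] (R ⧸ I))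
  have hy : (M.obj ◁ f).app (.op U) y = (M.obj ◁ f).app (.op U) 0 := by
    rw [map_zero]
    change x ⊗ₜ[R] φ 1 = 0
    rw [show φ 1 = c • 1 from (mul_one c).trans (mul_one c).symm, ← smul_tmul, hx, zero_tmul]
  refine ⟨_, Presheaf.equalizerSieve_mem J (M.obj ◁ f) y 0 hy, fun V g hg => ?_⟩
  have h1 : M.obj.map g.op x ⊗ₜ[R] (1 : R ⧸ I) = 0 := hg.trans (map_zero _)
  rw [← tensorQuotEquivQuotSMul_symm_mk, LinearEquiv.map_eq_zero_iff] at h1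
  exact (Submodule.Quotient.mk_eq_zero _).1 h1

end Flat

section Quotient

variable {Z : Type u} [SmallCategory Z] {J : GrothendieckTopology Z} {R : Type u} [CommRing R]

lemma sheaf_ext (M : Sheaf J (ModuleCat.{u} R)) {U : Z} {x y : M.obj.obj (.op U)}
    {S : Sieve U} (hS : S ∈ J U)
    (h : ∀ ⦃V : Z⦄ (g : V ⟶ U), S g → M.obj.map g.op x = M.obj.map g.op y) : x = y :=
  (Presheaf.IsSheaf.isSeparated M.property) U S hS x y h

lemma naturality_apply {F G : Zᵒᵖ ⥤ ModuleCat.{u} R} (q : F ⟶ G) {U V : Zᵒᵖ} (g : U ⟶ V)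
    (x : F.obj U) : q.app V (F.map g x) = G.map g (q.app U x) :=
  congrArg (fun f => f x) (congrArg ModuleCat.Hom.hom (q.naturality g))

lemma nsmul_id_app (M : Sheaf J (ModuleCat.{u} R)) (c : ℕ) (U : Zᵒᵖ) (y : M.obj.obj U) :
    (c • 𝟙 M : M ⟶ M).hom.app U y = c • y := by
  induction c with
  | zero => rw [zero_smul, zero_smul]; rfl
  | succ c ih => rw [succ_nsmul, succ_nsmul, ← ih]; rfl

variable {M N : Sheaf J (ModuleCat.{u} R)} {q : M ⟶ N} {c : ℕ}

lemma exists_local_lift [Epi q] (U : Z) (x : N.obj.obj (.op U)) :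
    ∃ S ∈ J U, ∀ ⦃V : Z⦄ (g : V ⟶ U), S g → ∃ y, q.hom.app (.op V) y = N.obj.map g.op x := by
  have h : Sheaf.IsLocallySurjective q := (Sheaf.isLocallySurjective_iff_epi' _ q).2 inferInstance
  exact ⟨_, h.imageSieve_mem x, fun V g hg => hg⟩

/-- The embedding of the quotient `N = M / c` into `M` induced by the multiplication by `c`, for
`c ^ 2 = 0` and `M` flat: it identifies `N` with the kernel of `M → N`. -/
lemma exists_embedding {h : (c • 𝟙 M) ≫ q = 0} (hq : IsColimit (CokernelCofork.ofπ q h))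
    (hc : (c : R) * c = 0) (hM : IsFlat M)
    (hN : ∀ r : R, (c : R) * r = 0 → ∀ U (x : N.obj.obj U), r • x = 0) :
    ∃ ι : N ⟶ M, q ≫ ι = c • 𝟙 M ∧ ι ≫ q = 0 ∧
      (∀ U, Function.Injective (ι.hom.app U)) ∧
      ∀ U (y : M.obj.obj U), q.hom.app U y = 0 → ∃ x, ι.hom.app U x = y := by
  have hepi : Epi q := Cofork.IsColimit.epi hq
  have hcM : ∀ U (y : M.obj.obj U), c • c • y = 0 := fun U y => by
    rw [← Nat.cast_smul_eq_nsmul R, ← Nat.cast_smul_eq_nsmul R, smul_smul, hc, zero_smul]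
  have hcc : (c • 𝟙 M) ≫ (c • 𝟙 M) = 0 := by
    ext U y
    change (c • 𝟙 M : M ⟶ M).hom.app U ((c • 𝟙 M : M ⟶ M).hom.app U y) = 0
    rw [nsmul_id_app, nsmul_id_app, hcM]
  let ι : N ⟶ M := hq.desc (CokernelCofork.ofπ _ hcc)
  have h1 : q ≫ ι = c • 𝟙 M := Cofork.IsColimit.π_desc hq
  have h2 : ι ≫ q = 0 := by
    rw [← cancel_epi q, ← Category.assoc, h1, h, comp_zero]
  have h1' : ∀ U (y : M.obj.obj U), ι.hom.app U (q.hom.app U y) = c • y := fun U y => by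
    rw [← nsmul_id_app, ← h1]
    rfl
  have h3 : ∀ U, Function.Injective (ι.hom.app U) := by
    rintro ⟨U⟩
    rw [injective_iff_map_eq_zero]
    intro x hx
    obtain ⟨S, hS, hS'⟩ := exists_local_lift (q := q) U x
    refine sheaf_ext N hS fun V g hg => ?_
    obtain ⟨y, hy⟩ := hS' g hg
    rw [map_zero, ← hy]
    have hy' : (c : R) • y = 0 := by
      rw [Nat.cast_smul_eq_nsmul, ← h1', hy, naturality_apply, hx, map_zero]
    obtain ⟨S', hS', hy''⟩ := hM.exists_mem_smul_top (c : R) V y hy'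
    refine sheaf_ext N hS' fun W g' hg' => ?_
    rw [map_zero, ← naturality_apply]
    refine Submodule.smul_induction_on (hy'' g' hg') (fun r hr z _ => ?_) fun z w hz hw => ?_
    · rw [map_smul]
      exact hN r hr _ _
    · rw [map_add, hz, hw, add_zero]
  refine ⟨ι, h1, h2, h3, fun U y hy => ?_⟩
  have hmono : Mono ι := Sheaf.mono_of_injective ι h3
  let S₁ : ShortComplex (Sheaf J (ModuleCat.{u} R)) := .mk (c • 𝟙 M) q h
  let S₂ : ShortComplex (Sheaf J (ModuleCat.{u} R)) := .mk ι q h2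
  let φ : S₁ ⟶ S₂ := { τ₁ := q, τ₂ := 𝟙 _, τ₃ := 𝟙 _, comm₁₂ := h1.trans (Category.comp_id _).symm }
  have e₁ : S₁.Exact := ShortComplex.exact_of_g_is_cokernel _ hq
  have e₂ : S₂.Exact := by
    have : Epi φ.τ₁ := hepi
    have : IsIso φ.τ₂ := inferInstanceAs (IsIso (𝟙 _))
    have : Mono φ.τ₃ := inferInstanceAs (Mono (𝟙 _))
    exact (ShortComplex.exact_iff_of_epi_of_isIso_of_mono φ).1 e₁
  have e₃ := e₂.map_of_mono_of_preservesKernel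
    (sheafToPresheaf J (ModuleCat.{u} R) ⋙ (evaluation _ _).obj U) hmono inferInstance
  exact (ShortComplex.moduleCat_exact_iff _).1 e₃ y hy

end Quotient

/-! ### Lifting data from a flat lift -/

lemma algSheaf_ext {Z : Type u} [SmallCategory Z] {J : GrothendieckTopology Z} {R : Type u}
    [CommRing R] (B : Sheaf J (AlgCat.{u} R)) {U : Z} {x y : B.obj.obj (.op U)} {S : Sieve U}
    (hS : S ∈ J U)
    (h : ∀ ⦃V : Z⦄ (g : V ⟶ U), S g → (B.obj.map g.op).hom x = (B.obj.map g.op).hom y) : x = y :=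
  sheaf_ext ((modSheaf R).obj B) hS h

section Lift

variable {k : Type u} [Field k] {p : ℕ} [Fact p.Prime] [CharP k p] [PerfectField k]
  {Z : Type u} [SmallCategory Z] {J : GrothendieckTopology Z} {A : Sheaf J (AlgCat.{u} k)}
  {A' : Sheaf J (AlgCat.{u} (TruncatedWittVector p 2 k))}
  (π : A' ⟶ restrictSheaf (wittRed p k) (frobTwist p A))

/-- The reduction on sections. -/
def redSection (U : Zᵒᵖ) : A'.obj.obj U →+* A.obj.obj U := (π.hom.app U).hom.toRingHom

lemma redSection_algebraMap (U : Zᵒᵖ) (r : TruncatedWittVector p 2 k) :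
    redSection π U (algebraMap _ _ r) = algebraMap k _ (frobInv p k (wittRed p k r)) :=
  (π.hom.app U).hom.commutes r

lemma redSection_map {U V : Zᵒᵖ} (g : U ⟶ V) (b : A'.obj.obj U) :
    redSection π V ((A'.obj.map g).hom b) = (A.obj.map g).hom (redSection π U b) :=
  congrArg (fun f => f b) (congrArg AlgCat.Hom.hom (π.hom.naturality g))

/-- An embedding of `A` into the lift `A'` that identifies `A` with the kernel of the reduction, and
whose composition with the reduction is the multiplication by `p` on `A'`. -/
structure KernelEmbedding where
  /-- the embedding -/
  inc (U : Zᵒᵖ) : A.obj.obj U →+ A'.obj.obj U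
  map_inc {U V : Zᵒᵖ} (g : U ⟶ V) (a : A.obj.obj U) :
    (A'.obj.map g).hom (inc U a) = inc V ((A.obj.map g).hom a)
  inc_injective (U) : Function.Injective (inc U)
  inc_red (U) (b : A'.obj.obj U) : inc U (redSection π U b) = p • b
  red_inc (U) (a : A.obj.obj U) : redSection π U (inc U a) = 0
  exists_inc (U) (b : A'.obj.obj U) (hb : redSection π U b = 0) : ∃ a, inc U a = b
  exists_red (U : Z) (a : A.obj.obj (.op U)) : ∃ S ∈ J U, ∀ ⦃V : Z⦄ (g : V ⟶ U), S g →
    ∃ b, redSection π (.op V) b = (A.obj.map g.op).hom a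

variable {π}

lemma exists_kernelEmbedding (hflat : IsFlat ((modSheaf (TruncatedWittVector p 2 k)).obj A'))
    (hπ : IsQuotientBy π p) : Nonempty (KernelEmbedding π) := by
  obtain ⟨h, ⟨hq⟩⟩ := hπ
  have hepi : Epi ((modSheaf _).map π) := Cofork.IsColimit.epi hq
  have hN : ∀ r : TruncatedWittVector p 2 k, p * r = 0 → ∀ U (x : A.obj.obj U),
      frobInv p k (wittRed p k r) • x = 0 := fun r hr U x => by
    rw [WittTwo.wittRed_eq_zero_of_p_mul hr, map_zero, zero_smul]
  obtain ⟨ι, h1, h2, h3, h4⟩ := exists_embedding hq WittTwo.p_mul_p hflat hN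
  exact ⟨{
    inc := fun U => (ι.hom.app U).hom.toAddMonoidHom
    map_inc := fun g a => (naturality_apply ι.hom g a).symm
    inc_injective := h3
    inc_red := fun U b => 
      (congrArg (fun f : (modSheaf _).obj A' ⟶ (modSheaf _).obj A' => f.hom.app U b) h1).trans
        (nsmul_id_app ((modSheaf _).obj A') p U b)
    red_inc := fun U a => congrArg (fun f => f.hom.app U a) h2
    exists_inc := h4
    exists_red := fun U a => exists_local_lift (q := (modSheaf _).map π) U a }⟩

namespace KernelEmbedding

variable (E : KernelEmbedding π)

lemma mul_inc (U : Zᵒᵖ) (b : A'.obj.obj U) (a : A.obj.obj U) :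
    b * E.inc U a = E.inc U (redSection π U b * a) := by
  obtain ⟨U⟩ := U
  obtain ⟨S, hS, hS'⟩ := E.exists_red U a
  refine algSheaf_ext A' hS fun V g hg => ?_
  obtain ⟨c, hc⟩ := hS' g hg
  rw [map_mul, E.map_inc, E.map_inc, map_mul, ← redSection_map, ← hc, ← map_mul, E.inc_red,
    E.inc_red, mul_smul_comm]

lemma inc_mul (U : Zᵒᵖ) (a : A.obj.obj U) (b : A'.obj.obj U) :
    E.inc U a * b = E.inc U (a * redSection π U b) := by
  obtain ⟨U⟩ := U
  obtain ⟨S, hS, hS'⟩ := E.exists_red U a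
  refine algSheaf_ext A' hS fun V g hg => ?_
  obtain ⟨c, hc⟩ := hS' g hg
  rw [map_mul, E.map_inc, E.map_inc, map_mul, ← redSection_map, ← hc, ← map_mul, E.inc_red,
    E.inc_red, smul_mul_assoc]

/-- The lifting data formed by the sections over an object. -/
def liftData (U : Zᵒᵖ) : LiftData p k where
  A := A.obj.obj U
  B := RingCat.of (A'.obj.obj U)
  red := redSection π U
  inc := E.inc U
  inc_injective := E.inc_injective U
  inc_red := E.inc_red U
  red_inc := E.red_inc U
  exists_inc := E.exists_inc U
  mul_inc := E.mul_inc U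
  inc_mul := E.inc_mul U
  teich := (algebraMap (TruncatedWittVector p 2 k) (A'.obj.obj U)).toMonoidHom.comp
    (WittTwo.teich p k)
  teich_comm c b := Algebra.commutes _ b
  red_teich c := (redSection_algebraMap π U _).trans (by rw [WittTwo.wittRed_teich])
  teich_add c d := by
    have h := congrArg (algebraMap (TruncatedWittVector p 2 k) (A'.obj.obj U))
      (WittTwo.teich_add (p := p) c d)
    rw [map_add (algebraMap _ _), map_add (algebraMap _ _), map_nsmul, map_sum] at h
    exact h

/-- The lifting data of sections form a presheaf. -/
def liftDataFunctor : Zᵒᵖ ⥤ LiftData p k where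
  obj U := E.liftData U
  map g :=
    { fA := A.obj.map g
      fB := (A'.obj.map g).hom.toRingHom
      red_fB := redSection_map π g
      inc_fA := fun a => (E.map_inc g a).symm
      fB_teich := fun c => (A'.obj.map g).hom.commutes (WittTwo.teich p k c) }
  map_id U := LiftData.Hom.ext (A.obj.map_id U) (RingHom.ext fun b =>
    congrArg (fun f => AlgCat.Hom.hom f b) (A'.obj.map_id U))
  map_comp g g' := LiftData.Hom.ext (A.obj.map_comp g g') (RingHom.ext fun b =>
    congrArg (fun f => AlgCat.Hom.hom f b) (A'.obj.map_comp g g'))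

end KernelEmbedding

end Lift

end NCHodge

end

theorem lemma3p8 {k : Type u} [Field k] (p : ℕ) [Fact p.Prime] [CharP k p] [PerfectField k]
    (hp : p ≠ 2) {Z : Type u} [SmallCategory Z] (J : GrothendieckTopology Z)
    (A : Sheaf J (AlgCat.{u} k))
    (A' : Sheaf J (AlgCat.{u} (TruncatedWittVector p 2 k)))
    (hflat : NCHodge.IsFlat ((NCHodge.modSheaf (TruncatedWittVector p 2 k)).obj A'))
    (π : A' ⟶ NCHodge.restrictSheaf (NCHodge.wittRed p k) (NCHodge.frobTwist p A))
    (hπ : NCHodge.IsQuotientBy π p) :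
    (NCHodge.dagger p A).IsFormal ∧
      (NCHodge.dagger p A).QuasiIsomorphic (NCHodge.squareZero (NCHodge.frobTwist p A)) := by
  obtain ⟨E⟩ := NCHodge.exists_kernelEmbedding hflat hπ
  have h : (NCHodge.dagger p A).QuasiIsomorphic (NCHodge.squareZero (NCHodge.frobTwist p A)) :=
    NCHodge.quasiIsomorphic_dagger_squareZero E.liftDataFunctor E.exists_red rfl
  exact ⟨⟨_, NCHodge.isHomologyOf_dagger A, h⟩, h⟩
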